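/- Let $k$ be an arbitrary field. A weighted projective line $\mathbb{X}$ over $k$ is given by a weight sequence $\mathbf{p}=(p_1\ge p_2\ge\dots\ge p_t)$ of integers $p_i\ge 2$ ($t\ge 1$) and pairwise distinct points $\lambda_1,\dots,\lambda_t\in\mathbb{P}^1(k)=k\cup\{\infty\}$, normalized such that $\lambda_1=\infty$, $\lambda_2=0$, $\lambda_3=1$. Its string group $L$ is the abelian group with generators $\vec{x}_1,\dots,\vec{x}_t$ and relations $p_1\vec{x}_1=\dots=p_t\vec{x}_t=:\vec{c}$; its dualizing element is $\vec{\omega}=(t-2)\vec{c}-\sum_{i=1}^t\vec{x}_i\in L$; its homogeneous coordinate algebra is the $L$-graded algebra $$S=k[X_1,\dots,X_t]/\bigl(X_i^{p_i}-(X_2^{p_2}-\lambda_iX_1^{p_1}),\ 3\le i\le t\bigr),\qquad \deg X_i=\vec{x}_i .$$ Put $p=\mathrm{lcm}(p_1,\dots,p_t)$. Assume that $\mathbb{X}$ is of tubular type, i.e. $\vec{\omega}$ is a torsion element of $L$; then $\mathbf{p}$ is one of $(2,2,2,2)$, $(3,3,3)$, $(4,4,2)$, $(6,3,2)$ and $\vec\omega$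 has order $p$. Let $R=k[X,Y,Z]/(f)$ be the associated $\mathbb{Z}$-graded algebra, with $X,Y,Z$ of degree one and $$f=\begin{cases}Y^2Z-X(X-Z)(X-\lambda Z),\ \lambda=\lambda_4, & \mathbf{p}=(2,2,2,2),\\ X^3-(Y^2Z-Z^2Y), & \mathbf{p}=(3,3,3),\\ Y^2Z-X(X-Z)(X+Z), & \mathbf{p}=(4,4,2),\\ Y^2Z-(X^3-Z^3), & \mathbf{p}=(6,3,2).\end{cases}$$ For a group $G$ and a $G$-graded algebra $A$, let $\mathrm{mod}^G\text{-}A$ be the category of finitely presented $G$-graded $A$-modules with degree-preserving homomorphisms, and let $\mathrm{qmod}^G\text{-}A$ be its quotient category by the Serre subcategory of modules of finite dimension over $k$. For an action of a group $\Gamma$ on a category $\mathcal{C}$ by auto-equivalences $F_g$ and coherent isomorphisms $\varepsilon_{g,h}\colon F_gF_h\to F_{gh}$, the equivariantization $\mathcal{C}^\Gamma$ has as objects the pairs $(M,\alpha)$ of an object $M$ and isomorphisms $\alpha_g\colon M\to F_g(M)$ with $\alpha_{gh}=(\varepsilon_{g,h})_M\circ F_g(\alpha_h)\circ\alpha_g$,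 and as morphisms $(M,\alpha)\to(N,\beta)$ the morphisms $\theta\colon M\to N$ with $\beta_g\circ\theta=F_g(\theta)\circ\alpha_g$ for all $g\in\Gamma$. (1) Let the subgroup $\mathbb{Z}\vec{\omega}\subseteq L$ act on $\mathrm{qmod}^L\text{-}S$ by degree shift, where $\vec{y}$ acts by $M\mapsto M(-\vec{y})$, with $M(\vec{z})_{\vec{x}}=M_{\vec{z}+\vec{x}}$. Then there is an equivalence of categories $$(\mathrm{qmod}^L\text{-}S)^{\mathbb{Z}\vec{\omega}}\;\simeq\;\mathrm{qmod}^{\mathbb{Z}}\text{-}R .$$ (2) Let $C_p=\langle g\mid g^p=1\rangle$ be the cyclic group of order $p$ and assume that $k$ is a splitting field of $C_p$, i.e. the group algebra $kC_p$ is isomorphic to a finite direct product of copies of $k$. Then $k$ contains a primitive $p$-th root of unity. For any such root $\zeta$, let $C_p$ act on $R$ by the graded algebra automorphisms determined by $$g.(X,Y,Z)=\begin{cases}(X,\zeta Y,Z), & \mathbf{p}=(2,2,2,2),\\ (\zeta^2X,Y,Z), & \mathbf{p}=(3,3,3),\\ (\zeta^2X,\zeta^3Y,Z), & \mathbf{p}=(4,4,2)\text{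 or }(6,3,2),\end{cases}$$ and let $C_p$ act on $\mathrm{qmod}^{\mathbb{Z}}\text{-}R$ by the induced twisting action, where $h$ acts by $M\mapsto M^{h^{-1}}$ (the module $M^\sigma$ is the graded space $M$ with $r\in R$ acting as $\sigma(r)$ does on $M$). Then there is an equivalence of categories $$\mathrm{qmod}^L\text{-}S\;\simeq\;(\mathrm{qmod}^{\mathbb{Z}}\text{-}R)^{C_p}.$$ -/

import Mathlib

open CategoryTheory

universe u v w u₁ v₁

/-! ## Group actions on categories and equivariantization -/

/-- An action of a group `G` on a category `C`: auto-equivalences `F g` together with natural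
isomorphisms `ε g h : F_g ∘ F_h ≅ F_{gh}` (note that `F h ⋙ F g` is `F_g ∘ F_h`) satisfying the
2-cocycle condition `ε_{gh,l} ∘ ε_{g,h} F_l = ε_{g,hl} ∘ F_g ε_{h,l}`.  The `eqToHom` is the
identification of `F_{g(hl)}` with `F_{(gh)l}`. -/
structure CatAction (G : Type w) [Group G] (C : Type u) [Category.{v} C] where
  F : G → C ⥤ C
  isEquivalence : ∀ g, (F g).IsEquivalence
  ε : ∀ g h, F h ⋙ F g ≅ F (g * h)
  cocycle : ∀ (g h l : G) (X : C),
    (ε g h).hom.app ((F l).obj X) ≫ (ε (g * h) l).hom.app X =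
      (F g).map ((ε h l).hom.app X) ≫ (ε g (h * l)).hom.app X ≫
        eqToHom (congrArg (fun m => (F m).obj X) (mul_assoc g h l).symm)

namespace CatAction

variable {G : Type w} [Group G] {C : Type u} [Category.{v} C]

/-- Functors `F g` with `F_g ∘ F_h ≅ F_{gh}` and `F_e ≅ Id` are auto-equivalences. -/
theorem isEquivalence_of_unit {F : G → C ⥤ C} (ε : ∀ g h, F h ⋙ F g ≅ F (g * h))
    (unit : F 1 ≅ 𝟭 C) (g : G) : (F g).IsEquivalence :=
  (CategoryTheory.Equivalence.mk (F g) (F g⁻¹)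
    (unit.symm ≪≫ eqToIso (congrArg F (inv_mul_cancel g).symm) ≪≫ (ε g⁻¹ g).symm)
    (ε g g⁻¹ ≪≫ eqToIso (congrArg F (mul_inv_cancel g)) ≪≫ unit)).isEquivalence_functor

/-- An equivariant object: an object `X` with isomorphisms `α_g : X ≅ F_g X` such that
`α_{gh} = (ε_{g,h})_X ∘ F_g(α_h) ∘ α_g`. -/
structure EquivariantObject (Φ : CatAction G C) where
  obj : C
  α : ∀ g : G, obj ≅ (Φ.F g).obj obj
  rel : ∀ g h : G,
    (α (g * h)).hom = (α g).hom ≫ (Φ.F g).map (α h).hom ≫ (Φ.ε g h).hom.app obj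

namespace EquivariantObject

variable {Φ : CatAction G C}

/-- A morphism of equivariant objects: `θ` with `β_g ∘ θ = F_g(θ) ∘ α_g` for all `g`. -/
@[ext]
structure Hom (X Y : EquivariantObject Φ) where
  hom : X.obj ⟶ Y.obj
  comm : ∀ g : G, hom ≫ (Y.α g).hom = (X.α g).hom ≫ (Φ.F g).map hom

/-- The equivariantization `C^G`. -/
instance : Category (EquivariantObject Φ) where
  Hom := Hom
  id X := ⟨𝟙 X.obj, fun g => by simp⟩
  comp f g := ⟨f.hom ≫ g.hom, fun a => by
    rw [Category.assoc, g.comm, ← Category.assoc, f.comm, Category.assoc, ← Functor.map_comp]⟩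
  id_comp f := Hom.ext (Category.id_comp f.hom)
  comp_id f := Hom.ext (Category.comp_id f.hom)
  assoc f g h := Hom.ext (Category.assoc f.hom g.hom h.hom)

end EquivariantObject

/-! ### The action induced on a localization -/

/-- A natural isomorphism of functors on the localization, from one on the original category. -/
noncomputable def isoExtension {W : MorphismProperty C} {D : Type u₁} [Category.{v₁} D] {F₁ F₂ : W.Localization ⥤ D}
    (τ : W.Q ⋙ F₁ ≅ W.Q ⋙ F₂) : F₁ ≅ F₂ where
  hom := Localization.Construction.natTransExtension τ.hom
  inv := Localization.Construction.natTransExtension τ.inv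
  hom_inv_id := Localization.Construction.natTrans_hcomp_injective (by ext X; simp)
  inv_hom_id := Localization.Construction.natTrans_hcomp_injective (by ext X; simp)

section Localize

variable (Φ : CatAction G C) (W : MorphismProperty C)

/-- The unit `F_e ≅ Id` of an action. -/
noncomputable def unit : Φ.F 1 ≅ 𝟭 C :=
  haveI := Φ.isEquivalence 1
  (Functor.rightUnitor _).symm ≪≫ Functor.isoWhiskerLeft (Φ.F 1) (Φ.F 1).asEquivalence.unitIso ≪≫
    (Functor.associator _ _ _).symm ≪≫
    Functor.isoWhiskerRight (Φ.ε 1 1 ≪≫ eqToIso (congrArg Φ.F (mul_one 1))) (Φ.F 1).inv ≪≫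
    (Φ.F 1).asEquivalence.unitIso.symm

theorem isInvertedBy (hW : ∀ (g : G) ⦃X Y : C⦄ (f : X ⟶ Y), W f → W ((Φ.F g).map f)) (g : G) :
    W.IsInvertedBy (Φ.F g ⋙ W.Q) :=
  fun _ _ f hf => W.Q_inverts _ (hW g f hf)

variable (hW : ∀ (g : G) ⦃X Y : C⦄ (f : X ⟶ Y), W f → W ((Φ.F g).map f))

/-- The endofunctor of the localization induced by `F g`, characterized by
`W.Q ⋙ localizeF g = F g ⋙ W.Q`. -/
noncomputable def localizeF (g : G) : W.Localization ⥤ W.Localization :=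
  Localization.Construction.lift (Φ.F g ⋙ W.Q) (Φ.isInvertedBy W hW g)

/-- The identification `F̄_g ∘ Q = Q ∘ F_g`, for the localization functor `Q`. -/
noncomputable def facIso (g : G) : W.Q ⋙ Φ.localizeF W hW g ≅ Φ.F g ⋙ W.Q :=
  eqToIso (Localization.Construction.fac _ _)

/-- The isomorphism of endofunctors of the localization induced by `ε g h`: up to the
identifications `facIso`, its component at `W.Q.obj X` is `W.Q.map ((ε g h).hom.app X)`. -/
noncomputable def localizeε (g h : G) :
    Φ.localizeF W hW h ⋙ Φ.localizeF W hW g ≅ Φ.localizeF W hW (g * h) :=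
  isoExtension
    ((Functor.associator _ _ _).symm ≪≫
      Functor.isoWhiskerRight (Φ.facIso W hW h) (Φ.localizeF W hW g) ≪≫
      Functor.associator _ _ _ ≪≫
      Functor.isoWhiskerLeft (Φ.F h) (Φ.facIso W hW g) ≪≫
      (Functor.associator _ _ _).symm ≪≫
      Functor.isoWhiskerRight (Φ.ε g h) W.Q ≪≫
      (Φ.facIso W hW (g * h)).symm)

theorem localizeε_app (g h : G) (X : C) :
    (Φ.localizeε W hW g h).hom.app (W.Q.obj X) =
      (Φ.localizeF W hW g).map ((Φ.facIso W hW h).hom.app X) ≫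
        (Φ.facIso W hW g).hom.app ((Φ.F h).obj X) ≫
        W.Q.map ((Φ.ε g h).hom.app X) ≫ (Φ.facIso W hW (g * h)).inv.app X := by
  simp [localizeε, isoExtension]

/-- The isomorphism between the endofunctor of the localization induced by `F_e` and the
identity. -/
noncomputable def localizeUnit : Φ.localizeF W hW 1 ≅ 𝟭 W.Localization :=
  isoExtension (Φ.facIso W hW 1 ≪≫ Functor.isoWhiskerRight Φ.unit W.Q ≪≫
    Functor.leftUnitor _ ≪≫ (Functor.rightUnitor _).symm)

theorem facIso_inv_eqToHom {a b : G} (h : a = b) (X : C) :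
    (Φ.facIso W hW a).inv.app X ≫
        eqToHom (congrArg (fun m => (Φ.localizeF W hW m).obj (W.Q.obj X)) h) =
      W.Q.map (eqToHom (congrArg (fun m => (Φ.F m).obj X) h)) ≫
        (Φ.facIso W hW b).inv.app X := by
  subst h
  simp

/-- If all functors `F g` of an action preserve the class `W`, then the action passes to the
localization with respect to `W`. -/
noncomputable def localize : CatAction G W.Localization where
  F := Φ.localizeF W hW
  isEquivalence := isEquivalence_of_unit (Φ.localizeε W hW) (Φ.localizeUnit W hW)
  ε := Φ.localizeε W hW
  cocycle g h l Y := by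
    obtain ⟨X, rfl⟩ := (Localization.Construction.objEquiv W).surjective Y
    change (Φ.localizeε W hW g h).hom.app ((Φ.localizeF W hW l).obj (W.Q.obj X)) ≫
        (Φ.localizeε W hW (g * h) l).hom.app (W.Q.obj X) =
      (Φ.localizeF W hW g).map ((Φ.localizeε W hW h l).hom.app (W.Q.obj X)) ≫
        (Φ.localizeε W hW g (h * l)).hom.app (W.Q.obj X) ≫ eqToHom _
    have nat := (Φ.localizeε W hW g h).hom.naturality ((Φ.facIso W hW l).hom.app X)
    have nat' : (Φ.localizeε W hW g h).hom.app ((Φ.localizeF W hW l).obj (W.Q.obj X)) =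
        (Φ.localizeF W hW g).map ((Φ.localizeF W hW h).map ((Φ.facIso W hW l).hom.app X)) ≫
          (Φ.localizeε W hW g h).hom.app (W.Q.obj ((Φ.F l).obj X)) ≫
          (Φ.localizeF W hW (g * h)).map ((Φ.facIso W hW l).inv.app X) := by
      have e : (Φ.facIso W hW l).hom.app X ≫ (Φ.facIso W hW l).inv.app X = 𝟙 _ := by simp
      rw [← Category.assoc]
      refine Eq.trans ?_ (congrArg (· ≫ _) nat).symm
      simp only [Category.assoc]
      rw [← Functor.map_comp, e, CategoryTheory.Functor.map_id]
      exact (Category.comp_id _).symm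
    have nat2 : (Φ.localizeF W hW g).map (W.Q.map ((Φ.ε h l).hom.app X)) ≫
        (Φ.facIso W hW g).hom.app ((Φ.F (h * l)).obj X) =
        (Φ.facIso W hW g).hom.app ((Φ.F h).obj ((Φ.F l).obj X)) ≫
          W.Q.map ((Φ.F g).map ((Φ.ε h l).hom.app X)) :=
      (Φ.facIso W hW g).hom.naturality ((Φ.ε h l).hom.app X)
    have co := congrArg W.Q.map (Φ.cocycle g h l X)
    simp only [Functor.map_comp] at co
    have eqh := facIso_inv_eqToHom Φ W hW (mul_assoc g h l).symm X
    have e1 (m : G) (Z : C) : (Φ.facIso W hW m).inv.app Z ≫ (Φ.facIso W hW m).hom.app Z = 𝟙 _ := by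
      simp
    rw [nat', localizeε_app, localizeε_app, localizeε_app, localizeε_app]
    simp only [Functor.map_comp, Category.assoc]
    have c1 (a m : G) (Z : C) {T : W.Localization}
        (t : (Φ.localizeF W hW a).obj (W.Q.obj ((Φ.F m).obj Z)) ⟶ T) :
        (Φ.localizeF W hW a).map ((Φ.facIso W hW m).inv.app Z) ≫
          (Φ.localizeF W hW a).map ((Φ.facIso W hW m).hom.app Z) ≫ t = t := by
      rw [← Category.assoc, ← Functor.map_comp, e1, CategoryTheory.Functor.map_id]
      exact Category.id_comp t
    have c2 (m : G) (Z : C) {T : W.Localization} (t : W.Q.obj ((Φ.F m).obj Z) ⟶ T) :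
        (Φ.facIso W hW m).inv.app Z ≫ (Φ.facIso W hW m).hom.app Z ≫ t = t := by
      rw [← Category.assoc, e1]
      exact Category.id_comp t
    refine congrArg (_ ≫ ·) (congrArg (_ ≫ ·) ?_)
    rw [eqh, c1, c1, reassoc_of% nat2, ← reassoc_of% co, c2]

end Localize

end CatAction

/-! ## Graded modules and the quotient category `qmod` -/

section GradedModules

variable {k A : Type u} [Field k] [CommRing A] [Algebra k A] {G : Type w} [AddCommGroup G]

/-- A finitely presented `G`-graded module over the commutative `k`-algebra `A` with grading
`𝒜`: an `A`-module that is the internal direct sum of its homogeneous components `comp g`, with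
`𝒜 g • comp h ⊆ comp (g + h)`.  As `A` is commutative, left and right modules coincide. -/
structure GradedModFP (𝒜 : G → Submodule k A) where
  carrier : Type u
  [addCommGroup : AddCommGroup carrier]
  [moduleBase : Module k carrier]
  [module : Module A carrier]
  [isScalarTower : IsScalarTower k A carrier]
  comp : G → Submodule k carrier
  indep : iSupIndep comp
  iSup_comp : ⨆ g, comp g = ⊤
  smul_mem : ∀ {g h : G} {a : A} {x : carrier}, a ∈ 𝒜 g → x ∈ comp h → a • x ∈ comp (g + h)
  finitePresentation : Module.FinitePresentation A carrier

namespace GradedModFP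

attribute [instance] addCommGroup moduleBase module isScalarTower

variable {𝒜 : G → Submodule k A}

/-- Morphisms of graded modules: module homomorphisms preserving degrees. -/
@[ext]
structure Hom (X Y : GradedModFP 𝒜) where
  toLinearMap : X.carrier →ₗ[A] Y.carrier
  map_mem : ∀ {g : G} {x : X.carrier}, x ∈ X.comp g → toLinearMap x ∈ Y.comp g

/-- The category `mod^G-A` of finitely presented graded modules. -/
instance : Category (GradedModFP 𝒜) where
  Hom := Hom
  id X := ⟨LinearMap.id, fun h => h⟩
  comp f g := ⟨g.toLinearMap ∘ₗ f.toLinearMap, fun h => g.map_mem (f.map_mem h)⟩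

@[ext]
theorem hom_ext {X Y : GradedModFP 𝒜} {f g : X ⟶ Y} (h : Hom.toLinearMap f = Hom.toLinearMap g) :
    f = g := Hom.ext h

@[simp]
theorem id_toLinearMap (X : GradedModFP 𝒜) : Hom.toLinearMap (𝟙 X) = LinearMap.id := rfl

@[simp]
theorem comp_toLinearMap {X Y Z : GradedModFP 𝒜} (f : X ⟶ Y) (g : Y ⟶ Z) :
    Hom.toLinearMap (f ≫ g) = Hom.toLinearMap g ∘ₗ Hom.toLinearMap f := rfl

/-- The underlying `k`-linear map of a morphism of graded modules. -/
def Hom.kLinearMap {X Y : GradedModFP 𝒜} (f : X ⟶ Y) : X.carrier →ₗ[k] Y.carrier :=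
  (Hom.toLinearMap f).restrictScalars k

variable (𝒜) in
/-- The morphisms whose kernel and cokernel are finite dimensional over `k`, i.e. belong to the
Serre subcategory `mod₀^G-A` of finite dimensional modules. -/
def isoModFD : MorphismProperty (GradedModFP 𝒜) := fun _ Y f =>
  FiniteDimensional k (LinearMap.ker (Hom.kLinearMap f)) ∧
    FiniteDimensional k (Y.carrier ⧸ LinearMap.range (Hom.kLinearMap f))

end GradedModFP

/-- The quotient category `qmod^G-A = mod^G-A / mod₀^G-A`, i.e. the localization of `mod^G-A` at
the morphisms whose kernel and cokernel are finite dimensional. -/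
abbrev QMod (𝒜 : G → Submodule k A) := (GradedModFP.isoModFD 𝒜).Localization

/-! ### The degree-shift action -/

namespace GradedModFP

variable {𝒜 : G → Submodule k A}

/-- The shifted module `X(a)`, with `X(a)_g = X_{a+g}`. -/
abbrev shiftObj (a : G) (X : GradedModFP 𝒜) : GradedModFP 𝒜 where
  carrier := X.carrier
  comp g := X.comp (a + g)
  indep := X.indep.comp (add_right_injective a)
  iSup_comp := ((Equiv.addLeft a).iSup_comp (g := X.comp)).trans X.iSup_comp
  smul_mem {g h b x} hb hx := by
    rw [add_left_comm]
    exact X.smul_mem hb hx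
  finitePresentation := X.finitePresentation

/-- The degree-shift functor `X ↦ X(a)`. -/
def shift (a : G) : GradedModFP 𝒜 ⥤ GradedModFP 𝒜 where
  obj := shiftObj a
  map {X Y} f := Hom.mk (X := shiftObj a X) (Y := shiftObj a Y)
    (Hom.toLinearMap (X := X) (Y := Y) f) (fun h => Hom.map_mem (X := X) (Y := Y) f h)

/-- `X(0) = X`. -/
def shiftZero : shift (𝒜 := 𝒜) 0 ≅ 𝟭 _ :=
  NatIso.ofComponents (fun X =>
    { hom := ⟨LinearMap.id, fun {g x} h => by
        change x ∈ X.comp (0 + g) at h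
        rwa [zero_add] at h⟩
      inv := ⟨LinearMap.id, fun {g x} h => by
        change x ∈ X.comp (0 + g)
        rwa [zero_add]⟩ }) (fun f => hom_ext (by rfl))

/-- `X(b)(a) = X(c)` for `a + b = c`. -/
def shiftAdd {a b c : G} (hc : a + b = c) :
    shift (𝒜 := 𝒜) b ⋙ shift a ≅ shift c :=
  NatIso.ofComponents (fun X =>
    { hom := ⟨LinearMap.id, fun {g x} h => by
        change x ∈ X.comp (b + (a + g)) at h
        change x ∈ X.comp (c + g)
        rwa [← add_assoc, add_comm b, hc] at h⟩
      inv := ⟨LinearMap.id, fun {g x} h => by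
        change x ∈ X.comp (c + g) at h
        change x ∈ X.comp (b + (a + g))
        rwa [← add_assoc, add_comm b, hc]⟩ }) (fun f => hom_ext (by rfl))

theorem shift_eqToHom {H : Type*} (F : H → G) {a b : H} (h : a = b) (X : GradedModFP 𝒜) :
    Hom.toLinearMap (eqToHom (congrArg (fun m => (shift (𝒜 := 𝒜) (F m)).obj X) h)) =
      (LinearMap.id : X.carrier →ₗ[A] X.carrier) := by
  subst h
  rfl

variable (𝒜) in
/-- The degree-shift action of a subgroup `H` of `G` on `mod^G-A`: the element `h` acts by
`X ↦ X(-h)`. -/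
def shiftAction (H : AddSubgroup G) : CatAction (Multiplicative H) (GradedModFP 𝒜) where
  F h := shift (-(h.toAdd : G))
  isEquivalence := CatAction.isEquivalence_of_unit
    (F := fun h : Multiplicative H => shift (𝒜 := 𝒜) (-(h.toAdd : G)))
    (fun g h => shiftAdd (by simp [add_comm]))
    (eqToIso (by simp) ≪≫ shiftZero)
  ε g h := shiftAdd (by simp [add_comm])
  cocycle g h l X := by
    apply hom_ext
    rw [comp_toLinearMap, comp_toLinearMap, comp_toLinearMap]
    erw [shift_eqToHom (𝒜 := 𝒜) (fun m : Multiplicative H => (-(m.toAdd : G)))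
      (mul_assoc g h l).symm X]
    rfl

theorem shiftAction_isoModFD (H : AddSubgroup G) (h : Multiplicative H)
    ⦃X Y : GradedModFP 𝒜⦄ (f : X ⟶ Y) (hf : isoModFD 𝒜 f) :
    isoModFD 𝒜 (((shiftAction 𝒜 H).F h).map f) := hf

end GradedModFP

/-- The degree-shift action of a subgroup `H` of `G` on `qmod^G-A`. -/
noncomputable def qmodShiftAction (𝒜 : G → Submodule k A) (H : AddSubgroup G) :
    CatAction (Multiplicative H) (QMod 𝒜) :=
  (GradedModFP.shiftAction 𝒜 H).localize (GradedModFP.isoModFD 𝒜)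
    (GradedModFP.shiftAction_isoModFD H)

/-! ### The twisting action -/

/-- The automorphisms of `A` as a `G`-graded `k`-algebra. -/
def gradedAut (𝒜 : G → Submodule k A) : Subgroup (A ≃ₐ[k] A) where
  carrier := {σ | ∀ g, (𝒜 g).map (σ : A →ₗ[k] A) = 𝒜 g}
  one_mem' g := Submodule.map_id (𝒜 g)
  mul_mem' {σ τ} hσ hτ g := by
    have : ((σ * τ : A ≃ₐ[k] A) : A →ₗ[k] A) = (σ : A →ₗ[k] A) ∘ₗ (τ : A →ₗ[k] A) := rfl
    rw [this, Submodule.map_comp, hτ g, hσ g]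
  inv_mem' {σ} hσ g := by
    conv_lhs => rw [← hσ g]
    rw [← Submodule.map_comp]
    have : ((σ⁻¹ : A ≃ₐ[k] A) : A →ₗ[k] A) ∘ₗ (σ : A →ₗ[k] A) = LinearMap.id := by
      ext x
      exact σ.symm_apply_apply x
    rw [this, Submodule.map_id]

namespace GradedModFP

variable {𝒜 : G → Submodule k A}

theorem twist_smul_assoc (σ : gradedAut 𝒜) (X : GradedModFP 𝒜) (c : k) (a : A) (x : X.carrier) :
    σ.1 (c • a) • x = c • (σ.1 a • x) := by
  rw [map_smul, smul_assoc]

variable [IsNoetherianRing A]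

theorem twist_finitePresentation (σ : gradedAut 𝒜) (X : GradedModFP 𝒜) :
    @Module.FinitePresentation A X.carrier _ _ (Module.compHom X.carrier (σ.1 : A →+* A)) := by
  have fin : Module.Finite A X.carrier :=
    haveI := X.finitePresentation
    inferInstance
  have surj (x : X.carrier) (a : A) : a • x = σ.1 (σ.1.symm a) • x := by
    rw [AlgEquiv.apply_symm_apply]
  let m := Module.compHom X.carrier (σ.1 : A →+* A)
  have fin' : @Module.Finite A X.carrier _ _ m :=
    @Module.Finite.of_surjective A X.carrier _ _ X.module A X.carrier _ _ m
      (σ.1.symm : A →+* A) fin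
      (@LinearMap.mk _ _ _ _ _ _ _ _ _ X.module m ⟨id, fun _ _ => rfl⟩ fun a x => surj x a)
      Function.surjective_id
  exact @Module.finitePresentation_of_finite A X.carrier _ _ m _ fin'

/-- The twisted module `X^σ`: the same graded space, on which `a` acts as `σ a` does on `X`. -/
abbrev twistObj (σ : gradedAut 𝒜) (X : GradedModFP 𝒜) : GradedModFP 𝒜 where
  carrier := X.carrier
  module := Module.compHom X.carrier (σ.1 : A →+* A)
  isScalarTower :=
    letI := Module.compHom X.carrier (σ.1 : A →+* A)
    ⟨fun c a x => twist_smul_assoc σ X c a x⟩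
  comp := X.comp
  indep := X.indep
  iSup_comp := X.iSup_comp
  smul_mem {g h a x} ha hx :=
    X.smul_mem (a := σ.1 a) (by rw [← σ.2 g]; exact Submodule.mem_map_of_mem ha) hx
  finitePresentation := twist_finitePresentation σ X

/-- The twisting functor `X ↦ X^σ`. -/
def twist (σ : gradedAut 𝒜) : GradedModFP 𝒜 ⥤ GradedModFP 𝒜 where
  obj := twistObj σ
  map {X Y} f := Hom.mk (X := twistObj σ X) (Y := twistObj σ Y)
    { toFun := Hom.toLinearMap (X := X) (Y := Y) f
      map_add' := map_add _
      map_smul' := fun a x => (Hom.toLinearMap (X := X) (Y := Y) f).map_smul (σ.1 a) x }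
    (fun h => Hom.map_mem (X := X) (Y := Y) f h)

/-- `X^1 = X`. -/
def twistOne : twist (1 : gradedAut 𝒜) ≅ 𝟭 _ :=
  NatIso.ofComponents (fun X =>
    { hom := Hom.mk (X := twistObj 1 X) (Y := X)
        { toFun := id, map_add' := fun _ _ => rfl, map_smul' := fun _ _ => rfl } (fun h => h)
      inv := Hom.mk (X := X) (Y := twistObj 1 X)
        { toFun := id, map_add' := fun _ _ => rfl, map_smul' := fun _ _ => rfl } (fun h => h) })
    (fun f => hom_ext (by rfl))

/-- `(X^τ)^σ = X^ρ` for `τ * σ = ρ`. -/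
def twistMul {σ τ ρ : gradedAut 𝒜} (h : τ * σ = ρ) : twist τ ⋙ twist σ ≅ twist ρ :=
  NatIso.ofComponents (fun X =>
    { hom := Hom.mk (X := twistObj σ (twistObj τ X)) (Y := twistObj ρ X)
        { toFun := id, map_add' := fun _ _ => rfl, map_smul' := fun _ _ => by subst h; rfl }
        (fun h => h)
      inv := Hom.mk (X := twistObj ρ X) (Y := twistObj σ (twistObj τ X))
        { toFun := id, map_add' := fun _ _ => rfl, map_smul' := fun _ _ => by subst h; rfl }
        (fun h => h) })
    (fun f => hom_ext (by rfl))

theorem twist_eqToHom {H : Type*} (F : H → gradedAut 𝒜) {a b : H} (h : a = b)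
    (X : GradedModFP 𝒜) (x : X.carrier) :
    Hom.toLinearMap (eqToHom (congrArg (fun m => (twist (𝒜 := 𝒜) (F m)).obj X) h)) x = x := by
  subst h
  rfl

/-- The twisting action on `mod^G-A` of a group `H` acting on `A` by graded automorphisms: the
element `h` acts by `X ↦ X^{h⁻¹}`. -/
def twistAction {H : Type*} [Group H] (ρ : H →* gradedAut 𝒜) : CatAction H (GradedModFP 𝒜) where
  F h := twist (ρ h⁻¹)
  isEquivalence := CatAction.isEquivalence_of_unit (F := fun h : H => twist (ρ h⁻¹))
    (fun g h => twistMul (by simp)) (eqToIso (by simp) ≪≫ twistOne)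
  ε g h := twistMul (by simp)
  cocycle g h l X := by
    apply hom_ext
    rw [comp_toLinearMap, comp_toLinearMap, comp_toLinearMap]
    refine LinearMap.ext fun x => Eq.symm ?_
    exact twist_eqToHom (fun m : H => ρ m⁻¹) (mul_assoc g h l).symm X x

theorem twistAction_isoModFD {H : Type*} [Group H] (ρ : H →* gradedAut 𝒜) (h : H)
    ⦃X Y : GradedModFP 𝒜⦄ (f : X ⟶ Y) (hf : isoModFD 𝒜 f) :
    isoModFD 𝒜 (((twistAction ρ).F h).map f) := hf

end GradedModFP

/-- The twisting action on `qmod^G-A` of a group `H` acting on `A` by graded automorphisms. -/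
noncomputable def qmodTwistAction {𝒜 : G → Submodule k A} [IsNoetherianRing A] {H : Type*}
    [Group H] (ρ : H →* gradedAut 𝒜) : CatAction H (QMod 𝒜) :=
  (GradedModFP.twistAction ρ).localize (GradedModFP.isoModFD 𝒜)
    (GradedModFP.twistAction_isoModFD ρ)

end GradedModules

/-! ## Quotients of graded polynomial rings -/

section Polynomial

variable {k : Type u} [Field k] {ι : Type} {G : Type w} [AddCommGroup G]

/-- The homogeneous components of `k[X_i]/I` when `X_i` has degree `deg i`: the component of
degree `g` is the image of the space of polynomials that are homogeneous of degree `g`. -/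
noncomputable def quotientGrading (I : Ideal (MvPolynomial ι k)) (deg : ι → G) (g : G) :
    Submodule k (MvPolynomial ι k ⧸ I) :=
  (MvPolynomial.weightedHomogeneousSubmodule k deg g).map (Ideal.Quotient.mkₐ k I).toLinearMap

/-- The automorphism `X_i ↦ s_i X_i` of the polynomial ring. -/
noncomputable def diagAut (s : ι → kˣ) : MvPolynomial ι k ≃ₐ[k] MvPolynomial ι k :=
  AlgEquiv.ofAlgHom
    (MvPolynomial.aeval fun i => MvPolynomial.C (s i : k) * MvPolynomial.X i)
    (MvPolynomial.aeval fun i => MvPolynomial.C ((s i)⁻¹ : kˣ).val * MvPolynomial.X i)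
    (by
      ext i : 1
      simp only [AlgHom.comp_apply, MvPolynomial.aeval_X, map_mul, MvPolynomial.algHom_C,
        AlgHom.id_apply, MvPolynomial.algebraMap_eq]
      rw [← mul_assoc, ← MvPolynomial.C_mul, Units.inv_mul, MvPolynomial.C_1, one_mul])
    (by
      ext i : 1
      simp only [AlgHom.comp_apply, MvPolynomial.aeval_X, map_mul, MvPolynomial.algHom_C,
        AlgHom.id_apply, MvPolynomial.algebraMap_eq]
      rw [← mul_assoc, ← MvPolynomial.C_mul, Units.mul_inv, MvPolynomial.C_1, one_mul])

@[simp]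
theorem diagAut_X (s : ι → kˣ) (i : ι) :
    diagAut s (MvPolynomial.X i) = MvPolynomial.C (s i : k) * MvPolynomial.X i := by
  simp [diagAut]

@[simp]
theorem diagAut_C (s : ι → kˣ) (a : k) :
    diagAut s (MvPolynomial.C a) = MvPolynomial.C a := (diagAut s).commutes a

theorem diagAut_one : diagAut (1 : ι → kˣ) = 1 := by
  refine AlgEquiv.ext fun x => ?_
  have h : (diagAut (1 : ι → kˣ)).toAlgHom = AlgHom.id k _ := by
    ext i : 1
    simp
  exact DFunLike.congr_fun h x

theorem diagAut_mul (s s' : ι → kˣ) : diagAut (s * s') = diagAut s * diagAut s' := by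
  refine AlgEquiv.ext fun x => ?_
  have h : (diagAut (s * s')).toAlgHom = ((diagAut s).toAlgHom.comp (diagAut s').toAlgHom) := by
    ext i : 1
    simp only [AlgHom.comp_apply, AlgEquiv.toAlgHom_apply, diagAut_X, map_mul, diagAut_C,
      Pi.mul_apply, Units.val_mul]
    ring
  exact DFunLike.congr_fun h x

theorem diagAut_pow (s : ι → kˣ) (n : ℕ) : diagAut (s ^ n) = diagAut s ^ n := by
  induction n with
  | zero => rw [pow_zero, pow_zero, diagAut_one]
  | succ n ih => rw [pow_succ, pow_succ, diagAut_mul, ih]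

theorem diagAut_symm (s : ι → kˣ) : (diagAut s).symm = diagAut s⁻¹ := by
  refine AlgEquiv.ext fun x => ?_
  rw [AlgEquiv.symm_apply_eq, ← AlgEquiv.mul_apply, ← diagAut_mul, mul_inv_cancel, diagAut_one]
  rfl

theorem coeff_diagAut (s : ι → kˣ) (f : MvPolynomial ι k) (d : ι →₀ ℕ) :
    (diagAut s f).coeff d = (d.prod fun i n => (s i : k) ^ n) * f.coeff d := by
  classical
  induction f using MvPolynomial.induction_on' with
  | monomial e a =>
    have : diagAut s (MvPolynomial.monomial e a) =
        MvPolynomial.monomial e ((e.prod fun i n => (s i : k) ^ n) * a) := by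
      rw [MvPolynomial.monomial_eq, MvPolynomial.monomial_eq, map_mul, Finsupp.prod, map_prod]
      simp only [map_pow, diagAut_X, mul_pow, Finset.prod_mul_distrib, Finsupp.prod,
        MvPolynomial.C_mul, map_prod]
      rw [show diagAut s (MvPolynomial.C a) = MvPolynomial.C a from (diagAut s).commutes a]
      ring
    rw [this, MvPolynomial.coeff_monomial, MvPolynomial.coeff_monomial]
    split_ifs with h
    · rw [h]
    · rw [mul_zero]
  | add p q hp hq => rw [map_add, MvPolynomial.coeff_add, hp, hq, MvPolynomial.coeff_add, mul_add]

theorem diagAut_map_le (s : ι → kˣ) (deg : ι → G) (g : G) :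
    (MvPolynomial.weightedHomogeneousSubmodule k deg g).map (diagAut s : _ →ₗ[k] _) ≤
      MvPolynomial.weightedHomogeneousSubmodule k deg g := by
  rintro _ ⟨f, hf, rfl⟩ d hd
  refine hf (d := d) fun h => hd ?_
  change (diagAut s f).coeff d = 0
  rw [coeff_diagAut, h, mul_zero]

theorem diagAut_map (s : ι → kˣ) (deg : ι → G) (g : G) :
    (MvPolynomial.weightedHomogeneousSubmodule k deg g).map (diagAut s : _ →ₗ[k] _) =
      MvPolynomial.weightedHomogeneousSubmodule k deg g := by
  refine le_antisymm (diagAut_map_le s deg g) fun f hf => ?_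
  refine ⟨diagAut s⁻¹ f, diagAut_map_le s⁻¹ deg g ⟨f, hf, rfl⟩, ?_⟩
  rw [← diagAut_symm]
  exact (diagAut s).apply_symm_apply f

/-- If `f` is an eigenvector of the automorphism `X_i ↦ s_i X_i`, this is the induced graded
automorphism of `k[X_i]/(f)`. -/
noncomputable def diagQuotientAut (f : MvPolynomial ι k) (deg : ι → G) (s : ι → kˣ)
    (hs : ∃ u : kˣ, diagAut s f = MvPolynomial.C (u : k) * f) :
    gradedAut (quotientGrading (Ideal.span {f}) deg) :=
  ⟨Ideal.quotientEquivAlg (Ideal.span {f}) (Ideal.span {f}) (diagAut s) (by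
      obtain ⟨u, hu⟩ := hs
      rw [Ideal.map_span, Set.image_singleton]
      change _ = Ideal.span {diagAut s f}
      rw [hu]
      exact (Ideal.span_singleton_mul_left_unit
        ((Units.isUnit u).map (MvPolynomial.C (σ := ι))) f).symm),
    fun g => by
      unfold quotientGrading
      rw [← Submodule.map_comp]
      conv_rhs => rw [← diagAut_map s deg g, ← Submodule.map_comp]
      rfl⟩

theorem diagQuotientAut_pow_mk (f : MvPolynomial ι k) (deg : ι → G) (s : ι → kˣ)
    (hs : ∃ u : kˣ, diagAut s f = MvPolynomial.C (u : k) * f) (n : ℕ) (x : MvPolynomial ι k) :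
    (diagQuotientAut f deg s hs ^ n).1 (Ideal.Quotient.mk (Ideal.span {f}) x) =
      Ideal.Quotient.mk (Ideal.span {f}) (diagAut (s ^ n) x) := by
  induction n generalizing x with
  | zero => rw [pow_zero, pow_zero, diagAut_one]; rfl
  | succ n ih =>
    rw [pow_succ, pow_succ, diagAut_mul, AlgEquiv.mul_apply, ← ih]
    rfl

end Polynomial

/-! ## Weighted projective lines -/

/-- A weighted projective line over `k`: a weight sequence `p₁ ≥ ⋯ ≥ p_t` of integers `≥ 2`,
`t ≥ 1`, and a parameter sequence of pairwise distinct rational points of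
`ℙ¹(k) = k ∪ {∞}`, normalized such that `λ₁ = ∞`, `λ₂ = 0`, `λ₃ = 1`.
Indices start at `0` instead of `1`. -/
structure WeightedProjectiveLine (k : Type u) [Field k] where
  t : ℕ
  t_pos : 0 < t
  p : Fin t → ℕ
  two_le : ∀ i, 2 ≤ p i
  antitone : Antitone p
  param : Fin t → OnePoint k
  param_injective : Function.Injective param
  param_zero : ∀ i : Fin t, (i : ℕ) = 0 → param i = OnePoint.infty
  param_one : ∀ i : Fin t, (i : ℕ) = 1 → param i = ((0 : k) : OnePoint k)
  param_two : ∀ i : Fin t, (i : ℕ) = 2 → param i = ((1 : k) : OnePoint k)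

namespace WeightedProjectiveLine

variable {k : Type u} [Field k] (X : WeightedProjectiveLine k)

/-- The string group `L(p)`: generators `x_i` with relations `p_i x_i = p_j x_j`. -/
abbrev StringGroup : Type :=
  (Fin X.t → ℤ) ⧸ AddSubgroup.closure
    {r : Fin X.t → ℤ | ∃ i j, r = Pi.single i (X.p i : ℤ) - Pi.single j (X.p j : ℤ)}

/-- The generators `x_i` of the string group. -/
def gen (i : Fin X.t) : X.StringGroup := QuotientAddGroup.mk (Pi.single i 1)

/-- The canonical element `c = p₁ x₁ = ⋯ = p_t x_t`. -/
def canonical : X.StringGroup := X.p ⟨0, X.t_pos⟩ • X.gen ⟨0, X.t_pos⟩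

/-- The dualizing element `ω = (t - 2) c - ∑ x_i`. -/
def dualizing : X.StringGroup := ((X.t : ℤ) - 2) • X.canonical - ∑ i, X.gen i

/-- `X` is of tubular type if the dualizing element is torsion. -/
def IsTubular : Prop := IsOfFinAddOrder X.dualizing

/-- The parameters `λ_i` as elements of `k`; only used for `i ≠ 0`, when `λ_i ≠ ∞`. -/
def affineParam (i : Fin X.t) : k := (X.param i).elim 0 id

/-- The ideal generated by `X_i ^ p_i - (X₂ ^ p₂ - λ_i X₁ ^ p₁)`, `3 ≤ i ≤ t`. -/
noncomputable def coordIdeal : Ideal (MvPolynomial (Fin X.t) k) :=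
  Ideal.span {f | ∃ (i : Fin X.t) (hi : 2 ≤ (i : ℕ)),
    f = MvPolynomial.X i ^ X.p i -
      (MvPolynomial.X ⟨1, by omega⟩ ^ X.p ⟨1, by omega⟩ -
        MvPolynomial.C (X.affineParam i) *
          MvPolynomial.X ⟨0, by omega⟩ ^ X.p ⟨0, by omega⟩)}

/-- The homogeneous coordinate algebra `S`. -/
abbrev CoordAlgebra : Type u := MvPolynomial (Fin X.t) k ⧸ X.coordIdeal

/-- The `L(p)`-grading of `S` with `deg x_i = x_i`. -/
noncomputable def coordGrading : X.StringGroup → Submodule k X.CoordAlgebra :=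
  quotientGrading X.coordIdeal X.gen

/-- The weight sequence as a list. -/
def weights : List ℕ := List.ofFn X.p

/-- `p = lcm(p₁, …, p_t)`. -/
def lcmWeights : ℕ := X.weights.foldr Nat.lcm 1

/-- The parameter `λ = λ₄` (for `t ≥ 4`). -/
def lam : k := if h : 3 < X.t then X.affineParam ⟨3, h⟩ else 0

end WeightedProjectiveLine

/-! ### The associated cubic plane curve algebra -/

section Cubic

variable {k : Type u} [Field k]

open MvPolynomial in
/-- The ternary cubic associated with a tubular weight sequence (and `λ`, for `(2,2,2,2)`), in
the variables `X = X 0`, `Y = X 1`, `Z = X 2`.  The value `0` for other sequences is a dummy. -/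
noncomputable def tubularCubic (lam : k) : List ℕ → MvPolynomial (Fin 3) k
  | [2, 2, 2, 2] => X 1 ^ 2 * X 2 - X 0 * (X 0 - X 2) * (X 0 - C lam * X 2)
  | [3, 3, 3] => X 0 ^ 3 - (X 1 ^ 2 * X 2 - X 2 ^ 2 * X 1)
  | [4, 4, 2] => X 1 ^ 2 * X 2 - X 0 * (X 0 - X 2) * (X 0 + X 2)
  | [6, 3, 2] => X 1 ^ 2 * X 2 - (X 0 ^ 3 - X 2 ^ 3)
  | _ => 0

/-- The exponents `e` such that the generator `g` of `C_p` acts on the variable `X i` of the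
associated cubic algebra by multiplication with `ζ ^ e i`.  The value `0` for non-tubular
sequences is a dummy. -/
def tubularExponents : List ℕ → Fin 3 → ℕ
  | [2, 2, 2, 2] => ![0, 1, 0]
  | [3, 3, 3] => ![2, 0, 0]
  | [4, 4, 2] => ![2, 3, 0]
  | [6, 3, 2] => ![2, 3, 0]
  | _ => 0

open MvPolynomial in
theorem diagAut_tubularCubic (lam : k) (w : List ℕ) (ζ : kˣ) (hζ : ζ ^ w.foldr Nat.lcm 1 = 1) :
    ∃ u : kˣ, diagAut (fun i => ζ ^ tubularExponents w i) (tubularCubic lam w) =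
      C (u : k) * tubularCubic lam w := by
  have hC (n : ℕ) (h : ζ ^ n = 1) : (C (ζ : k) : MvPolynomial (Fin 3) k) ^ n = 1 := by
    rw [← C_pow, ← Units.val_pow_eq_pow_val, h, Units.val_one, C_1]
  unfold tubularExponents tubularCubic
  split
  · have h := hC 2 hζ
    refine ⟨1, ?_⟩
    simp only [map_sub, map_mul, map_pow, diagAut_X, diagAut_C, Units.val_pow_eq_pow_val,
      Units.val_one, C_1, Matrix.cons_val]
    linear_combination (X 1 ^ 2 * X 2) * h
  · have h := hC 3 hζ
    refine ⟨1, ?_⟩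
    simp only [map_sub, map_mul, map_pow, diagAut_X, Units.val_pow_eq_pow_val,
      Units.val_one, C_1, Matrix.cons_val]
    linear_combination (X 0 ^ 3 * (C (ζ : k) ^ 3 + 1)) * h
  · have h := hC 4 hζ
    refine ⟨ζ ^ 2, ?_⟩
    simp only [map_sub, map_add, map_mul, map_pow, diagAut_X, Units.val_pow_eq_pow_val,
      Matrix.cons_val]
    linear_combination (C (ζ : k) ^ 2 * (X 1 ^ 2 * X 2 - X 0 ^ 3)) * h
  · have h := hC 6 hζ
    refine ⟨1, ?_⟩
    simp only [map_sub, map_mul, map_pow, diagAut_X, Units.val_pow_eq_pow_val,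
      Units.val_one, C_1, Matrix.cons_val]
    linear_combination (X 1 ^ 2 * X 2 - X 0 ^ 3) * h
  · exact ⟨1, by simp⟩

end Cubic

namespace WeightedProjectiveLine

variable {k : Type u} [Field k] (X : WeightedProjectiveLine k)

/-- The defining equation of the plane curve associated with `X` of tubular type. -/
noncomputable def cubic : MvPolynomial (Fin 3) k := tubularCubic X.lam X.weights

/-- The associated algebra `R = k[X, Y, Z]/(cubic)`. -/
abbrev CubicAlgebra : Type u := MvPolynomial (Fin 3) k ⧸ Ideal.span {X.cubic}

/-- The `ℤ`-grading of `R` with all variables of degree one. -/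
noncomputable def cubicGrading : ℤ → Submodule k X.CubicAlgebra :=
  quotientGrading (Ideal.span {X.cubic}) (fun _ => (1 : ℤ))

variable (ζ : kˣ) (hζ : IsPrimitiveRoot ζ X.lcmWeights)

/-- The automorphism `X_i ↦ ζ ^ (e i) X_i` of the graded algebra `R`, where `e` is given by
`tubularExponents`. -/
noncomputable def cyclicGenerator : gradedAut X.cubicGrading :=
  diagQuotientAut X.cubic (fun _ => (1 : ℤ)) (fun i => ζ ^ tubularExponents X.weights i)
    (diagAut_tubularCubic X.lam X.weights ζ hζ.pow_eq_one)

theorem cyclicGenerator_pow : X.cyclicGenerator ζ hζ ^ X.lcmWeights = 1 := by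
  refine Subtype.ext (AlgEquiv.ext fun x => ?_)
  obtain ⟨x, rfl⟩ := Ideal.Quotient.mk_surjective x
  refine (diagQuotientAut_pow_mk X.cubic (fun _ => (1 : ℤ)) _ _ X.lcmWeights x).trans ?_
  have h : (fun i => ζ ^ tubularExponents X.weights i) ^ X.lcmWeights = 1 := by
    ext1 i
    rw [Pi.pow_apply, ← pow_mul, mul_comm, pow_mul, hζ.pow_eq_one, one_pow, Pi.one_apply]
  rw [h, diagAut_one]
  rfl

/-- The action of the cyclic group `C_p = ⟨g | g ^ p = 1⟩` on `R`, in which `g` acts by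
`cyclicGenerator`. -/
noncomputable def cyclicAction : Multiplicative (ZMod X.lcmWeights) →* gradedAut X.cubicGrading :=
  AddMonoidHom.toMultiplicativeLeft (ZMod.lift X.lcmWeights
    ⟨zmultiplesHom _ (Additive.ofMul (X.cyclicGenerator ζ hζ)), by
      rw [zmultiplesHom_apply, natCast_zsmul, ← ofMul_pow, cyclicGenerator_pow, ofMul_one]⟩)

end WeightedProjectiveLine

/-- `k` is a splitting field of the group `H`: the group algebra `kH` is isomorphic to a finite
direct product of copies of `k`. -/
def IsSplittingFieldOfGroup (k : Type u) [Field k] (H : Type w) [Group H] : Prop :=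
  ∃ n : ℕ, Nonempty (MonoidAlgebra k H ≃ₐ[k] (Fin n → k))

/-!
Both equivalences come from two constructions which change the grading group of an algebra, applied
to the coordinate algebra `S` and to the algebra `R` of the cubic.

**Veronese subalgebras.** Let `B` be the part of a `G`-graded algebra `A` in the degrees from a
subgroup `H`. If `A` is finite over `B` and the elements of degree in any coset of `H` generate an
ideal of finite codimension, then a finitely generated graded `A`-module is finite-dimensional as
soon as its part in degrees from `H` is. Hence restriction to `H`, with its left adjoint
`A ⊗[B] -`, is an equivalence `qmod^G-A ≌ qmod^H-B` (`IsVeronese.nonempty_qmod_equivalence`).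

In the tubular case this applies to `S` and the subgroup `ℤ 3 x₁ ⊕ ℤ ω ≅ ℤ × ℤ/p` of the string
group (`IsTubular.veroneseHom`). The Veronese subalgebra is `R`, with the grading by `ℤ × ℤ/p` in
which the second degree records the weights of the action of `C_p` (`IsTubular.isCubicVeronese`).
For each of the four weight sequences the variables of the cubic are sent to explicit monomials of
`S`. The map is injective because it can be specialized to a generic point of the irreducible
Weierstrass cubic (`weierstrassCubic_dvd_of_map_eq_zero`). It is surjective because characters of
the string group bound the monomials that occur (`IsTubular.sum_smul_eq_zero`), and these are
products of the given ones. The ideals generated by cosets of degrees have finite codimension since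
`ω` allows every degree to be represented by a monomial avoiding any prescribed variable
(`IsTubular.finiteDimensional_quotient`).

**Coarsening.** For a homomorphism `q : G → G'` with finite kernel `K`, a graded module over the
coarser grading is the same thing as a finely graded module which is equivariant under the shifts by
`K`: unfold a module into the components `N_{q(x)}`, and conversely take coinvariants
(`GradedModFP.nonempty_qmod_equivalence_shift`). Dually, if `k` contains a primitive `p`-th root of
unity, a module graded by `G × ℤ/p` is the same thing as a `G`-graded module which is equivariant
under twists by the corresponding characters: the eigenspaces give back the finer grading
(`GradedModFP.nonempty_qmod_equivalence_twist`).

These statements hold for categories of modules, and pass to `qmod` because equivariantization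
commutes with the localization
(`CatAction.nonempty_localization_equivalence_equivariantObject`). The point is to lift the
equivariant structure from the quotient category. Every morphism of the localization is represented
on a truncation `X_{≥ n}` of its source, truncations are compatible with the actions, and a
sufficiently small truncation serves all elements of the finite group and all relations at once.

The first equivalence combines shifts by `ℤ ω` with the restriction to `ℤ` inside `L / ℤ ω`; the
second combines restriction to `ℤ × ℤ/p` with twists by `C_p`. Finally, if `k C_p` is a product of
copies of `k`, then the generator of `C_p` acts by roots of unity of `k`, and it can have order `p`
only if there are `p` of them.
-/

universe w'

open scoped TensorProduct

/-! ### Recognizing localizations -/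

section LocalizationCriterion

variable {D : Type u} [Category.{v} D] {E : Type u₁} [Category.{v₁} E]

theorem exists_Q_obj (W : MorphismProperty D) (Y : W.Localization) : ∃ X, W.Q.obj X = Y :=
  (Localization.Construction.objEquiv W).surjective Y

/-- If `W` has a calculus of right fractions, then a functor `Φ` inverting `W` induces an
equivalence on the localization as soon as every object is in its image, every morphism is a right
fraction of morphisms in its image, and two morphisms with the same image are equalized by an
element of `W`. -/
theorem nonempty_localization_equivalence (W : MorphismProperty D) [W.HasRightCalculusOfFractions]
    (Φ : D ⥤ E) (hΦ : W.IsInvertedBy Φ)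
    (surj : ∀ Y : E, ∃ X : D, Nonempty (Φ.obj X ≅ Y))
    (full : ∀ (X Y : D) (θ : Φ.obj X ⟶ Φ.obj Y),
      ∃ (Z : D) (s : Z ⟶ X) (f : Z ⟶ Y), W s ∧ Φ.map s ≫ θ = Φ.map f)
    (faithful : ∀ (X Y : D) (f g : X ⟶ Y), Φ.map f = Φ.map g →
      ∃ (Z : D) (s : Z ⟶ X), W s ∧ s ≫ f = s ≫ g) :
    Nonempty (W.Localization ≌ E) := by
  obtain ⟨F, rfl⟩ : ∃ F : W.Localization ⥤ E, W.Q ⋙ F = Φ :=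
    ⟨Localization.Construction.lift Φ hΦ, Localization.Construction.fac Φ hΦ⟩
  have : F.EssSurj := ⟨fun Y => by
    obtain ⟨X, ⟨e⟩⟩ := surj Y
    exact ⟨W.Q.obj X, ⟨e⟩⟩⟩
  have : F.Full := ⟨by
    intro X Y θ
    obtain ⟨X, rfl⟩ := exists_Q_obj W X
    obtain ⟨Y, rfl⟩ := exists_Q_obj W Y
    obtain ⟨Z, s, f, hs, h⟩ := full X Y θ
    have := W.Q_inverts s hs
    refine ⟨inv (W.Q.map s) ≫ W.Q.map f, ?_⟩
    rw [F.map_comp, F.map_inv, IsIso.inv_comp_eq]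
    exact h.symm⟩
  have : F.Faithful := ⟨by
    intro X Y a b hab
    obtain ⟨X, rfl⟩ := exists_Q_obj W X
    obtain ⟨Y, rfl⟩ := exists_Q_obj W Y
    obtain ⟨φ, rfl⟩ := Localization.exists_rightFraction W.Q W a
    obtain ⟨ψ, h⟩ := Localization.exists_rightFraction W.Q W (W.Q.map φ.s ≫ b)
    have e1 : W.Q.map φ.s ≫ φ.map W.Q (Localization.inverts W.Q W) = W.Q.map φ.f := by simp
    have e2 : W.Q.map ψ.s ≫ W.Q.map φ.s ≫ b = W.Q.map ψ.f := by rw [h]; simp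
    have e3 : F.map (W.Q.map (ψ.s ≫ φ.f)) = F.map (W.Q.map ψ.f) := by
      rw [Functor.map_comp, ← e1, ← e2, F.map_comp, F.map_comp, F.map_comp, F.map_comp]
      exact congrArg (fun t => _ ≫ _ ≫ t) hab
    obtain ⟨Z, s, hs, h⟩ := faithful _ _ _ _ e3
    have e4 : W.Q.map (ψ.s ≫ φ.f) = W.Q.map ψ.f := by
      have := W.Q_inverts s hs
      rw [← cancel_epi (W.Q.map s), ← Functor.map_comp, ← Functor.map_comp, h]
    have := W.Q_inverts _ φ.hs
    have := W.Q_inverts _ ψ.hs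
    rw [← cancel_epi (W.Q.map φ.s), ← cancel_epi (W.Q.map ψ.s), e2, ← e4, Functor.map_comp, e1]⟩
  have : F.IsEquivalence := {}
  exact ⟨F.asEquivalence⟩

/-- A functor `V` induces an equivalence of localizations if it reflects and preserves the inverted
morphisms, and if each object `N` of the target has a universal morphism `N ⟶ V.obj (I N)` which is
inverted. -/
theorem nonempty_localization_equivalence_localization
    (W : MorphismProperty D) [W.HasRightCalculusOfFractions]
    (W' : MorphismProperty E) [W'.HasRightCalculusOfFractions] (V : D ⥤ E)
    (hV : ∀ ⦃X Y : D⦄ (f : X ⟶ Y), W f ↔ W' (V.map f))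
    (cancel : ∀ ⦃X Y Z : E⦄ (f : X ⟶ Y) (g : Y ⟶ Z), W' f → W' (f ≫ g) → W' g)
    (unit : ∀ N : E, ∃ (I : D) (η : N ⟶ V.obj I), W' η ∧
      ∀ (M : D) (h : N ⟶ V.obj M), ∃! h' : I ⟶ M, η ≫ V.map h' = h) :
    Nonempty (W.Localization ≌ W'.Localization) := by
  refine nonempty_localization_equivalence W (V ⋙ W'.Q)
    (fun X Y f hf => W'.Q_inverts _ ((hV f).1 hf)) (fun Y => ?_) (fun X Y θ => ?_)
    (fun X Y f g h => ?_)
  · obtain ⟨N, rfl⟩ := exists_Q_obj W' Y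
    obtain ⟨I, η, hη, -⟩ := unit N
    have := W'.Q_inverts η hη
    exact ⟨I, ⟨(asIso (W'.Q.map η)).symm⟩⟩
  · obtain ⟨φ, hφ⟩ : ∃ φ, θ = _ := Localization.exists_rightFraction W'.Q W' θ
    obtain ⟨I, η, hη, hI⟩ := unit φ.X'
    obtain ⟨s, hs, -⟩ := hI X φ.s
    obtain ⟨f, hf, -⟩ := hI Y φ.f
    refine ⟨I, s, f, (hV s).2 (cancel η _ hη (by rw [hs]; exact φ.hs)), ?_⟩
    have := W'.Q_inverts η hη
    rw [← cancel_epi (W'.Q.map η), hφ, Functor.comp_map, Functor.comp_map, ← Functor.map_comp, hf,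
      ← Category.assoc, ← Functor.map_comp, hs, MorphismProperty.RightFraction.map_s_comp_map]
  · obtain ⟨N, s, hs, e⟩ := (MorphismProperty.map_eq_iff_precomp W'.Q W' _ _).1 h
    obtain ⟨I, η, hη, hI⟩ := unit N
    obtain ⟨t, ht, -⟩ := hI X s
    refine ⟨I, t, (hV t).2 (cancel η _ hη (by rw [ht]; exact hs)), ?_⟩
    refine (hI Y (s ≫ V.map f)).unique ?_ ?_
    · rw [Functor.map_comp, ← Category.assoc, ht]
    · rw [Functor.map_comp, ← Category.assoc, ht, e]

end LocalizationCriterion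

/-! ### Equivariant objects of a localization -/

namespace CatAction

variable {G : Type w} [Group G] {C : Type u} [Category.{v} C]
variable (Φ : CatAction G C) (W : MorphismProperty C)

/-- A system of functorial truncations `T n X ↪ X` in `W`, decreasing in `n`, idempotent, cofinal
among the morphisms in `W` with target `X`, and compatible with a group action. -/
structure Truncation where
  T : ℤ → C ⥤ C
  ι : ∀ n, T n ⟶ 𝟭 C
  mem : ∀ n X, W ((ι n).app X)
  mono : ∀ n X, Mono ((ι n).app X)
  idem : ∀ n X, IsIso ((ι n).app ((T n).obj X))
  le : ∀ {n m : ℤ}, n ≤ m → ∀ X, ∃ u : (T m).obj X ⟶ (T n).obj X,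
    u ≫ (ι n).app X = (ι m).app X
  cofinal : ∀ {Z X : C} (s : Z ⟶ X), W s → ∃ (n : ℤ) (u : (T n).obj X ⟶ Z), u ≫ s = (ι n).app X
  τ : ∀ g n X, (Φ.F g).obj ((T n).obj X) ≅ (T n).obj ((Φ.F g).obj X)
  τ_ι : ∀ g n X, (τ g n X).hom ≫ (ι n).app ((Φ.F g).obj X) = (Φ.F g).map ((ι n).app X)

namespace EquivariantObject

variable {Φ}

theorem hom_ext {X Y : EquivariantObject Φ} {f g : X ⟶ Y} (h : Hom.hom f = Hom.hom g) : f = g :=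
  Hom.ext h

/-- An equivariant morphism whose underlying morphism is invertible is invertible. -/
theorem isIso_of_isIso_hom {X Y : EquivariantObject Φ} (f : X ⟶ Y) [IsIso (Hom.hom f)] :
    IsIso f := by
  refine ⟨⟨inv (Hom.hom f), fun g => ?_⟩, hom_ext (IsIso.hom_inv_id _),
    hom_ext (IsIso.inv_hom_id _)⟩
  rw [IsIso.inv_comp_eq, Functor.map_inv, ← Category.assoc, f.comm, Category.assoc,
    IsIso.hom_inv_id, Category.comp_id]

/-- Construct an equivariant object from morphisms `a g : X ⟶ F_g X` satisfying the cocycle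
relation, of which only `a 1` is known to be invertible. -/
noncomputable def ofHom (X : C) (a : ∀ g, X ⟶ (Φ.F g).obj X) [IsIso (a 1)]
    (rel : ∀ g h, a (g * h) = a g ≫ (Φ.F g).map (a h) ≫ (Φ.ε g h).hom.app X) :
    EquivariantObject Φ :=
  -- As `a 1` is invertible, the cocycle relation for `g * g⁻¹` makes `a g` a split monomorphism,
  -- and the one for `g⁻¹ * g` makes it an epimorphism.
  have key (g h : G) (hgh : g * h = 1) :
      IsIso (a g ≫ (Φ.F g).map (a h) ≫ (Φ.ε g h).hom.app X) := by
    rw [← rel]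
    have : ∀ x, x = 1 → IsIso (a x) := by rintro _ rfl; infer_instance
    exact this _ hgh
  have iso (g : G) : IsIso (a g) := by
    have := Φ.isEquivalence
    have h1 := key g g⁻¹ (mul_inv_cancel g)
    have : IsSplitMono (a g) := ⟨⟨⟨_ ≫ inv (a g ≫ (Φ.F g).map (a g⁻¹) ≫ (Φ.ε g g⁻¹).hom.app X),
      by rw [← Category.assoc, IsIso.hom_inv_id]⟩⟩⟩
    have h2 := key g⁻¹ g (inv_mul_cancel g)
    have : IsSplitEpi ((Φ.F g⁻¹).map (a g) ≫ (Φ.ε g⁻¹ g).hom.app X) :=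
      ⟨⟨⟨inv (a g⁻¹ ≫ (Φ.F g⁻¹).map (a g) ≫ (Φ.ε g⁻¹ g).hom.app X) ≫ a g⁻¹,
      by simp⟩⟩⟩
    have : Epi ((Φ.F g⁻¹).map (a g)) := by
      have : (Φ.F g⁻¹).map (a g) = ((Φ.F g⁻¹).map (a g) ≫ (Φ.ε g⁻¹ g).hom.app X) ≫
        inv ((Φ.ε g⁻¹ g).hom.app X) := by simp
      rw [this]
      infer_instance
    have : Epi (a g) := (Φ.F g⁻¹).epi_of_epi_map this
    exact isIso_of_epi_of_isSplitMono _
  { obj := X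
    α := fun g => asIso (a g)
    rel := rel }

end EquivariantObject

open EquivariantObject

variable (hW : ∀ (g : G) ⦃X Y : C⦄ (f : X ⟶ Y), W f → W ((Φ.F g).map f))

theorem facIso_hom_naturality (g : G) {X Y : C} (f : X ⟶ Y) :
    (Φ.localizeF W hW g).map (W.Q.map f) ≫ (Φ.facIso W hW g).hom.app Y =
      (Φ.facIso W hW g).hom.app X ≫ W.Q.map ((Φ.F g).map f) :=
  (Φ.facIso W hW g).hom.naturality f

theorem facIso_hom_inv (g : G) (X : C) :
    (Φ.facIso W hW g).hom.app X ≫ (Φ.facIso W hW g).inv.app X = 𝟙 _ := by simp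

theorem facIso_inv_hom (g : G) (X : C) :
    (Φ.facIso W hW g).inv.app X ≫ (Φ.facIso W hW g).hom.app X = 𝟙 _ := by simp

/-- The functor between the categories of equivariant objects induced by the localization
functor. -/
noncomputable def localizeEquivariant :
    EquivariantObject Φ ⥤ EquivariantObject (Φ.localize W hW) where
  obj X :=
    { obj := W.Q.obj X.obj
      α := fun g => W.Q.mapIso (X.α g) ≪≫ (Φ.facIso W hW g).symm.app X.obj
      rel := fun g h => by
        change W.Q.map (X.α (g * h)).hom ≫ (Φ.facIso W hW (g * h)).inv.app X.obj =
          (W.Q.map (X.α g).hom ≫ (Φ.facIso W hW g).inv.app X.obj) ≫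
          (Φ.localizeF W hW g).map
            (W.Q.map (X.α h).hom ≫ (Φ.facIso W hW h).inv.app X.obj) ≫
            (Φ.localizeε W hW g h).hom.app (W.Q.obj X.obj)
        rw [localizeε_app, X.rel, Functor.map_comp (Φ.localizeF W hW g)]
        have c1 {T : W.Localization}
            (t : (Φ.localizeF W hW g).obj (W.Q.obj ((Φ.F h).obj X.obj)) ⟶ T) :
            (Φ.localizeF W hW g).map ((Φ.facIso W hW h).inv.app X.obj) ≫
              (Φ.localizeF W hW g).map ((Φ.facIso W hW h).hom.app X.obj) ≫ t = t := by
          rw [← Category.assoc, ← Functor.map_comp, facIso_inv_hom,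
            CategoryTheory.Functor.map_id]
          exact Category.id_comp t
        have c2 := facIso_hom_naturality Φ W hW g (X.α h).hom
        have c3 {T : W.Localization}
            (t : W.Q.obj ((Φ.F g).obj X.obj) ⟶ T) :
            (Φ.facIso W hW g).inv.app X.obj ≫ (Φ.facIso W hW g).hom.app X.obj ≫ t = t := by
          rw [← Category.assoc, facIso_inv_hom]
          exact Category.id_comp t
        simp only [Category.assoc, Functor.map_comp]
        rw [c1, reassoc_of% c2, c3] }
  map {X Y} f := Hom.mk (Φ := Φ.localize W hW) (W.Q.map (Hom.hom f)) (fun g => by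
      change W.Q.map (Hom.hom f) ≫ W.Q.map (Y.α g).hom ≫ (Φ.facIso W hW g).inv.app Y.obj =
        (W.Q.map (X.α g).hom ≫ (Φ.facIso W hW g).inv.app X.obj) ≫
          (Φ.localizeF W hW g).map (W.Q.map (Hom.hom f))
      have c2 := (Φ.facIso W hW g).inv.naturality (Hom.hom f)
      change W.Q.map ((Φ.F g).map (Hom.hom f)) ≫ (Φ.facIso W hW g).inv.app Y.obj =
        (Φ.facIso W hW g).inv.app X.obj ≫
          (Φ.localizeF W hW g).map (W.Q.map (Hom.hom f)) at c2
      rw [Category.assoc, ← c2, ← Category.assoc, ← Category.assoc, ← Functor.map_comp,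
        ← Functor.map_comp, f.comm])
  map_id X := hom_ext (W.Q.map_id _)
  map_comp f g := hom_ext (W.Q.map_comp _ _)

/-- The endofunctor of the localization induced by `F g`, on morphisms between objects `W.Q.obj _`
and up to the identification `facIso`. -/
noncomputable def localizeMap (g : G) {X Y : C} (x : W.Q.obj X ⟶ W.Q.obj Y) :
    W.Q.obj ((Φ.F g).obj X) ⟶ W.Q.obj ((Φ.F g).obj Y) :=
  (Φ.facIso W hW g).inv.app X ≫ (Φ.localizeF W hW g).map x ≫ (Φ.facIso W hW g).hom.app Y

theorem localizeMap_comp (g : G) {X Y Z : C} (x : W.Q.obj X ⟶ W.Q.obj Y)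
    (y : W.Q.obj Y ⟶ W.Q.obj Z) :
    Φ.localizeMap W hW g (x ≫ y) = Φ.localizeMap W hW g x ≫ Φ.localizeMap W hW g y := by
  simp only [localizeMap, Category.assoc, Functor.map_comp]
  have c {T : W.Localization} (t : (Φ.localizeF W hW g).obj (W.Q.obj Y) ⟶ T) :
      (Φ.facIso W hW g).hom.app Y ≫ (Φ.facIso W hW g).inv.app Y ≫ t = t := by
    rw [← Category.assoc, facIso_hom_inv]
    exact Category.id_comp t
  rw [c]

theorem localizeMap_map (g : G) {X Y : C} (f : X ⟶ Y) :
    Φ.localizeMap W hW g (W.Q.map f) = W.Q.map ((Φ.F g).map f) := by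
  rw [localizeMap, facIso_hom_naturality, ← Category.assoc, facIso_inv_hom]
  exact Category.id_comp _

/-- A morphism in the localization from `W.Q.obj X` to the translate of `W.Q.obj X`, in terms of
the translate of `X`. -/
noncomputable def unlocalize {g : G} {X Y : C}
    (a : W.Q.obj X ⟶ (Φ.localizeF W hW g).obj (W.Q.obj Y)) :
    W.Q.obj X ⟶ W.Q.obj ((Φ.F g).obj Y) :=
  a ≫ (Φ.facIso W hW g).hom.app Y

theorem unlocalize_rel {g h : G} {X : C}
    (a : W.Q.obj X ⟶ (Φ.localizeF W hW g).obj (W.Q.obj X))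
    (b : W.Q.obj X ⟶ (Φ.localizeF W hW h).obj (W.Q.obj X)) :
    Φ.unlocalize W hW (a ≫ (Φ.localizeF W hW g).map b ≫
      (Φ.localizeε W hW g h).hom.app (W.Q.obj X)) =
      Φ.unlocalize W hW a ≫ Φ.localizeMap W hW g (Φ.unlocalize W hW b) ≫
        W.Q.map ((Φ.ε g h).hom.app X) := by
  have c1 {T : W.Localization} (t : (Φ.localizeF W hW g).obj (W.Q.obj X) ⟶ T) :
      (Φ.facIso W hW g).hom.app X ≫ (Φ.facIso W hW g).inv.app X ≫ t = t := by
    rw [← Category.assoc, facIso_hom_inv]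
    exact Category.id_comp t
  simp only [unlocalize, localizeMap, Category.assoc, localizeε_app, Functor.map_comp]
  rw [c1, facIso_inv_hom]
  congr 4

theorem unlocalize_injective {g : G} {X Y : C} :
    Function.Injective (Φ.unlocalize W hW (g := g) (X := X) (Y := Y)) := by
  intro a b h
  have : Epi ((Φ.facIso W hW g).hom.app Y) := inferInstance
  have h2 := congrArg (· ≫ (Φ.facIso W hW g).inv.app Y) h
  simp only [unlocalize, Category.assoc, facIso_hom_inv] at h2
  exact (Category.comp_id a).symm.trans (h2.trans (Category.comp_id b))

theorem unlocalize_comp {g : G} {X Y Z : C} (x : W.Q.obj X ⟶ W.Q.obj Y)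
    (a : W.Q.obj Y ⟶ (Φ.localizeF W hW g).obj (W.Q.obj Z)) :
    Φ.unlocalize W hW (x ≫ a) = x ≫ Φ.unlocalize W hW a :=
  Category.assoc _ _ _

theorem unlocalize_comp_map {g : G} {X Y Z : C}
    (a : W.Q.obj X ⟶ (Φ.localizeF W hW g).obj (W.Q.obj Y)) (y : W.Q.obj Y ⟶ W.Q.obj Z) :
    Φ.unlocalize W hW (a ≫ (Φ.localizeF W hW g).map y) =
      Φ.unlocalize W hW a ≫ Φ.localizeMap W hW g y := by
  have c1 {T : W.Localization} (t : (Φ.localizeF W hW g).obj (W.Q.obj Y) ⟶ T) :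
      (Φ.facIso W hW g).hom.app Y ≫ (Φ.facIso W hW g).inv.app Y ≫ t = t := by
    rw [← Category.assoc, facIso_hom_inv]
    exact Category.id_comp t
  simp only [unlocalize, localizeMap, Category.assoc]
  rw [c1]

theorem unlocalize_localizeEquivariant_α (X : EquivariantObject Φ) (g : G) :
    Φ.unlocalize W hW (((Φ.localizeEquivariant W hW).obj X).α g).hom = W.Q.map (X.α g).hom := by
  change (W.Q.map (X.α g).hom ≫ (Φ.facIso W hW g).inv.app X.obj) ≫
    (Φ.facIso W hW g).hom.app X.obj = _
  rw [Category.assoc, facIso_inv_hom]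
  exact Category.comp_id _

section Truncation

variable {Φ W}

attribute [instance] Truncation.mono Truncation.idem

namespace Truncation

open Filter

variable (T : Φ.Truncation W)

theorem eventually_lift {Z X : C} (s : Z ⟶ X) (hs : W s) :
    ∀ᶠ n in atTop, ∃ u : (T.T n).obj X ⟶ Z, u ≫ s = (T.ι n).app X := by
  obtain ⟨n, u, hu⟩ := T.cofinal s hs
  filter_upwards [eventually_ge_atTop n] with m hm
  obtain ⟨v, hv⟩ := T.le hm X
  exact ⟨v ≫ u, by rw [Category.assoc, hu, hv]⟩

/-- On a sufficiently deep truncation of `X`, a morphism of the localization comes from `C`. -/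
theorem eventually_rep [W.HasRightCalculusOfFractions] {X Y : C} (θ : W.Q.obj X ⟶ W.Q.obj Y) :
    ∀ᶠ n in atTop, ∃ f : (T.T n).obj X ⟶ Y, W.Q.map ((T.ι n).app X) ≫ θ = W.Q.map f := by
  obtain ⟨φ, rfl⟩ := Localization.exists_rightFraction W.Q W θ
  filter_upwards [T.eventually_lift φ.s φ.hs] with n ⟨u, hu⟩
  exact ⟨u ≫ φ.f, by rw [← hu, Functor.map_comp, Functor.map_comp, Category.assoc,
    MorphismProperty.RightFraction.map_s_comp_map]⟩

theorem eventually_eq [W.HasRightCalculusOfFractions] {X Y : C} (f g : X ⟶ Y)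
    (h : W.Q.map f = W.Q.map g) :
    ∀ᶠ n in atTop, (T.ι n).app X ≫ f = (T.ι n).app X ≫ g := by
  obtain ⟨Z, s, hs, e⟩ := (MorphismProperty.map_eq_iff_precomp W.Q W f g).1 h
  filter_upwards [T.eventually_lift s hs] with n ⟨u, hu⟩
  rw [← hu, Category.assoc, e, Category.assoc]

/-- The restriction to truncations of a morphism to a translate. -/
def restrict (n : ℤ) {g : G} {X Y : C} (f : X ⟶ (Φ.F g).obj Y) :
    (T.T n).obj X ⟶ (Φ.F g).obj ((T.T n).obj Y) :=
  (T.T n).map f ≫ (T.τ g n Y).inv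

theorem restrict_ι (n : ℤ) {g : G} {X Y : C} (f : X ⟶ (Φ.F g).obj Y) :
    T.restrict n f ≫ (Φ.F g).map ((T.ι n).app Y) = (T.ι n).app X ≫ f := by
  rw [restrict, ← T.τ_ι, Category.assoc, Iso.inv_hom_id_assoc]
  exact (T.ι n).naturality f

/-- The truncation of an equivariant object. -/
def equivariant (n : ℤ) (X : EquivariantObject Φ) : EquivariantObject Φ where
  obj := (T.T n).obj X.obj
  α g := (T.T n).mapIso (X.α g) ≪≫ (T.τ g n X.obj).symm
  rel g h := by
    have := Φ.isEquivalence
    have key (g : G) : ((T.T n).mapIso (X.α g) ≪≫ (T.τ g n X.obj).symm).hom =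
      T.restrict n (X.α g).hom := rfl
    have e := (Φ.ε g h).hom.naturality ((T.ι n).app X.obj)
    rw [Functor.comp_map] at e
    have e2 := congrArg (Φ.F g).map (T.restrict_ι n (X.α h).hom)
    rw [Functor.map_comp, Functor.map_comp] at e2
    rw [key, key, key, ← cancel_mono ((Φ.F (g * h)).map ((T.ι n).app X.obj)), restrict_ι, X.rel,
      Category.assoc, Category.assoc, ← e, reassoc_of% e2, ← Category.assoc, ← Category.assoc,
      ← restrict_ι]
    simp only [Category.assoc]
    rfl

/-- The inclusion of the truncation of an equivariant object. -/
def equivariantι (n : ℤ) (X : EquivariantObject Φ) : T.equivariant n X ⟶ X :=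
  Hom.mk ((T.ι n).app X.obj) fun g => (T.restrict_ι n (X.α g).hom).symm

/-- A morphism of the localization that is equivariant is a right fraction of equivariant morphisms
of `C`: as `G` is finite, one truncation makes all equivariance relations hold in `C`. -/
theorem exists_equivariant_fraction (T : Φ.Truncation W) [W.HasRightCalculusOfFractions] [Finite G]
    {hW : ∀ (g : G) ⦃X Y : C⦄ (f : X ⟶ Y), W f → W ((Φ.F g).map f)} {X Y : EquivariantObject Φ}
    (θ : (Φ.localizeEquivariant W hW).obj X ⟶ (Φ.localizeEquivariant W hW).obj Y) :
    ∃ (Z : EquivariantObject Φ) (s : Z ⟶ X) (f : Z ⟶ Y), W (Hom.hom s) ∧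
      (Φ.localizeEquivariant W hW).map s ≫ θ = (Φ.localizeEquivariant W hW).map f := by
  let t : W.Q.obj X.obj ⟶ W.Q.obj Y.obj := Hom.hom θ
  have ht (g : G) : t ≫ W.Q.map (Y.α g).hom =
      W.Q.map (X.α g).hom ≫ Φ.localizeMap W hW g t := by
    have := congrArg (Φ.unlocalize W hW) (Hom.comm θ g)
    rw [← unlocalize_localizeEquivariant_α (hW := hW),
      ← unlocalize_localizeEquivariant_α (hW := hW)]
    exact (Φ.unlocalize_comp W hW t _).symm.trans
      (this.trans (Φ.unlocalize_comp_map W hW _ t))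
  obtain ⟨n, f, hf⟩ := (T.eventually_rep t).exists
  have h1 (g : G) : W.Q.map (f ≫ (Y.α g).hom) =
      W.Q.map (T.restrict n (X.α g).hom ≫ (Φ.F g).map f) := by
    rw [Functor.map_comp, ← hf, Category.assoc, ht, Functor.map_comp,
      ← Φ.localizeMap_map W hW g f, ← hf, localizeMap_comp, localizeMap_map,
      ← Category.assoc, ← Category.assoc, ← Functor.map_comp, ← Functor.map_comp,
      T.restrict_ι]
  obtain ⟨m, hm⟩ := (eventually_all.2 fun g => T.eventually_eq _ _ (h1 g)).exists
  refine ⟨T.equivariant m (T.equivariant n X), T.equivariantι m _ ≫ T.equivariantι n X,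
    Hom.mk ((T.ι m).app _ ≫ f) fun g => ?_, ?_, ?_⟩
  · change ((T.ι m).app ((T.T n).obj X.obj) ≫ f) ≫ (Y.α g).hom =
      T.restrict m (T.restrict n (X.α g).hom) ≫
        (Φ.F g).map ((T.ι m).app ((T.T n).obj X.obj) ≫ f)
    rw [Category.assoc, hm, Functor.map_comp, ← Category.assoc, ← Category.assoc, T.restrict_ι]
  · exact W.comp_mem _ _ (T.mem _ _) (T.mem _ _)
  · apply hom_ext
    change W.Q.map ((T.ι m).app ((T.T n).obj X.obj) ≫ (T.ι n).app X.obj) ≫ t =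
      W.Q.map ((T.ι m).app ((T.T n).obj X.obj) ≫ f)
    rw [Functor.map_comp, Category.assoc, Functor.map_comp, ← hf]

theorem exists_equivariant_equalizer (T : Φ.Truncation W) [W.HasRightCalculusOfFractions]
    {hW : ∀ (g : G) ⦃X Y : C⦄ (f : X ⟶ Y), W f → W ((Φ.F g).map f)} {X Y : EquivariantObject Φ}
    (f g : X ⟶ Y)
    (h : (Φ.localizeEquivariant W hW).map f = (Φ.localizeEquivariant W hW).map g) :
    ∃ (Z : EquivariantObject Φ) (s : Z ⟶ X), W (Hom.hom s) ∧ s ≫ f = s ≫ g := by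
  obtain ⟨n, hn⟩ := (T.eventually_eq (Hom.hom f) (Hom.hom g) (congrArg Hom.hom h)).exists
  exact ⟨_, T.equivariantι n X, T.mem _ _, hom_ext hn⟩

/-- Every equivariant object of the localization comes from an equivariant object of `C`. After one
truncation the structure morphisms come from morphisms of `C`, and after a further one these satisfy
the cocycle relations; as `G` is finite, finitely many conditions have to be met. -/
theorem exists_equivariant_iso (T : Φ.Truncation W) [W.HasRightCalculusOfFractions] [Finite G]
    {hW : ∀ (g : G) ⦃X Y : C⦄ (f : X ⟶ Y), W f → W ((Φ.F g).map f)}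
    (Y : EquivariantObject (Φ.localize W hW)) :
    ∃ X, Nonempty ((Φ.localizeEquivariant W hW).obj X ≅ Y) := by
  have := Φ.isEquivalence
  obtain ⟨Y, α, rel⟩ := Y
  obtain ⟨M, rfl⟩ := exists_Q_obj W Y
  let b (g : G) : W.Q.obj M ⟶ W.Q.obj ((Φ.F g).obj M) := Φ.unlocalize W hW (α g).hom
  have hb (g h : G) : b (g * h) =
      b g ≫ Φ.localizeMap W hW g (b h) ≫ W.Q.map ((Φ.ε g h).hom.app M) :=
    (congrArg (Φ.unlocalize W hW) (rel g h)).trans (Φ.unlocalize_rel W hW _ _)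
  have hbi (g : G) : IsIso (b g) := by
    have : IsIso ((Φ.facIso W hW g).hom.app M) := inferInstance
    exact IsIso.comp_isIso' (α g).isIso_hom this
  -- On a truncation `N` of `M`, all structure morphisms come from morphisms of `C`.
  obtain ⟨n, hn⟩ := (eventually_all.2 fun g => T.eventually_rep (b g)).exists
  choose f hf using hn
  let N := (T.T n).obj M
  let j : N ⟶ M := (T.ι n).app M
  have : IsIso (W.Q.map j) := W.Q_inverts j (T.mem _ _)
  obtain ⟨a, ha⟩ : ∃ a : ∀ g, N ⟶ (Φ.F g).obj N,
      ∀ g, W.Q.map (a g) ≫ W.Q.map ((Φ.F g).map j) = W.Q.map j ≫ b g := by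
    refine ⟨fun g => inv ((T.ι n).app N) ≫ T.restrict n (f g), fun g => ?_⟩
    rw [hf, ← Functor.map_comp, Category.assoc, restrict_ι, IsIso.inv_hom_id_assoc]
  have hQj (g : G) : IsIso (W.Q.map ((Φ.F g).map j)) := W.Q_inverts _ (hW g _ (T.mem _ _))
  have hai (g : G) : IsIso (W.Q.map (a g)) := by
    have : IsIso (W.Q.map (a g) ≫ W.Q.map ((Φ.F g).map j)) := by rw [ha]; infer_instance
    exact IsIso.of_isIso_comp_right _ (W.Q.map ((Φ.F g).map j))
  have hrel (g h : G) : W.Q.map (a (g * h)) =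
      W.Q.map (a g ≫ (Φ.F g).map (a h) ≫ (Φ.ε g h).hom.app N) := by
    have e := (Φ.ε g h).hom.naturality j
    rw [Functor.comp_map] at e
    rw [← cancel_mono (W.Q.map ((Φ.F (g * h)).map j)), ha, hb, ← Functor.map_comp,
      Category.assoc, Category.assoc, ← e, ← Category.assoc ((Φ.F g).map (a h)), ← Functor.map_comp,
      Functor.map_comp, Functor.map_comp, ← localizeMap_map (hW := hW), Functor.map_comp, ha,
      localizeMap_comp, localizeMap_map, Category.assoc, reassoc_of% (ha g)]
  -- The unit condition: `a 1` is a one-sided inverse of `κ`, up to translation by `F 1`. It makes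
  -- the structure morphism at `1` invertible in `C` on a truncation.
  let κ : Φ.F 1 ⋙ Φ.F 1 ≅ Φ.F 1 := Φ.ε 1 1 ≪≫ eqToIso (congrArg Φ.F (mul_one 1))
  have hunit : W.Q.map ((Φ.F 1).map (a 1) ≫ κ.hom.app N) = W.Q.map (𝟙 _) := by
    rw [← cancel_epi (W.Q.map (a 1)), ← Functor.map_comp, ← Functor.map_comp, Category.comp_id]
    have : ∀ (x : G) (hx : x = 1), a x ≫ (eqToHom (congrArg Φ.F hx)).app N = a 1 := by
      rintro _ rfl
      exact Category.comp_id _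
    refine Eq.trans ?_ (congrArg W.Q.map (this _ (mul_one 1)))
    rw [Functor.map_comp _ (a (1 * 1)), hrel, ← Functor.map_comp]
    simp [κ]
  obtain ⟨m, hm1, hm2⟩ := ((eventually_all.2 fun x : G × G =>
    T.eventually_eq _ _ (hrel x.1 x.2)).and (T.eventually_eq _ _ hunit)).exists
  obtain ⟨a', ha'⟩ : ∃ a' : ∀ g, (T.T m).obj N ⟶ (Φ.F g).obj ((T.T m).obj N),
      ∀ g, a' g ≫ (Φ.F g).map ((T.ι m).app N) = (T.ι m).app N ≫ a g :=
    ⟨fun g => T.restrict m (a g), fun g => T.restrict_ι m (a g)⟩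
  have rel' (g h : G) : a' (g * h) =
      a' g ≫ (Φ.F g).map (a' h) ≫ (Φ.ε g h).hom.app ((T.T m).obj N) := by
    have e := (Φ.ε g h).hom.naturality ((T.ι m).app N)
    rw [Functor.comp_map] at e
    have e2 := congrArg (Φ.F g).map (ha' h)
    rw [Functor.map_comp, Functor.map_comp] at e2
    have e3 := ha' g
    rw [← cancel_mono ((Φ.F (g * h)).map ((T.ι m).app N)), ha', hm1 (g, h),
      Category.assoc, Category.assoc, ← e, reassoc_of% e2, reassoc_of% e3]
    rfl
  have : IsIso (a' 1) := by
    have e := κ.hom.naturality ((T.ι m).app N)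
    rw [Functor.comp_map] at e
    have e2 := congrArg (Φ.F 1).map (ha' 1)
    rw [Functor.map_comp, Functor.map_comp] at e2
    have e3 := congrArg ((T.τ 1 m N).hom ≫ ·) hm2
    simp only [← Category.assoc, T.τ_ι] at e3
    have e4 : (Φ.F 1).map (a' 1) ≫ κ.hom.app ((T.T m).obj N) = 𝟙 _ := by
      rw [← cancel_mono ((Φ.F 1).map ((T.ι m).app N)), Category.assoc]
      refine (congrArg _ e.symm).trans ?_
      rw [reassoc_of% e2]
      simpa using e3
    have : IsIso ((Φ.F 1).map (a' 1) ≫ κ.hom.app ((T.T m).obj N)) := by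
      rw [e4]; infer_instance
    have : IsIso ((Φ.F 1).map (a' 1)) :=
      IsIso.of_isIso_comp_right _ (κ.hom.app ((T.T m).obj N))
    exact isIso_of_reflects_iso _ (Φ.F 1)
  refine ⟨EquivariantObject.ofHom _ a' rel', ⟨@asIso _ _ _ _ (Hom.mk (Φ := Φ.localize W hW)
    (W.Q.map ((T.ι m).app N) ≫ W.Q.map j) fun g => ?_) ?_⟩⟩
  · apply Φ.unlocalize_injective W hW
    refine (Φ.unlocalize_comp W hW _ _).trans (Eq.trans ?_
      (Φ.unlocalize_comp_map W hW _ _).symm)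
    rw [unlocalize_localizeEquivariant_α]
    change (W.Q.map ((T.ι m).app N) ≫ W.Q.map j) ≫ b g =
      W.Q.map (a' g) ≫ Φ.localizeMap W hW g (X := (T.T m).obj N)
        (W.Q.map ((T.ι m).app N) ≫ W.Q.map j)
    have e := congrArg W.Q.map (ha' g)
    rw [Functor.map_comp, Functor.map_comp] at e
    rw [localizeMap_comp, localizeMap_map, localizeMap_map, ← Category.assoc, e,
      Category.assoc, Category.assoc, ha]
  · have h1 : IsIso (W.Q.map ((T.ι m).app N)) := W.Q_inverts _ (T.mem _ _)
    have h2 : IsIso (W.Q.map ((T.ι m).app N) ≫ W.Q.map j) := inferInstance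
    exact @isIso_of_isIso_hom _ _ _ _ _ _ _ _ h2

end Truncation

/-- Equivariantization by a finite group commutes with localization: if `D` is equivalent to the
category of equivariant objects of `C`, then the localization of `D` is equivalent to the category
of equivariant objects of the localization of `C`. -/
theorem nonempty_localization_equivalence_equivariantObject [W.HasRightCalculusOfFractions]
    [Finite G] (T : Φ.Truncation W) (iso : ∀ ⦃X Y : C⦄ (f : X ⟶ Y) [IsIso f], W f)
    (hW : ∀ (g : G) ⦃X Y : C⦄ (f : X ⟶ Y), W f → W ((Φ.F g).map f))
    {D : Type u₁} [Category.{v₁} D] (V : MorphismProperty D) [V.HasRightCalculusOfFractions]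
    (Θ : D ⥤ EquivariantObject Φ) [Θ.IsEquivalence]
    (hV : ∀ ⦃X Y : D⦄ (f : X ⟶ Y), V f ↔ W (Hom.hom (Θ.map f))) :
    Nonempty (V.Localization ≌ EquivariantObject (Φ.localize W hW)) := by
  have hiso (X Y : EquivariantObject Φ) (e : X ≅ Y) : W (Hom.hom e.hom) := by
    have : IsIso (Hom.hom e.hom) := ⟨Hom.hom e.inv, congrArg Hom.hom e.hom_inv_id,
      congrArg Hom.hom e.inv_hom_id⟩
    exact iso _
  refine nonempty_localization_equivalence V (Θ ⋙ Φ.localizeEquivariant W hW)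
    (fun X Y f hf => ?_) (fun Y => ?_) (fun X Y θ => ?_) (fun X Y f g h => ?_)
  · have : IsIso (W.Q.map (Hom.hom (Θ.map f))) := W.Q_inverts _ ((hV f).1 hf)
    exact @isIso_of_isIso_hom _ _ _ _ _ _ _ _ this
  · obtain ⟨X, ⟨e⟩⟩ := T.exists_equivariant_iso Y
    exact ⟨Θ.objPreimage X, ⟨(Φ.localizeEquivariant W hW).mapIso (Θ.objObjPreimageIso X) ≪≫ e⟩⟩
  · obtain ⟨Z, s, f, hs, e⟩ := T.exists_equivariant_fraction θ
    have hi := hiso _ _ (Θ.objObjPreimageIso Z)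
    refine ⟨Θ.objPreimage Z, Θ.preimage ((Θ.objObjPreimageIso Z).hom ≫ s),
      Θ.preimage ((Θ.objObjPreimageIso Z).hom ≫ f), ?_, ?_⟩
    · rw [hV, Θ.map_preimage]
      exact W.comp_mem _ _ hi hs
    · rw [Functor.comp_map, Functor.comp_map, Θ.map_preimage, Θ.map_preimage, Functor.map_comp,
        Functor.map_comp, Category.assoc, e]
  · obtain ⟨Z, s, hs, e⟩ := T.exists_equivariant_equalizer _ _ h
    have hi := hiso _ _ (Θ.objObjPreimageIso Z)
    refine ⟨Θ.objPreimage Z, Θ.preimage ((Θ.objObjPreimageIso Z).hom ≫ s), ?_, ?_⟩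
    · rw [hV, Θ.map_preimage]
      exact W.comp_mem _ _ hi hs
    · apply Θ.map_injective
      rw [Functor.map_comp, Functor.map_comp, Θ.map_preimage, Category.assoc, e, Category.assoc]

end Truncation

end CatAction

/-! ### Gradings of vector spaces -/

section IsGrading

variable {k : Type*} {M N : Type*} {G : Type*} [Field k] [AddCommGroup M] [Module k M]
  [AddCommGroup N] [Module k N]

/-- The family of subspaces `ℳ` is a grading: the ambient space is their internal direct sum. -/
structure IsGrading (ℳ : G → Submodule k M) : Prop where
  indep : iSupIndep ℳ
  iSup_eq : ⨆ g, ℳ g = ⊤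

namespace IsGrading

open Classical in
/-- The projection onto a homogeneous component. -/
noncomputable def proj {ℳ : G → Submodule k M} (h : IsGrading ℳ) (g : G) : M →ₗ[k] M :=
  letI := (DirectSum.isInternal_submodule_of_iSupIndep_of_iSup_eq_top
    h.indep h.iSup_eq).chooseDecomposition
  (ℳ g).subtype ∘ₗ DirectSum.component k G (fun g => ℳ g) g ∘ₗ
    (DirectSum.decomposeLinearEquiv ℳ).toLinearMap

variable {ℳ : G → Submodule k M} (h : IsGrading ℳ) {𝒩 : G → Submodule k N} (h' : IsGrading 𝒩)

theorem proj_mem (g : G) (x : M) : h.proj g x ∈ ℳ g := Subtype.prop _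

theorem proj_same {g : G} {x : M} (hx : x ∈ ℳ g) : h.proj g x = x := by
  classical
  let := (DirectSum.isInternal_submodule_of_iSupIndep_of_iSup_eq_top
    h.indep h.iSup_eq).chooseDecomposition
  exact DirectSum.decompose_of_mem_same ℳ hx

theorem proj_ne {g g' : G} {x : M} (hx : x ∈ ℳ g) (hg : g ≠ g') : h.proj g' x = 0 := by
  classical
  let := (DirectSum.isInternal_submodule_of_iSupIndep_of_iSup_eq_top
    h.indep h.iSup_eq).chooseDecomposition
  exact DirectSum.decompose_of_mem_ne ℳ hx hg

theorem proj_proj_same (g : G) (x : M) : h.proj g (h.proj g x) = h.proj g x :=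
  h.proj_same (h.proj_mem g x)

theorem proj_proj_ne {g g' : G} (hg : g ≠ g') (x : M) : h.proj g' (h.proj g x) = 0 :=
  h.proj_ne (h.proj_mem g x) hg

theorem finite_support (x : M) : {g | h.proj g x ≠ 0}.Finite := by
  classical
  let := (DirectSum.isInternal_submodule_of_iSupIndep_of_iSup_eq_top
    h.indep h.iSup_eq).chooseDecomposition
  refine (DFinsupp.support (DirectSum.decompose ℳ x)).finite_toSet.subset fun g hg => ?_
  rw [Finset.mem_coe, DFinsupp.mem_support_iff]
  intro h0
  exact hg (congrArg Subtype.val h0)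

theorem sum_proj (x : M) : ∑ g ∈ (h.finite_support x).toFinset, h.proj g x = x := by
  classical
  let := (DirectSum.isInternal_submodule_of_iSupIndep_of_iSup_eq_top
    h.indep h.iSup_eq).chooseDecomposition
  refine Eq.trans ?_ (DirectSum.sum_support_decompose ℳ x)
  refine Finset.sum_congr ?_ fun _ _ => rfl
  ext g
  rw [Set.Finite.mem_toFinset, DFinsupp.mem_support_iff]
  exact not_congr ⟨fun h0 => Subtype.ext h0, fun h0 => congrArg Subtype.val h0⟩

theorem ext {x y : M} (e : ∀ g, h.proj g x = h.proj g y) : x = y := by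
  rw [← h.sum_proj x, ← h.sum_proj y]
  exact Finset.sum_congr (by ext g; simp [e g]) fun g _ => e g

theorem mem_iff {g : G} {x : M} : x ∈ ℳ g ↔ ∀ g', g' ≠ g → h.proj g' x = 0 := by
  refine ⟨fun hx g' hg => h.proj_ne hx hg.symm, fun hx => ?_⟩
  have : x = h.proj g x := h.ext fun g' => by
    by_cases hg : g' = g
    · rw [hg, h.proj_proj_same]
    · rw [hx g' hg, h.proj_proj_ne (Ne.symm hg)]
  rw [this]
  exact h.proj_mem g x

/-- A subspace containing the components of `x` contains `x`. -/
theorem mem_of_proj_mem {U : Submodule k M} {x : M} (hx : ∀ g, h.proj g x ∈ U) : x ∈ U := by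
  rw [← h.sum_proj x]
  exact U.sum_mem fun g _ => hx g

theorem iSup_induction {P : M → Prop} {ℳ : G → Submodule k M} (hs : ⨆ g, ℳ g = ⊤)
    (zero : P 0) (hom : ∀ g, ∀ x ∈ ℳ g, P x)
    (add : ∀ x y, P x → P y → P (x + y)) (x : M) : P x :=
  Submodule.iSup_induction ℳ (motive := P) (hs ▸ Submodule.mem_top : x ∈ ⨆ g, ℳ g) hom zero add

theorem induction (h : IsGrading ℳ) {P : M → Prop} (zero : P 0) (hom : ∀ g, ∀ x ∈ ℳ g, P x)
    (add : ∀ x y, P x → P y → P (x + y)) (x : M) : P x :=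
  iSup_induction h.iSup_eq zero hom add x

theorem mem_biSup_iff {p : G → Prop} {x : M} :
    x ∈ ⨆ g, ⨆ _ : p g, ℳ g ↔ ∀ g, ¬ p g → h.proj g x = 0 := by
  constructor
  · intro hx g hg
    have : ⨆ g, ⨆ _ : p g, ℳ g ≤ LinearMap.ker (h.proj g) := by
      refine iSup₂_le fun g' hg' y hy => h.proj_ne hy ?_
      rintro rfl
      exact hg hg'
    exact this hx
  · intro hx
    refine h.mem_of_proj_mem fun g => ?_
    by_cases hg : p g
    · exact Submodule.mem_iSup_of_mem g (Submodule.mem_iSup_of_mem hg (h.proj_mem g x))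
    · rw [hx g hg]
      exact zero_mem _

/-- Maps which shift degrees injectively commute with the projections. -/
theorem map_proj_of_injective {G' : Type*} {𝒩 : G' → Submodule k N} (h' : IsGrading 𝒩)
    (f : M →ₗ[k] N) {σ : G → G'} (hσ : Function.Injective σ)
    (hf : ∀ g, ∀ x ∈ ℳ g, f x ∈ 𝒩 (σ g)) (g : G) (x : M) :
    f (h.proj g x) = h'.proj (σ g) (f x) := by
  induction x using h.induction with
  | zero => simp
  | hom g' x hx =>
    by_cases hg : g' = g
    · subst hg
      rw [h.proj_same hx, h'.proj_same (hf _ _ hx)]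
    · rw [h.proj_ne hx hg, h'.proj_ne (hf _ _ hx) (hσ.ne hg), map_zero]
  | add x y hx hy => simp only [map_add, hx, hy]

/-- Degree-preserving maps commute with the projections. -/
theorem map_proj (f : M →ₗ[k] N) (hf : ∀ g, ∀ x ∈ ℳ g, f x ∈ 𝒩 g) (g : G) (x : M) :
    f (h.proj g x) = h'.proj g (f x) :=
  h.map_proj_of_injective h' f Function.injective_id hf g x

open Classical in
/-- The linear map which is given by `f g` on the homogeneous component of degree `g`. -/
noncomputable def lift {ℳ : G → Submodule k M} (h : IsGrading ℳ) (f : G → M →ₗ[k] N) :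
    M →ₗ[k] N :=
  letI := (DirectSum.isInternal_submodule_of_iSupIndep_of_iSup_eq_top
    h.indep h.iSup_eq).chooseDecomposition
  DirectSum.toModule k G N (fun g => f g ∘ₗ (ℳ g).subtype) ∘ₗ
    (DirectSum.decomposeLinearEquiv ℳ).toLinearMap

theorem lift_apply (f : G → M →ₗ[k] N) {g : G} {x : M} (hx : x ∈ ℳ g) : h.lift f x = f g x := by
  classical
  let := (DirectSum.isInternal_submodule_of_iSupIndep_of_iSup_eq_top
    h.indep h.iSup_eq).chooseDecomposition
  have : DirectSum.decomposeLinearEquiv ℳ x = DirectSum.lof k G (fun g => ℳ g) g ⟨x, hx⟩ :=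
    DirectSum.decompose_of_mem ℳ hx
  change DirectSum.toModule k G N (fun g => f g ∘ₗ (ℳ g).subtype)
    (DirectSum.decomposeLinearEquiv ℳ x) = f g x
  rw [this, DirectSum.toModule_lof]
  rfl

/-- A family of subspaces with suitable projections is independent. -/
theorem of_proj (P : G → M →ₗ[k] M) (hP : ∀ g, ∀ x ∈ ℳ g, P g x = x)
    (hP' : ∀ g g', g ≠ g' → ∀ x ∈ ℳ g, P g' x = 0) (hs : ⨆ g, ℳ g = ⊤) : IsGrading ℳ := by
  refine ⟨fun g => Submodule.disjoint_def.2 fun x hx hx' => ?_, hs⟩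
  rw [← hP g x hx]
  have : ⨆ g', ⨆ _ : g' ≠ g, ℳ g' ≤ LinearMap.ker (P g) :=
    iSup₂_le fun g' hg y hy => hP' g' g hg y hy
  exact this hx'

/-- A finite-dimensional subspace lives in finitely many degrees. -/
theorem finite_support_of_finiteDimensional (U : Submodule k M) [FiniteDimensional k U] :
    {g | ∃ x ∈ U, h.proj g x ≠ 0}.Finite := by
  obtain ⟨S, hS⟩ := (Submodule.fg_iff_finiteDimensional U).2 inferInstance
  refine (S.finite_toSet.biUnion fun x _ => h.finite_support x).subset ?_
  rintro g ⟨x, hx, hg⟩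
  by_contra hn
  simp only [Set.mem_iUnion, not_exists] at hn
  have : U ≤ LinearMap.ker (h.proj g) := by
    rw [← hS, Submodule.span_le]
    intro y hy
    by_contra hy'
    exact hn y hy hy'
  exact hg (this hx)

end IsGrading

/-- If a finitely generated module is spanned by homogeneous elements, then it is generated by
finitely many homogeneous elements. -/
theorem exists_homogeneous_generators {A : Type*} [CommRing A] [Module A M] [Module.Finite A M]
    (ℳ : G → Submodule k M) (h : ⨆ g, ℳ g = ⊤) :
    ∃ S : Finset M, (∀ s ∈ S, ∃ g, s ∈ ℳ g) ∧ Submodule.span A (S : Set M) = ⊤ := by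
  classical
  obtain ⟨T, hT⟩ := Module.Finite.fg_top (R := A) (M := M)
  have key (x : M) : ∃ S : Finset M, (∀ s ∈ S, ∃ g, s ∈ ℳ g) ∧
      x ∈ Submodule.span A (S : Set M) := by
    induction x using IsGrading.iSup_induction h with
    | zero => exact ⟨∅, by simp, zero_mem _⟩
    | hom g x hx => exact ⟨{x}, by simpa using ⟨g, hx⟩, Submodule.subset_span (by simp)⟩
    | add x y hx hy =>
      obtain ⟨S, hS, hxS⟩ := hx
      obtain ⟨S', hS', hxS'⟩ := hy
      refine ⟨S ∪ S', fun s hs => ?_, add_mem ?_ ?_⟩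
      · rcases Finset.mem_union.1 hs with hs | hs
        exacts [hS s hs, hS' s hs]
      · exact Submodule.span_mono (by simp) hxS
      · exact Submodule.span_mono (by simp) hxS'
  choose S hS hxS using key
  refine ⟨T.biUnion S, fun s hs => ?_, top_unique ?_⟩
  · obtain ⟨t, -, hs⟩ := Finset.mem_biUnion.1 hs
    exact hS t s hs
  · rw [← hT, Submodule.span_le]
    intro t ht
    refine Submodule.span_mono ?_ (hxS t)
    exact Finset.coe_subset.2 (Finset.subset_biUnion_of_mem S ht)

end IsGrading

/-! ### Linear maps with finite-dimensional kernel and cokernel -/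

section FiniteDimensional

variable {k : Type*} {M N P : Type*} [Field k] [AddCommGroup M] [Module k M]
  [AddCommGroup N] [Module k N] [AddCommGroup P] [Module k P]

theorem finiteDimensional_quotient_iff {U : Submodule k M} :
    FiniteDimensional k (M ⧸ U) ↔ ∃ V : Submodule k M, FiniteDimensional k V ∧ V ⊔ U = ⊤ := by
  constructor
  · intro h
    obtain ⟨V, hV⟩ := U.exists_isCompl
    exact ⟨V, (Submodule.quotientEquivOfIsCompl U V hV).finiteDimensional,
      hV.symm.sup_eq_top⟩
  · rintro ⟨V, hV, h⟩
    refine Module.Finite.of_surjective (U.mkQ ∘ₗ V.subtype) fun x => ?_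
    obtain ⟨x, rfl⟩ := U.mkQ_surjective x
    obtain ⟨v, hv, y, hy, rfl⟩ := Submodule.mem_sup.1 (h ▸ Submodule.mem_top : x ∈ V ⊔ U)
    exact ⟨⟨v, hv⟩, by simpa using hy⟩

theorem finiteDimensional_of_map_of_inf (f : M →ₗ[k] N) (U : Submodule k M)
    (h1 : FiniteDimensional k (U.map f)) (h2 : FiniteDimensional k ↥(U ⊓ LinearMap.ker f)) :
    FiniteDimensional k U := by
  rw [← Submodule.fg_iff_finiteDimensional] at *
  exact Submodule.fg_of_fg_map_of_fg_inf_ker f h1 h2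

/-- The linear map `f` is invertible up to finite-dimensional spaces. -/
def LinearMap.IsIsoModFD (f : M →ₗ[k] N) : Prop :=
  FiniteDimensional k (LinearMap.ker f) ∧ FiniteDimensional k (N ⧸ LinearMap.range f)

namespace LinearMap.IsIsoModFD

theorem of_bijective {f : M →ₗ[k] N} (hf : Function.Bijective f) : f.IsIsoModFD := by
  refine ⟨?_, ?_⟩
  · rw [LinearMap.ker_eq_bot.2 hf.1]
    infer_instance
  · rw [finiteDimensional_quotient_iff, LinearMap.range_eq_top.2 hf.2]
    exact ⟨⊥, inferInstance, by simp⟩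

theorem comp {g : N →ₗ[k] P} {f : M →ₗ[k] N} (hg : g.IsIsoModFD) (hf : f.IsIsoModFD) :
    (g ∘ₗ f).IsIsoModFD := by
  obtain ⟨hg1, hg2⟩ := hg
  obtain ⟨hf1, hf2⟩ := hf
  refine ⟨finiteDimensional_of_map_of_inf f _ ?_ ?_, ?_⟩
  · refine Submodule.finiteDimensional_of_le (S₂ := LinearMap.ker g) ?_
    rintro _ ⟨x, hx, rfl⟩
    exact hx
  · exact Submodule.finiteDimensional_of_le (S₂ := LinearMap.ker f) inf_le_right
  · rw [finiteDimensional_quotient_iff] at *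
    obtain ⟨V, hV, hV'⟩ := hf2
    obtain ⟨U, hU, hU'⟩ := hg2
    refine ⟨U ⊔ V.map g, inferInstance, ?_⟩
    rw [sup_assoc, LinearMap.range_comp, ← Submodule.map_sup, hV', Submodule.map_top, hU']

theorem cancel_right {g : N →ₗ[k] P} {f : M →ₗ[k] N} (hf : f.IsIsoModFD)
    (hgf : (g ∘ₗ f).IsIsoModFD) : g.IsIsoModFD := by
  obtain ⟨hf1, hf2⟩ := hf
  obtain ⟨hg1, hg2⟩ := hgf
  refine ⟨finiteDimensional_of_map_of_inf (LinearMap.range f).mkQ _ inferInstance ?_, ?_⟩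
  · refine Submodule.finiteDimensional_of_le (S₂ := (LinearMap.ker (g ∘ₗ f)).map f) ?_
    rintro x ⟨hx, hx'⟩
    rw [Submodule.ker_mkQ] at hx'
    obtain ⟨y, rfl⟩ := hx'
    exact ⟨y, hx, rfl⟩
  · rw [finiteDimensional_quotient_iff] at *
    obtain ⟨V, hV, hV'⟩ := hg2
    refine ⟨V, hV, top_unique (hV'.ge.trans (sup_le_sup_left ?_ V))⟩
    exact LinearMap.range_comp_le_range f g

end LinearMap.IsIsoModFD

end FiniteDimensional

/-! ### Graded modules over positively graded algebras -/

section PositivelyGraded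

variable {k A : Type u} [Field k] [CommRing A] [Algebra k A] {G : Type w} [AddCommGroup G]

/-- The family `𝒜` is a grading of `A` which is positive for the degree function `δ`, with
finite-dimensional parts in bounded degree. -/
structure PositivelyGraded (𝒜 : G → Submodule k A) (δ : G →+ ℤ) : Prop where
  isGrading : IsGrading 𝒜
  eq_bot : ∀ g, δ g < 0 → 𝒜 g = ⊥
  finite : ∀ n : ℤ, FiniteDimensional k ↥(⨆ g, ⨆ _ : δ g < n, 𝒜 g)

namespace GradedModFP

variable {𝒜 : G → Submodule k A}

theorem isGrading (X : GradedModFP 𝒜) : IsGrading X.comp := ⟨X.indep, X.iSup_comp⟩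

/-- The projection onto a homogeneous component. -/
noncomputable abbrev proj (X : GradedModFP 𝒜) (g : G) : X.carrier →ₗ[k] X.carrier :=
  X.isGrading.proj g

theorem finite (X : GradedModFP 𝒜) : Module.Finite A X.carrier :=
  haveI := X.finitePresentation
  inferInstance

theorem proj_smul (X : GradedModFP 𝒜) {d : G} {a : A} (ha : a ∈ 𝒜 d) (g : G) (x : X.carrier) :
    X.proj (d + g) (a • x) = a • X.proj g x := by
  induction x using X.isGrading.induction with
  | zero => simp
  | hom g' x hx =>
    by_cases hg : g' = g
    · subst hg
      rw [X.isGrading.proj_same hx, X.isGrading.proj_same (X.smul_mem ha hx)]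
    · rw [X.isGrading.proj_ne hx hg, X.isGrading.proj_ne (X.smul_mem ha hx) (by simpa using hg),
        smul_zero]
  | add x y hx hy => simp only [smul_add, map_add, hx, hy]

theorem proj_smul' (X : GradedModFP 𝒜) {d : G} {a : A} (ha : a ∈ 𝒜 d) (g : G) (x : X.carrier) :
    X.proj g (a • x) = a • X.proj (g - d) x := by
  rw [← X.proj_smul ha, add_sub_cancel]

theorem Hom.map_proj {X Y : GradedModFP 𝒜} (f : X ⟶ Y) (g : G) (x : X.carrier) :
    f.toLinearMap (X.proj g x) = Y.proj g (f.toLinearMap x) :=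
  X.isGrading.map_proj Y.isGrading (Hom.kLinearMap f) (fun _ _ h => f.map_mem h) g x

theorem isoModFD_of_bijective {X Y : GradedModFP 𝒜} (f : X ⟶ Y)
    (hf : Function.Bijective f.toLinearMap) : isoModFD 𝒜 f :=
  LinearMap.IsIsoModFD.of_bijective hf

theorem isoModFD_of_isIso {X Y : GradedModFP 𝒜} (f : X ⟶ Y) [IsIso f] : isoModFD 𝒜 f := by
  refine isoModFD_of_bijective f (Function.bijective_iff_has_inverse.2
    ⟨(inv f).toLinearMap, fun x => ?_, fun x => ?_⟩)
  · exact DFunLike.congr_fun (congrArg Hom.toLinearMap (IsIso.hom_inv_id f)) x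
  · exact DFunLike.congr_fun (congrArg Hom.toLinearMap (IsIso.inv_hom_id f)) x

theorem isoModFD_cancel ⦃X Y Z : GradedModFP 𝒜⦄ (f : X ⟶ Y) (g : Y ⟶ Z) (hf : isoModFD 𝒜 f)
    (hfg : isoModFD 𝒜 (f ≫ g)) : isoModFD 𝒜 g :=
  LinearMap.IsIsoModFD.cancel_right (f := Hom.kLinearMap f) hf hfg

instance : (isoModFD 𝒜).IsMultiplicative where
  id_mem X := isoModFD_of_isIso (𝟙 X)
  comp_mem f g hf hg := LinearMap.IsIsoModFD.comp (f := Hom.kLinearMap f)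
    (g := Hom.kLinearMap g) hg hf

/-- An isomorphism of graded modules from a degree-preserving bijective linear map. -/
noncomputable def isoOfBijective {X Y : GradedModFP 𝒜} (f : X ⟶ Y)
    (hf : Function.Bijective f.toLinearMap) : X ≅ Y where
  hom := f
  inv := ⟨(LinearEquiv.ofBijective f.toLinearMap hf).symm, fun {g y} hy => by
    rw [X.isGrading.mem_iff]
    intro g' hg
    apply hf.1
    rw [f.map_proj, map_zero]
    have : f.toLinearMap ((LinearEquiv.ofBijective f.toLinearMap hf).symm y) = y :=
      (LinearEquiv.ofBijective f.toLinearMap hf).apply_symm_apply y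
    exact (congrArg _ this).trans (Y.isGrading.proj_ne hy hg.symm)⟩
  hom_inv_id := hom_ext (LinearMap.ext fun x =>
    (LinearEquiv.ofBijective f.toLinearMap hf).symm_apply_apply x)
  inv_hom_id := hom_ext (LinearMap.ext fun x =>
    (LinearEquiv.ofBijective f.toLinearMap hf).apply_symm_apply x)

/-! ### Truncations of graded modules -/

variable {δ : G →+ ℤ} (hA : PositivelyGraded 𝒜 δ)

/-- The submodule of elements without components of degree `< n`. -/
noncomputable def truncSub (hA : PositivelyGraded 𝒜 δ) (n : ℤ) (X : GradedModFP 𝒜) :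
    Submodule A X.carrier where
  carrier := {x | ∀ g, δ g < n → X.proj g x = 0}
  zero_mem' := by simp
  add_mem' hx hy g hg := by rw [map_add, hx g hg, hy g hg, add_zero]
  smul_mem' a x hx g hg := by
    induction a using hA.isGrading.induction with
    | zero => simp
    | hom d a ha =>
      by_cases hd : δ d < 0
      · rw [hA.eq_bot d hd, Submodule.mem_bot] at ha
        simp [ha]
      · rw [X.proj_smul' ha, hx _ (by rw [map_sub]; omega), smul_zero]
    | add a b ha hb => rw [add_smul, map_add, ha, hb, add_zero]

theorem mem_truncSub_of_mem {n : ℤ} {X : GradedModFP 𝒜} {g : G} {x : X.carrier}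
    (hx : x ∈ X.comp g) (hg : n ≤ δ g) : x ∈ X.truncSub hA n := by
  intro g' hg'
  refine X.isGrading.proj_ne hx ?_
  rintro rfl
  omega

theorem proj_mem_truncSub (n : ℤ) (X : GradedModFP 𝒜) (x) (hx : x ∈ X.truncSub hA n) (g : G) :
    X.proj g x ∈ X.truncSub hA n := by
  by_cases hg : δ g < n
  · rw [hx g hg]
    exact zero_mem _
  · exact mem_truncSub_of_mem hA (X.isGrading.proj_mem g x) (by omega)

/-- The parts in bounded degree of a finitely generated graded module are finite-dimensional. -/
theorem finiteDimensional_lt (hA : PositivelyGraded 𝒜 δ) (n : ℤ) (X : GradedModFP 𝒜) :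
    FiniteDimensional k ↥(⨆ g, ⨆ _ : δ g < n, X.comp g) := by
  classical
  have := X.finite
  obtain ⟨S, hS, hS'⟩ := exists_homogeneous_generators (A := A) X.comp X.iSup_comp
  choose! d hd using hS
  have := hA.finite
  let U : Submodule k X.carrier := ⨆ s : S, (⨆ g, ⨆ _ : δ g < n - δ (d s), 𝒜 g).map
    ((LinearMap.toSpanSingleton A X.carrier s.1).restrictScalars k)
  have key (x : X.carrier) (g : G) (hg : δ g < n) : X.proj g x ∈ U := by
    have hx : x ∈ Submodule.span A (S : Set X.carrier) := hS' ▸ Submodule.mem_top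
    induction hx using Submodule.closure_induction with
    | zero => simp
    | add x y _ _ hx hy => rw [map_add]; exact add_mem hx hy
    | smul_mem a x hx =>
      refine Submodule.mem_iSup_of_mem ⟨x, hx⟩ ?_
      induction a using hA.isGrading.induction with
      | zero => simp
      | hom g' a ha =>
        by_cases hg' : g' + d x = g
        · have h1 : X.proj g (a • x) = a • x := by
            rw [← hg']
            exact X.isGrading.proj_same (X.smul_mem ha (hd x hx))
          rw [h1]
          refine ⟨a, Submodule.mem_iSup_of_mem g' (Submodule.mem_iSup_of_mem ?_ ha), rfl⟩
          rw [← hg', map_add] at hg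
          dsimp only
          omega
        · rw [X.isGrading.proj_ne (X.smul_mem ha (hd x hx)) hg']
          exact zero_mem _
      | add a b ha hb => rw [add_smul, map_add]; exact add_mem ha hb
  refine Submodule.finiteDimensional_of_le (S₂ := U) (iSup₂_le fun g hg x hx => ?_)
  rw [← X.isGrading.proj_same hx]
  exact key x g hg

/-- A linear map with finite-dimensional kernel and cokernel is bijective in large degree. -/
theorem exists_bijective_ge {Z X : GradedModFP 𝒜} (s : Z ⟶ X) (hs : isoModFD 𝒜 s) :
    ∃ n : ℤ, ∀ g, n ≤ δ g → (∀ z ∈ Z.comp g, s.toLinearMap z = 0 → z = 0) ∧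
      ∀ x ∈ X.comp g, ∃ z ∈ Z.comp g, s.toLinearMap z = x := by
  obtain ⟨h1, h2⟩ := hs
  obtain ⟨V, hV, hV'⟩ := finiteDimensional_quotient_iff.1 h2
  have f1 := Z.isGrading.finite_support_of_finiteDimensional (LinearMap.ker (Hom.kLinearMap s))
  have f2 := X.isGrading.finite_support_of_finiteDimensional V
  obtain ⟨n, hn⟩ := ((f1.union f2).image δ).bddAbove
  refine ⟨n + 1, fun g hg => ⟨fun z hz hsz => ?_, fun x hx => ?_⟩⟩
  · by_contra h0
    have : δ g ≤ n := hn ⟨g, Or.inl ⟨z, hsz, by rwa [Z.isGrading.proj_same hz]⟩, rfl⟩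
    omega
  · obtain ⟨v, hv, y, ⟨z, rfl⟩, hvz⟩ :=
      Submodule.mem_sup.1 (hV' ▸ Submodule.mem_top : x ∈ V ⊔ LinearMap.range (Hom.kLinearMap s))
    refine ⟨Z.proj g z, Z.isGrading.proj_mem g z, ?_⟩
    have hv0 : X.proj g v = 0 := by
      by_contra h0
      have : δ g ≤ n := hn ⟨g, Or.inr ⟨v, hv, h0⟩, rfl⟩
      omega
    rw [Hom.map_proj, ← X.isGrading.proj_same hx, ← hvz, map_add]
    exact (add_eq_right.2 hv0).symm

variable [IsNoetherianRing A]

/-- The graded module structure on a homogeneous submodule. -/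
noncomputable abbrev subObj (X : GradedModFP 𝒜) (N : Submodule A X.carrier)
    (hN : ∀ x ∈ N, ∀ g, X.proj g x ∈ N) : GradedModFP 𝒜 where
  carrier := N
  comp g := (X.comp g).comap (N.subtype.restrictScalars k)
  indep := by
    refine fun g => Submodule.disjoint_def.2 fun x hx hx' => ?_
    apply Subtype.ext
    refine Submodule.disjoint_def.1 (X.indep g) x.1 hx ?_
    have : ⨆ g', ⨆ _ : g' ≠ g, (X.comp g').comap (N.subtype.restrictScalars k) ≤
        (⨆ g', ⨆ _ : g' ≠ g, X.comp g').comap (N.subtype.restrictScalars k) :=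
      iSup₂_le fun g' hg => Submodule.comap_mono (le_iSup₂_of_le g' hg le_rfl)
    exact this hx'
  iSup_comp := by
    refine top_unique fun x _ => ?_
    have : x = ∑ g ∈ (X.isGrading.finite_support x.1).toFinset,
        (⟨X.proj g x.1, hN x.1 x.2 g⟩ : N) := by
      apply Subtype.ext
      rw [AddSubmonoidClass.coe_finsetSum]
      exact (X.isGrading.sum_proj x.1).symm
    rw [this]
    exact Submodule.sum_mem _ fun g _ => Submodule.mem_iSup_of_mem g (X.isGrading.proj_mem g _)
  smul_mem ha hx := X.smul_mem ha hx
  finitePresentation :=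
    haveI := X.finite
    haveI : IsNoetherian A X.carrier := isNoetherian_of_isNoetherianRing_of_finite A _
    Module.finitePresentation_of_finite A N

/-- The inclusion of a homogeneous submodule. -/
noncomputable def subObjι (X : GradedModFP 𝒜) (N : Submodule A X.carrier)
    (hN : ∀ x ∈ N, ∀ g, X.proj g x ∈ N) : X.subObj N hN ⟶ X :=
  Hom.mk (X := X.subObj N hN) N.subtype fun h => h

/-- The truncation functor `X ↦ X_{≥ n}`. -/
noncomputable def trunc (n : ℤ) : GradedModFP 𝒜 ⥤ GradedModFP 𝒜 where
  obj X := X.subObj (X.truncSub hA n) (X.proj_mem_truncSub hA n)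
  map {X Y} f := Hom.mk (X := X.subObj _ (X.proj_mem_truncSub hA n))
    (Y := Y.subObj _ (Y.proj_mem_truncSub hA n))
    ((Hom.toLinearMap (X := X) (Y := Y) f).restrict fun x hx g hg => by
      rw [← Hom.map_proj, hx g hg, map_zero]) fun h => Hom.map_mem (X := X) (Y := Y) f h

/-- The inclusion `X_{≥ n} ↪ X`. -/
noncomputable def truncι (n : ℤ) : trunc hA n ⟶ 𝟭 (GradedModFP 𝒜) where
  app X := X.subObjι _ (X.proj_mem_truncSub hA n)
  naturality _ _ _ := rfl

theorem truncι_injective (n : ℤ) (X : GradedModFP 𝒜) :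
    Function.Injective (Hom.toLinearMap ((truncι hA n).app X)) := Subtype.val_injective

theorem isoModFD_truncι (n : ℤ) (X : GradedModFP 𝒜) :
    isoModFD 𝒜 ((truncι hA n).app X) := by
  refine ⟨?_, ?_⟩
  · have : LinearMap.ker (Hom.kLinearMap ((truncι hA n).app X)) = ⊥ :=
      LinearMap.ker_eq_bot.2 (truncι_injective hA n X)
    rw [this]
    infer_instance
  · rw [finiteDimensional_quotient_iff]
    refine ⟨_, finiteDimensional_lt hA n X, top_unique fun x hx => ?_⟩
    clear hx
    induction x using X.isGrading.induction with
    | zero => exact zero_mem _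
    | hom g x hx =>
      by_cases hg : δ g < n
      · exact Submodule.mem_sup_left (Submodule.mem_iSup_of_mem g
          (Submodule.mem_iSup_of_mem hg hx))
      · exact Submodule.mem_sup_right ⟨⟨x, mem_truncSub_of_mem hA hx (by omega)⟩, rfl⟩
    | add x y hx hy => exact add_mem hx hy

/-- The truncations are cofinal among the morphisms with finite-dimensional kernel and cokernel. -/
theorem exists_trunc_lift {Z X : GradedModFP 𝒜} (s : Z ⟶ X) (hs : isoModFD 𝒜 s) :
    ∃ (n : ℤ) (u : (trunc hA n).obj X ⟶ Z), u ≫ s = (truncι hA n).app X := by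
  obtain ⟨n, hn⟩ := exists_bijective_ge (δ := δ) s hs
  have inj : ∀ z ∈ Z.truncSub hA n, s.toLinearMap z = 0 → z = 0 := by
    intro z hz hsz
    refine Z.isGrading.ext fun g => ?_
    rw [map_zero]
    by_cases hg : δ g < n
    · exact hz g hg
    · refine (hn g (by omega)).1 _ (Z.isGrading.proj_mem g z) ?_
      exact (s.map_proj g z).trans (by rw [hsz, map_zero])
  have bij : Function.Bijective (Hom.toLinearMap ((trunc hA n).map s)) := by
    refine ⟨(injective_iff_map_eq_zero _).2 fun z hz =>
      Subtype.ext (inj z.1 z.2 (congrArg Subtype.val hz)), fun x => ?_⟩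
    have hx : x.1 ∈ ((Z.truncSub hA n).map s.toLinearMap).restrictScalars k := by
      refine X.isGrading.mem_of_proj_mem fun g => ?_
      by_cases hg : δ g < n
      · have : X.proj g x.1 = 0 := x.2 g hg
        rw [this]
        exact zero_mem _
      · obtain ⟨z, hz, hz'⟩ := (hn g (by omega)).2 _ (X.isGrading.proj_mem g x.1)
        exact ⟨z, mem_truncSub_of_mem hA hz (by omega), hz'⟩
    obtain ⟨z, hz, hz'⟩ := hx
    exact ⟨⟨z, hz⟩, Subtype.ext hz'⟩
  let e := isoOfBijective ((trunc hA n).map s) bij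
  refine ⟨n, e.inv ≫ (truncι hA n).app Z, ?_⟩
  have := (truncι hA n).naturality s
  rw [Category.assoc, Iso.inv_comp_eq]
  exact this.symm

/-- As truncations are functorial and cofinal, a fraction `s⁻¹ f` can be rewritten with a truncation
as denominator. -/
theorem hasRightCalculusOfFractions (hA : PositivelyGraded 𝒜 δ) :
    (isoModFD 𝒜).HasRightCalculusOfFractions where
  exists_rightFraction X Y φ := by
    obtain ⟨n, u, hu⟩ := exists_trunc_lift hA φ.s φ.hs
    refine ⟨⟨(truncι hA n).app X, isoModFD_truncι hA n X, (trunc hA n).map φ.f ≫ u⟩, ?_⟩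
    have := (truncι hA n).naturality φ.f
    change (truncι hA n).app X ≫ φ.f = ((trunc hA n).map φ.f ≫ u) ≫ φ.s
    rw [Category.assoc, hu, this]
    rfl
  ext X Y Y' f₁ f₂ s hs h := by
    obtain ⟨n, hn⟩ := exists_bijective_ge (δ := δ) s hs
    refine ⟨_, (truncι hA n).app X, isoModFD_truncι hA n X, hom_ext (LinearMap.ext fun x => ?_)⟩
    have e : s.toLinearMap (f₁.toLinearMap x.1) = s.toLinearMap (f₂.toLinearMap x.1) :=
      DFunLike.congr_fun (congrArg Hom.toLinearMap h) x.1
    change f₁.toLinearMap x.1 = f₂.toLinearMap x.1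
    refine Y.isGrading.ext fun g => ?_
    by_cases hg : δ g < n
    · have h0 := x.2 g hg
      refine ((f₁.map_proj g x.1).symm.trans ?_).trans (f₂.map_proj g x.1)
      rw [h0, map_zero, map_zero]
    · rw [← sub_eq_zero, ← map_sub]
      refine (hn g (by omega)).1 _ (Y.isGrading.proj_mem g _) ?_
      refine (s.map_proj g _).trans ?_
      rw [map_sub, e, sub_self, map_zero]

/-- The truncations are compatible with a group action which does not change the underlying graded
vector spaces, up to shifts of degree `0`. -/
noncomputable def truncation {H : Type*} [Group H] (Φ : CatAction H (GradedModFP 𝒜))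
    (τ : ∀ g n X, (Φ.F g).obj ((trunc hA n).obj X) ≅ (trunc hA n).obj ((Φ.F g).obj X))
    (hτ : ∀ g n X, (τ g n X).hom ≫ (truncι hA n).app ((Φ.F g).obj X) =
      (Φ.F g).map ((truncι hA n).app X)) :
    Φ.Truncation (isoModFD 𝒜) where
  T := trunc hA
  ι := truncι hA
  mem := isoModFD_truncι hA
  mono n X := ⟨fun f g h => hom_ext (LinearMap.ext fun x => truncι_injective hA n X
    (DFunLike.congr_fun (congrArg Hom.toLinearMap h) x))⟩
  idem n X := (isoOfBijective ((truncι hA n).app ((trunc hA n).obj X))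
    ⟨truncι_injective hA n _, fun x => by
      refine ⟨⟨x, fun g hg => ?_⟩, rfl⟩
      apply truncι_injective hA n X
      refine (Hom.map_proj ((truncι hA n).app X) g x).trans ?_
      rw [map_zero]
      exact x.2 g hg⟩).isIso_hom
  le {n m} hnm X := ⟨Hom.mk (X := (trunc hA m).obj X) (Y := (trunc hA n).obj X)
    (Submodule.inclusion fun x hx g hg => hx g (by omega)) fun h => h, rfl⟩
  cofinal s hs := exists_trunc_lift hA s hs
  τ := τ
  τ_ι := hτ

end GradedModFP

end PositivelyGraded

/-! ### Restriction to Veronese subalgebras -/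

section Veronese

variable {k A B : Type u} [Field k] [CommRing A] [Algebra k A] [CommRing B] [Algebra k B]
  [Algebra B A]
  {G : Type w} [AddCommGroup G] {H : Type w'} [AddCommGroup H]

/-- If `A` is finite over `B`, and for each degree `g` the elements of degree in `g + φ(H)` generate
an ideal of finite codimension, then a finitely generated graded `A`-module is finite-dimensional
as soon as its components in degrees from `φ(H)` are. -/
theorem finiteDimensional_of_restriction [Module.Finite B A] {𝒜 : G → Submodule k A}
    {ℬ : H → Submodule k B} (φ : H →+ G)
    (hcofin : ∀ g, FiniteDimensional k
      (A ⧸ (Ideal.span (⋃ h, (𝒜 (g + φ h) : Set A))).restrictScalars k))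
    (hB : ∀ h, ∀ b ∈ ℬ h, algebraMap B A b ∈ 𝒜 (φ h)) (hB' : ⨆ h, ℬ h = ⊤)
    {M : Type*} [AddCommGroup M] [Module k M] [Module A M] [IsScalarTower k A M]
    [Module.Finite A M] (ℳ : G → Submodule k M)
    (hsmul : ∀ {g h : G} {a : A} {x : M}, a ∈ 𝒜 g → x ∈ ℳ h → a • x ∈ ℳ (g + h))
    (hM : ⨆ g, ℳ g = ⊤) (hfin : FiniteDimensional k ↥(⨆ h, ℳ (φ h))) :
    FiniteDimensional k M := by
  classical
  obtain ⟨S, hS, hS'⟩ := exists_homogeneous_generators (A := A) ℳ hM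
  choose! d hd using hS
  obtain ⟨T, hT⟩ := Module.Finite.fg_top (R := B) (M := A)
  -- The `A`-submodule generated by the restriction is spanned by finitely many translates of it.
  let P : Submodule k M := ⨆ t : T, (⨆ h, ℳ (φ h)).map (Algebra.lsmul k k M t.1)
  have hMB : ∀ b : B, ∀ x ∈ ⨆ h, ℳ (φ h), algebraMap B A b • x ∈ ⨆ h, ℳ (φ h) := by
    intro b x hx
    induction b using IsGrading.iSup_induction hB' with
    | zero => simp
    | hom h b hb =>
      induction hx using Submodule.iSup_induction' with
      | mem h' x hx =>
        refine Submodule.mem_iSup_of_mem (h + h') ?_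
        rw [map_add]
        exact hsmul (hB h b hb) hx
      | zero => simp
      | add x y _ _ hx hy => rw [smul_add]; exact add_mem hx hy
    | add b c hb hc => rw [map_add, add_smul]; exact add_mem hb hc
  have hP : ∀ a : A, ∀ x ∈ ⨆ h, ℳ (φ h), a • x ∈ P := by
    intro a x hx
    have ha : a ∈ Submodule.span B (T : Set A) := hT ▸ Submodule.mem_top
    induction ha using Submodule.closure_induction with
    | zero => simp
    | add a b _ _ ha hb => rw [add_smul]; exact add_mem ha hb
    | smul_mem b t ht =>
      refine Submodule.mem_iSup_of_mem ⟨t, ht⟩ ⟨algebraMap B A b • x, hMB b x hx, ?_⟩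
      change t • algebraMap B A b • x = (b • t) • x
      rw [smul_smul, Algebra.smul_def, mul_comm]
  have hQ (s : S) := finiteDimensional_quotient_iff.1 (hcofin (-d s))
  choose V hV hV' using hQ
  let U : Submodule k M := P ⊔ ⨆ s : S, (V s).map
    ((LinearMap.toSpanSingleton A M s.1).restrictScalars k)
  have hI (s : S) (a : A) (ha : a ∈ Ideal.span (⋃ h, (𝒜 (-d s + φ h) : Set A))) :
      a • s.1 ∈ P := by
    have : ∀ c : A, (c * a) • s.1 ∈ P := by
      induction ha using Submodule.span_induction with
      | mem a ha =>
        intro c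
        obtain ⟨h, ha⟩ := Set.mem_iUnion.1 ha
        rw [mul_smul]
        refine hP c _ (Submodule.mem_iSup_of_mem h ?_)
        have := hsmul ha (hd s.1 s.2)
        rwa [add_assoc, add_comm (φ h), neg_add_cancel_left] at this
      | zero => simp
      | add a b _ _ ha hb => intro c; rw [mul_add, add_smul]; exact add_mem (ha c) (hb c)
      | smul b a _ ha => intro c; rw [smul_eq_mul, ← mul_assoc]; exact ha _
    simpa using this 1
  have hU : U = ⊤ := by
    refine top_unique fun x _ => ?_
    have hx : x ∈ Submodule.span A (S : Set M) := hS' ▸ Submodule.mem_top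
    induction hx using Submodule.closure_induction with
    | zero => exact zero_mem _
    | add x y _ _ hx hy => exact add_mem (hx trivial) (hy trivial)
    | smul_mem a x hx =>
      obtain ⟨v, hv, b, hb, rfl⟩ := Submodule.mem_sup.1
        (hV' ⟨x, hx⟩ ▸ Submodule.mem_top : a ∈ V ⟨x, hx⟩ ⊔ _)
      rw [add_smul]
      refine add_mem (Submodule.mem_sup_right (Submodule.mem_iSup_of_mem ⟨x, hx⟩ ⟨v, hv, rfl⟩))
        (Submodule.mem_sup_left (hI ⟨x, hx⟩ b hb))
  have : FiniteDimensional k U := inferInstance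
  rw [hU] at this
  exact Module.finite_def.2 ((Submodule.fg_iff_finiteDimensional _).2 this)

/-- The graded algebra `B` is the restriction of the graded algebra `A` along the injective
homomorphism `φ` of grading groups, and is large in `A`: `A` is finite over `B`, and for each
degree `g` the elements of degree in `g + φ(H)` generate an ideal of finite codimension. -/
structure IsVeronese (𝒜 : G → Submodule k A) (ℬ : H → Submodule k B) (φ : H →+ G) : Prop where
  isGrading : IsGrading 𝒜
  isGrading' : IsGrading ℬ
  mul_mem : ∀ g g', ∀ a ∈ 𝒜 g, ∀ b ∈ 𝒜 g', a * b ∈ 𝒜 (g + g')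
  one_mem : (1 : A) ∈ 𝒜 0
  injective : Function.Injective φ
  algebraMap_injective : Function.Injective (algebraMap B A)
  algebraMap_mem : ∀ h, ∀ b ∈ ℬ h, algebraMap B A b ∈ 𝒜 (φ h)
  exists_algebraMap : ∀ h, ∀ a ∈ 𝒜 (φ h), ∃ b ∈ ℬ h, algebraMap B A b = a
  finite : Module.Finite B A
  cofinite : ∀ g, FiniteDimensional k
      (A ⧸ (Ideal.span (⋃ h, (𝒜 (g + φ h) : Set A))).restrictScalars k)

namespace GradedModFP

variable {𝒜 : G → Submodule k A} {ℬ : H → Submodule k B} {φ : H →+ G}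

/-- The part of a graded module in the degrees from `φ(H)`. -/
def restrSub (hV : IsVeronese 𝒜 ℬ φ) (X : GradedModFP 𝒜) :
    letI := Module.compHom X.carrier (algebraMap B A)
    Submodule B X.carrier :=
  letI := Module.compHom X.carrier (algebraMap B A)
  { carrier := {x | ∀ g, g ∉ Set.range φ → X.proj g x = 0}
    zero_mem' := by simp
    add_mem' := fun hx hy g hg => by rw [map_add, hx g hg, hy g hg, add_zero]
    smul_mem' := fun b x hx g hg => by
      change X.proj g (algebraMap B A b • x) = 0
      induction b using hV.isGrading'.induction with
      | zero => simp
      | hom h b hb =>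
        rw [X.proj_smul' (hV.algebraMap_mem h b hb), hx, smul_zero]
        rintro ⟨h', hh⟩
        exact hg ⟨h + h', by rw [map_add, hh]; abel⟩
      | add b c hb hc => rw [map_add, add_smul, map_add, hb, hc, add_zero] }

theorem mem_restrSub_of_mem (hV : IsVeronese 𝒜 ℬ φ) {X : GradedModFP 𝒜} {h : H} {x : X.carrier}
    (hx : x ∈ X.comp (φ h)) : x ∈ X.restrSub hV := by
  intro g hg
  refine X.isGrading.proj_ne hx ?_
  rintro rfl
  exact hg ⟨h, rfl⟩

variable [IsScalarTower k B A] [IsNoetherianRing B]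

/-- The restriction of a graded `A`-module to a graded `B`-module. -/
noncomputable abbrev restrObj (hV : IsVeronese 𝒜 ℬ φ) (X : GradedModFP 𝒜) : GradedModFP ℬ :=
  letI := Module.compHom X.carrier (algebraMap B A)
  haveI : IsScalarTower k B X.carrier := ⟨fun c b x => by
    change algebraMap B A (c • b) • x = c • algebraMap B A b • x
    rw [← smul_assoc]
    exact congrArg (· • x) (map_smul (IsScalarTower.toAlgHom k B A) c b)⟩
  { carrier := X.restrSub hV
    moduleBase := inferInstance
    module := inferInstance
    isScalarTower := inferInstance
    comp := fun h => (X.comp (φ h)).comap ((X.restrSub hV).subtype.restrictScalars k)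
    indep := by
      refine fun g => Submodule.disjoint_def.2 fun x hx hx' => ?_
      apply Subtype.ext
      refine Submodule.disjoint_def.1 (X.indep (φ g)) x.1 hx ?_
      have : ⨆ g', ⨆ _ : g' ≠ g,
          (X.comp (φ g')).comap ((X.restrSub hV).subtype.restrictScalars k) ≤
          (⨆ g', ⨆ _ : g' ≠ φ g, X.comp g').comap
            ((X.restrSub hV).subtype.restrictScalars k) :=
        iSup₂_le fun g' hg => Submodule.comap_mono
          (le_iSup₂_of_le (φ g') (hV.injective.ne hg) le_rfl)
      exact this hx'
    iSup_comp := by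
      refine top_unique fun x _ => ?_
      have hmem (g : G) : X.proj g x.1 ∈ X.restrSub hV := fun g' hg' => by
        by_cases hg : g = g'
        · rw [hg, X.isGrading.proj_proj_same, x.2 g' hg']
        · exact X.isGrading.proj_proj_ne hg x.1
      have : x = ∑ g ∈ (X.isGrading.finite_support x.1).toFinset,
          (⟨X.proj g x.1, hmem g⟩ : X.restrSub hV) := by
        apply Subtype.ext
        rw [AddSubmonoidClass.coe_finsetSum]
        exact (X.isGrading.sum_proj x.1).symm
      rw [this]
      refine Submodule.sum_mem _ fun g hg => ?_
      obtain ⟨h, rfl⟩ : g ∈ Set.range φ := by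
        by_contra hn
        exact (X.isGrading.finite_support x.1).mem_toFinset.1 hg (x.2 g hn)
      exact Submodule.mem_iSup_of_mem h (X.isGrading.proj_mem _ _)
    smul_mem := fun {g h b x} hb hx => by
      change algebraMap B A b • x.1 ∈ X.comp (φ (g + h))
      rw [map_add]
      exact X.smul_mem (hV.algebraMap_mem g b hb) hx
    finitePresentation := by
      have : IsScalarTower B A X.carrier := ⟨fun b a x => by
        rw [Algebra.smul_def, mul_smul]
        rfl⟩
      have := X.finite
      have := hV.finite
      have : Module.Finite B X.carrier := Module.Finite.trans A X.carrier
      have : IsNoetherian B X.carrier := isNoetherian_of_isNoetherianRing_of_finite B _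
      exact Module.finitePresentation_of_finite B _ }

/-- The restriction functor from graded `A`-modules to graded `B`-modules. -/
noncomputable def restr (hV : IsVeronese 𝒜 ℬ φ) : GradedModFP 𝒜 ⥤ GradedModFP ℬ where
  obj X := X.restrObj hV
  map {X Y} f := Hom.mk (X := X.restrObj hV) (Y := Y.restrObj hV)
    { toFun := fun x => ⟨Hom.toLinearMap (X := X) (Y := Y) f x.1, fun g hg => by
        rw [← Hom.map_proj, x.2 g hg, map_zero]⟩
      map_add' := fun x y => Subtype.ext (map_add _ x.1 y.1)
      map_smul' := fun b x => Subtype.ext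
        ((Hom.toLinearMap (X := X) (Y := Y) f).map_smul (algebraMap B A b) x.1) }
    fun h => Hom.map_mem (X := X) (Y := Y) f h

/-- The inclusion of the restriction of a graded module. -/
noncomputable def restrSubtype (hV : IsVeronese 𝒜 ℬ φ) (X : GradedModFP 𝒜) :
    ((restr hV).obj X).carrier →ₗ[k] X.carrier where
  toFun x := x.1
  map_add' _ _ := rfl
  map_smul' _ _ := rfl

theorem restrSubtype_injective (hV : IsVeronese 𝒜 ℬ φ) (X : GradedModFP 𝒜) :
    Function.Injective (restrSubtype hV X) := Subtype.val_injective

open Classical in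
/-- The projection of a graded module onto its restriction. -/
noncomputable def restrProj (hV : IsVeronese 𝒜 ℬ φ) (X : GradedModFP 𝒜) :
    X.carrier →ₗ[k] ((restr hV).obj X).carrier :=
  X.isGrading.lift fun g =>
    if hg : g ∈ Set.range φ then
      { toFun := fun x => ⟨X.proj g x, by
          obtain ⟨h, rfl⟩ := hg
          exact mem_restrSub_of_mem hV (X.isGrading.proj_mem _ _)⟩
        map_add' := fun x y => Subtype.ext (map_add _ x y)
        map_smul' := fun c x => Subtype.ext (map_smul _ c x) }
    else 0

theorem restrProj_of_mem (hV : IsVeronese 𝒜 ℬ φ) {X : GradedModFP 𝒜} {h : H} {x : X.carrier}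
    (hx : x ∈ X.comp (φ h)) : restrProj hV X x = ⟨x, mem_restrSub_of_mem hV hx⟩ := by
  rw [restrProj, X.isGrading.lift_apply _ hx, dif_pos ⟨h, rfl⟩]
  exact Subtype.ext (X.isGrading.proj_same hx)

theorem restrProj_of_mem_ne (hV : IsVeronese 𝒜 ℬ φ) {X : GradedModFP 𝒜} {g : G} {x : X.carrier}
    (hx : x ∈ X.comp g) (hg : g ∉ Set.range φ) : restrProj hV X x = 0 := by
  rw [restrProj, X.isGrading.lift_apply _ hx, dif_neg hg, LinearMap.zero_apply]

theorem restrProj_restrSubtype (hV : IsVeronese 𝒜 ℬ φ) {X : GradedModFP 𝒜}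
    (x : ((restr hV).obj X).carrier) : restrProj hV X (restrSubtype hV X x) = x := by
  induction x using ((restr hV).obj X).isGrading.induction with
  | zero => simp
  | hom h x hx => exact restrProj_of_mem hV hx
  | add x y hx hy => rw [map_add, map_add, hx, hy]

theorem restrProj_map (hV : IsVeronese 𝒜 ℬ φ) {X Y : GradedModFP 𝒜} (f : X ⟶ Y) (x : X.carrier) :
    restrProj hV Y (f.toLinearMap x) = ((restr hV).map f).toLinearMap (restrProj hV X x) := by
  induction x using X.isGrading.induction with
  | zero => simp
  | hom g x hx =>
    by_cases hg : g ∈ Set.range φ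
    · obtain ⟨h, rfl⟩ := hg
      rw [restrProj_of_mem hV hx, restrProj_of_mem hV (f.map_mem hx)]
      rfl
    · rw [restrProj_of_mem_ne hV hx hg, restrProj_of_mem_ne hV (f.map_mem hx) hg, map_zero]
  | add x y hx hy => simp only [map_add, hx, hy]

/-- Restriction is exact, hence preserves finite-dimensional kernels and cokernels. -/
theorem isoModFD_restr_map (hV : IsVeronese 𝒜 ℬ φ) {X Y : GradedModFP 𝒜} (f : X ⟶ Y)
    (hf : isoModFD 𝒜 f) : isoModFD ℬ ((restr hV).map f) := by
  obtain ⟨h1, h2⟩ := hf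
  refine ⟨finiteDimensional_of_map_of_inf (restrSubtype hV X) _ ?_ ?_, ?_⟩
  · refine Submodule.finiteDimensional_of_le (S₂ := LinearMap.ker (Hom.kLinearMap f)) ?_
    rintro _ ⟨x, hx, rfl⟩
    exact congrArg Subtype.val hx
  · rw [LinearMap.ker_eq_bot.2 (restrSubtype_injective hV X), inf_bot_eq]
    infer_instance
  · rw [finiteDimensional_quotient_iff] at *
    obtain ⟨V, hV1, hV2⟩ := h2
    refine ⟨V.map (restrProj hV Y), inferInstance, top_unique fun y _ => ?_⟩
    obtain ⟨v, hv, _, ⟨x, rfl⟩, e⟩ := Submodule.mem_sup.1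
      (hV2 ▸ Submodule.mem_top : restrSubtype hV Y y ∈ V ⊔ LinearMap.range (Hom.kLinearMap f))
    refine Submodule.mem_sup.2 ⟨_, ⟨v, hv, rfl⟩, _, ⟨restrProj hV X x, rfl⟩, ?_⟩
    rw [← restrProj_restrSubtype hV y, ← e, map_add]
    exact congrArg (_ + ·) (restrProj_map hV f x).symm

variable [IsNoetherianRing A]

/-- The kernel and the cokernel of a morphism are finite-dimensional as soon as their restrictions
are, by `finiteDimensional_of_restriction`. -/
theorem isoModFD_of_restr_map (hV : IsVeronese 𝒜 ℬ φ) {X Y : GradedModFP 𝒜} (f : X ⟶ Y)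
    (hf : isoModFD ℬ ((restr hV).map f)) : isoModFD 𝒜 f := by
  have := X.finite
  have := Y.finite
  have := hV.finite
  have : IsNoetherian A X.carrier := isNoetherian_of_isNoetherianRing_of_finite A _
  obtain ⟨h1, h2⟩ := hf
  constructor
  · let K := LinearMap.ker f.toLinearMap
    have hK (x : X.carrier) (hx : x ∈ K) (g : G) : X.proj g x ∈ K := by
      change f.toLinearMap (X.proj g x) = 0
      rw [f.map_proj, LinearMap.mem_ker.1 hx, map_zero]
    let Z := X.subObj K hK
    change FiniteDimensional k K
    refine finiteDimensional_of_restriction (M := Z.carrier) φ hV.cofinite hV.algebraMap_mem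
      hV.isGrading'.iSup_eq Z.comp Z.smul_mem Z.iSup_comp ?_
    let e : ↥(LinearMap.ker (Hom.kLinearMap ((restr hV).map f))) →ₗ[k] Z.carrier :=
      { toFun := fun x => ⟨x.1.1, congrArg Subtype.val x.2⟩
        map_add' := fun _ _ => rfl
        map_smul' := fun _ _ => rfl }
    refine Submodule.finiteDimensional_of_le (S₂ := LinearMap.range e) (iSup_le fun h x hx => ?_)
    exact ⟨⟨⟨x.1, mem_restrSub_of_mem hV hx⟩, Subtype.ext x.2⟩, rfl⟩
  · let R := LinearMap.range f.toLinearMap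
    change FiniteDimensional k (Y.carrier ⧸ R)
    refine finiteDimensional_of_restriction φ hV.cofinite hV.algebraMap_mem
      hV.isGrading'.iSup_eq (fun g => (Y.comp g).map (R.mkQ.restrictScalars k)) ?_ ?_ ?_
    · rintro g h a _ ha ⟨x, hx, rfl⟩
      exact ⟨a • x, Y.smul_mem ha hx, rfl⟩
    · rw [← Submodule.map_iSup, Y.iSup_comp, Submodule.map_top]
      exact LinearMap.range_eq_top.2 R.mkQ_surjective
    · obtain ⟨V, hV1, hV2⟩ := finiteDimensional_quotient_iff.1 h2
      refine Submodule.finiteDimensional_of_le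
        (S₂ := V.map ((R.mkQ.restrictScalars k).comp (restrSubtype hV Y)))
        (iSup_le fun h => ?_)
      rintro _ ⟨y, hy, rfl⟩
      obtain ⟨v, hv, _, ⟨x, rfl⟩, e⟩ := Submodule.mem_sup.1 (hV2 ▸ Submodule.mem_top :
        restrProj hV Y y ∈
          V ⊔ LinearMap.range (Hom.kLinearMap ((restr hV).map f)))
      refine ⟨v, hv, ?_⟩
      refine (Submodule.Quotient.eq R).2 ⟨-x.1, ?_⟩
      have e' : v.1 + f.toLinearMap x.1 = y :=
        congrArg Subtype.val (e.trans (restrProj_of_mem hV hy))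
      rw [map_neg]
      change _ = v.1 - y
      rw [← e']
      abel

/-! ### Induction from Veronese subalgebras -/

/-- The component of degree `g` of the tensor `a ⊗ n` of a graded algebra and a graded module,
as a bilinear map. -/
noncomputable def indProjAux (hV : IsVeronese 𝒜 ℬ φ) (N : GradedModFP ℬ) (g : G) :
    N.carrier →ₗ[k] A →ₗ[k] A ⊗[B] N.carrier :=
  N.isGrading.lift (N := A →ₗ[k] A ⊗[B] N.carrier) fun h => LinearMap.mk₂ k
    (fun (n : N.carrier) (a : A) => hV.isGrading.proj (g - φ h) a ⊗ₜ[B] n)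
    (fun n n' a => TensorProduct.tmul_add _ _ _)
    (fun c n a => by rw [TensorProduct.tmul_smul])
    (fun n a a' => by rw [map_add, TensorProduct.add_tmul])
    (fun c n a => by rw [map_smul, TensorProduct.smul_tmul'])

theorem indProjAux_of_mem (hV : IsVeronese 𝒜 ℬ φ) (N : GradedModFP ℬ) (g : G) {h : H}
    {n : N.carrier} (hn : n ∈ N.comp h) (a : A) :
    indProjAux hV N g n a = hV.isGrading.proj (g - φ h) a ⊗ₜ[B] n := by
  rw [indProjAux, N.isGrading.lift_apply _ hn]
  rfl

theorem proj_algebraMap_mul (hV : IsVeronese 𝒜 ℬ φ) {h : H} {b : B} (hb : b ∈ ℬ h) (g : G)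
    (a : A) : hV.isGrading.proj g (algebraMap B A b * a) =
      algebraMap B A b * hV.isGrading.proj (g - φ h) a := by
  have := hV.isGrading.map_proj_of_injective hV.isGrading
    (LinearMap.mulLeft k (algebraMap B A b)) (add_right_injective (φ h))
    (fun g' x hx => hV.mul_mem _ _ _ (hV.algebraMap_mem h b hb) _ hx) (g - φ h) a
  rw [add_sub_cancel] at this
  exact this.symm

/-- The projection onto the component of degree `g` of the tensor product `A ⊗[B] N`. -/
noncomputable def indProj (hV : IsVeronese 𝒜 ℬ φ) (N : GradedModFP ℬ) (g : G) :
    A ⊗[B] N.carrier →ₗ[k] A ⊗[B] N.carrier :=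
  let P : A ⊗[B] N.carrier →+ A ⊗[B] N.carrier :=
    TensorProduct.liftAddHom
      { toFun := fun a => ((indProjAux hV N g).flip a).toAddMonoidHom
        map_zero' := by ext; simp
        map_add' := fun _ _ => by ext; simp }
      (fun b a n => by
        change indProjAux hV N g n (b • a) = indProjAux hV N g (b • n) a
        induction n using N.isGrading.induction with
        | zero => simp
        | hom h n hn =>
          induction b using hV.isGrading'.induction with
          | zero => simp
          | hom h' b hb =>
            rw [indProjAux_of_mem hV N g hn, indProjAux_of_mem hV N g (N.smul_mem hb hn),
              Algebra.smul_def, proj_algebraMap_mul hV hb, ← Algebra.smul_def,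
              TensorProduct.smul_tmul, map_add, sub_sub, add_comm (φ h)]
          | add b c hb hc => simp only [add_smul, map_add, hb, hc, LinearMap.add_apply]
        | add n m hn hm => simp only [smul_add, map_add, hn, hm, LinearMap.add_apply])
  { toFun := P
    map_add' := P.map_add
    map_smul' := fun c t => by
      induction t with
      | zero => simp
      | tmul a n =>
        rw [TensorProduct.smul_tmul']
        change indProjAux hV N g n (c • a) = c • indProjAux hV N g n a
        rw [map_smul]
      | add x y hx hy => simp only [smul_add, map_add, hx, hy] }

theorem indProj_tmul (hV : IsVeronese 𝒜 ℬ φ) (N : GradedModFP ℬ) (g : G) {h : H}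
    {n : N.carrier} (hn : n ∈ N.comp h) (a : A) :
    indProj hV N g (a ⊗ₜ n) = hV.isGrading.proj (g - φ h) a ⊗ₜ[B] n :=
  indProjAux_of_mem hV N g hn a

/-- The component of degree `g` of the tensor product `A ⊗[B] N`. -/
def indComp (𝒜 : G → Submodule k A) (φ : H →+ G) (N : GradedModFP ℬ) (g : G) :
    Submodule k (A ⊗[B] N.carrier) :=
  Submodule.span k {t | ∃ d h, d + φ h = g ∧ ∃ a ∈ 𝒜 d, ∃ n ∈ N.comp h, a ⊗ₜ[B] n = t}

theorem isGrading_indComp (hV : IsVeronese 𝒜 ℬ φ) (N : GradedModFP ℬ) :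
    IsGrading (indComp 𝒜 φ N) := by
  refine IsGrading.of_proj (indProj hV N) (fun g x hx => ?_) (fun g g' hg x hx => ?_) ?_
  · induction hx using Submodule.span_induction with
    | mem x hx =>
      obtain ⟨d, h, e, a, ha, n, hn, rfl⟩ := hx
      rw [indProj_tmul hV N g hn, hV.isGrading.proj_same (by rwa [← e, add_sub_cancel_right])]
    | zero => simp
    | add x y _ _ hx hy => rw [map_add, hx, hy]
    | smul c x _ hx => rw [map_smul, hx]
  · induction hx using Submodule.span_induction with
    | mem x hx =>
      obtain ⟨d, h, e, a, ha, n, hn, rfl⟩ := hx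
      rw [indProj_tmul hV N g' hn, hV.isGrading.proj_ne ha, TensorProduct.zero_tmul]
      rintro rfl
      exact hg (by rw [← e, sub_add_cancel])
    | zero => simp
    | add x y _ _ hx hy => rw [map_add, hx, hy, add_zero]
    | smul c x _ hx => rw [map_smul, hx, smul_zero]
  · refine top_unique fun t ht => ?_
    clear ht
    induction t with
    | zero => exact zero_mem _
    | tmul a n =>
      induction n using N.isGrading.induction with
      | zero => simp
      | hom h n hn =>
        induction a using hV.isGrading.induction with
        | zero => simp
        | hom d a ha =>
          exact Submodule.mem_iSup_of_mem (d + φ h)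
            (Submodule.subset_span ⟨d, h, rfl, a, ha, n, hn, rfl⟩)
        | add a b ha hb => rw [TensorProduct.add_tmul]; exact add_mem ha hb
      | add n m hn hm => rw [TensorProduct.tmul_add]; exact add_mem hn hm
    | add x y hx hy => exact add_mem hx hy

/-- The graded module `A ⊗[B] N`. -/
noncomputable abbrev indObj (hV : IsVeronese 𝒜 ℬ φ) (N : GradedModFP ℬ) : GradedModFP 𝒜 where
  carrier := A ⊗[B] N.carrier
  comp := indComp 𝒜 φ N
  indep := (isGrading_indComp hV N).indep
  iSup_comp := (isGrading_indComp hV N).iSup_eq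
  smul_mem {g g' c x} hc hx := by
    induction hx using Submodule.span_induction with
    | mem x hx =>
      obtain ⟨d, h, e, a, ha, n, hn, rfl⟩ := hx
      rw [TensorProduct.smul_tmul', ← e, ← add_assoc]
      exact Submodule.subset_span ⟨g + d, h, rfl, c * a, hV.mul_mem _ _ _ hc _ ha, n, hn, rfl⟩
    | zero => simp
    | add x y _ _ hx hy => rw [smul_add]; exact add_mem hx hy
    | smul r x _ hx => rw [smul_comm]; exact Submodule.smul_mem _ _ hx
  finitePresentation := by
    have := N.finite
    exact Module.finitePresentation_of_finite A _

/-- The unit `N → (A ⊗[B] N)_H` of the adjunction between induction and restriction. -/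
noncomputable def indUnit (hV : IsVeronese 𝒜 ℬ φ) (N : GradedModFP ℬ) :
    N ⟶ (restr hV).obj (indObj hV N) :=
  have hmem {h : H} {n : N.carrier} (hn : n ∈ N.comp h) :
      (1 : A) ⊗ₜ[B] n ∈ (indObj hV N).comp (φ h) :=
    Submodule.subset_span ⟨0, h, zero_add _, 1, hV.one_mem, n, hn, rfl⟩
  Hom.mk (Y := (indObj hV N).restrObj hV)
    { toFun := fun n => ⟨(1 : A) ⊗ₜ[B] n, by
        induction n using N.isGrading.induction with
        | zero => rw [TensorProduct.tmul_zero]; exact zero_mem _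
        | hom h n hn => exact mem_restrSub_of_mem hV (X := indObj hV N) (hmem hn)
        | add x y hx hy => rw [TensorProduct.tmul_add]; exact add_mem hx hy⟩
      map_add' := fun _ _ => Subtype.ext (TensorProduct.tmul_add _ _ _)
      map_smul' := fun b n => Subtype.ext (by
        change (1 : A) ⊗ₜ[B] (b • n) = algebraMap B A b • ((1 : A) ⊗ₜ[B] n)
        rw [TensorProduct.smul_tmul', ← TensorProduct.smul_tmul, Algebra.smul_def, smul_eq_mul]) }
    fun hn => hmem hn

end GradedModFP

end Veronese

/-! ### The equivalence for a large Veronese subalgebra -/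

section Veronese

variable {k A B : Type u} [Field k] [CommRing A] [Algebra k A] [CommRing B] [Algebra k B]
  [Algebra B A] {G : Type w} [AddCommGroup G] {H : Type w'} [AddCommGroup H]
  {𝒜 : G → Submodule k A} {ℬ : H → Submodule k B} {φ : H →+ G}

open Classical in
/-- A Veronese subalgebra `B` is a direct summand of `A` as a `B`-module. -/
theorem IsVeronese.exists_retraction (hV : IsVeronese 𝒜 ℬ φ) :
    ∃ r : A →ₗ[B] B, ∀ b, r (algebraMap B A b) = b := by
  let p : A →ₗ[k] A := hV.isGrading.lift fun g => if g ∈ Set.range φ then LinearMap.id else 0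
  have hp {h : H} {a : A} (ha : a ∈ 𝒜 (φ h)) : p a = a := by
    change hV.isGrading.lift _ a = a
    rw [hV.isGrading.lift_apply _ ha, if_pos ⟨h, rfl⟩]
    rfl
  have hp' {g : G} {a : A} (ha : a ∈ 𝒜 g) (hg : g ∉ Set.range φ) : p a = 0 := by
    change hV.isGrading.lift _ a = 0
    rw [hV.isGrading.lift_apply _ ha, if_neg hg]
    rfl
  have hr (a : A) : ∃ b, algebraMap B A b = p a := by
    induction a using hV.isGrading.induction with
    | zero => exact ⟨0, by simp⟩
    | hom g a ha =>
      by_cases hg : g ∈ Set.range φ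
      · obtain ⟨h, rfl⟩ := hg
        obtain ⟨b, -, hb⟩ := hV.exists_algebraMap h a ha
        exact ⟨b, by rw [hp ha, hb]⟩
      · exact ⟨0, by rw [hp' ha hg, map_zero]⟩
    | add a b ha hb =>
      obtain ⟨x, hx⟩ := ha
      obtain ⟨y, hy⟩ := hb
      exact ⟨x + y, by rw [map_add, map_add, hx, hy]⟩
  choose r hr using hr
  have hmul (b : B) (a : A) : p (b • a) = b • p a := by
    induction a using hV.isGrading.induction with
    | zero => simp
    | hom g a ha =>
      induction b using hV.isGrading'.induction with
      | zero => simp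
      | hom h b hb =>
        have hba : b • a ∈ 𝒜 (φ h + g) := by
          rw [Algebra.smul_def]
          exact hV.mul_mem _ _ _ (hV.algebraMap_mem h b hb) _ ha
        by_cases hg : g ∈ Set.range φ
        · obtain ⟨h', rfl⟩ := hg
          rw [← map_add] at hba
          rw [hp ha, hp hba]
        · rw [hp' ha hg, hp' hba, smul_zero]
          rintro ⟨h', e⟩
          exact hg ⟨h' - h, by rw [map_sub, e, add_sub_cancel_left]⟩
      | add b c hb hc => simp only [add_smul, map_add, hb, hc]
    | add a c ha hc => simp only [smul_add, map_add, ha, hc]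
  have hpB (b : B) : p (algebraMap B A b) = algebraMap B A b := by
    induction b using hV.isGrading'.induction with
    | zero => simp
    | hom h b hb => exact hp (hV.algebraMap_mem h b hb)
    | add b c hb hc => simp only [map_add, hb, hc]
  refine ⟨{ toFun := r, map_add' := fun a c => ?_, map_smul' := fun b a => ?_ }, fun b => ?_⟩
  · exact hV.algebraMap_injective (by rw [hr, map_add, map_add, hr, hr])
  · exact hV.algebraMap_injective (by
      rw [hr, hmul, RingHom.id_apply, smul_eq_mul, map_mul, hr, Algebra.smul_def])
  · exact hV.algebraMap_injective (by
      change algebraMap B A (r _) = _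
      rw [hr, hpB])

namespace GradedModFP

variable [IsScalarTower k B A] [IsNoetherianRing B] [IsNoetherianRing A]

/-- The component of `A ⊗[B] N` in a degree from `φ(H)` consists of the tensors `1 ⊗ n`; they are
nonzero for `n ≠ 0` as `B` is a direct summand of `A`. -/
theorem indUnit_bijective (hV : IsVeronese 𝒜 ℬ φ) (N : GradedModFP ℬ) :
    Function.Bijective (indUnit hV N).toLinearMap := by
  constructor
  · obtain ⟨r, hr⟩ := hV.exists_retraction
    intro n m h
    have h' : (1 : A) ⊗ₜ[B] n = (1 : A) ⊗ₜ[B] m := congrArg Subtype.val h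
    have h1 : r 1 = 1 := by rw [← map_one (algebraMap B A), hr]
    have := congrArg (fun t => TensorProduct.lid B N.carrier (r.rTensor N.carrier t)) h'
    simpa [h1] using this
  · intro t
    let j : N.carrier →ₗ[k] A ⊗[B] N.carrier :=
      { toFun := fun n => 1 ⊗ₜ[B] n
        map_add' := fun _ _ => TensorProduct.tmul_add _ _ _
        map_smul' := fun _ _ => by rw [TensorProduct.tmul_smul]; rfl }
    have key : t.1 ∈ LinearMap.range j := by
      refine (indObj hV N).isGrading.mem_of_proj_mem fun g => ?_
      by_cases hg : g ∈ Set.range φ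
      · obtain ⟨h, rfl⟩ := hg
        have ht : (indObj hV N).proj (φ h) t.1 ∈ indComp 𝒜 φ N (φ h) :=
          (indObj hV N).isGrading.proj_mem (φ h) t.1
        have hle : indComp 𝒜 φ N (φ h) ≤ LinearMap.range j := by
          refine Submodule.span_le.2 ?_
          rintro _ ⟨d, h', e, a, ha, n, hn, rfl⟩
          rw [show d = φ (h - h') by rw [map_sub, ← e, add_sub_cancel_right]] at ha
          obtain ⟨b, -, rfl⟩ := hV.exists_algebraMap _ a ha
          refine ⟨b • n, ?_⟩
          change (1 : A) ⊗ₜ[B] (b • n) = algebraMap B A b ⊗ₜ[B] n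
          rw [← TensorProduct.smul_tmul, Algebra.smul_def, mul_one]
        exact hle ht
      · have : (indObj hV N).proj g t.1 = 0 := t.2 g hg
        rw [this]
        exact zero_mem _
    obtain ⟨n, hn⟩ := key
    exact ⟨n, Subtype.ext hn⟩

/-- A morphism to a restriction extends uniquely to the induced module. -/
theorem existsUnique_indObj_hom (hV : IsVeronese 𝒜 ℬ φ) (N : GradedModFP ℬ) (M : GradedModFP 𝒜)
    (f : N ⟶ (restr hV).obj M) :
    ∃! f' : indObj hV N ⟶ M, indUnit hV N ≫ (restr hV).map f' = f := by
  let := Module.compHom M.carrier (algebraMap B A)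
  have : IsScalarTower B A M.carrier := ⟨fun b a x => by
    rw [Algebra.smul_def, mul_smul]
    rfl⟩
  let l : N.carrier →ₗ[B] M.carrier := (M.restrSub hV).subtype ∘ₗ f.toLinearMap
  refine ⟨Hom.mk (X := indObj hV N) (l.liftBaseChange A) fun {g x} hx => ?_, ?_, fun f' hf' => ?_⟩
  · induction hx using Submodule.span_induction with
    | mem x hx =>
      obtain ⟨d, h, e, a, ha, n, hn, rfl⟩ := hx
      rw [LinearMap.liftBaseChange_tmul, ← e]
      exact M.smul_mem ha (f.map_mem hn)
    | zero => rw [map_zero]; exact zero_mem _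
    | add x y _ _ hx hy => rw [map_add]; exact add_mem hx hy
    | smul c x _ hx =>
      rw [← algebraMap_smul A c x, map_smul, algebraMap_smul]
      exact Submodule.smul_mem _ _ hx
  · refine hom_ext (LinearMap.ext fun n => Subtype.ext ?_)
    change l.liftBaseChange A (1 ⊗ₜ[B] n) = (f.toLinearMap n).1
    rw [LinearMap.liftBaseChange_tmul, one_smul]
    rfl
  · refine hom_ext (LinearMap.ext fun t => ?_)
    induction t using TensorProduct.induction_on with
    | zero => simp
    | tmul a n =>
      change _ = l.liftBaseChange A (a ⊗ₜ[B] n)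
      rw [LinearMap.liftBaseChange_tmul]
      have h1 : f'.toLinearMap ((1 : A) ⊗ₜ[B] n) = (f.toLinearMap n).1 :=
        congrArg Subtype.val (DFunLike.congr_fun (congrArg Hom.toLinearMap hf') n)
      have h2 : a ⊗ₜ[B] n = a • ((1 : A) ⊗ₜ[B] n) := by
        rw [TensorProduct.smul_tmul', smul_eq_mul, mul_one]
      rw [h2, map_smul, h1]
      rfl
    | add x y hx hy => simp only [map_add, hx, hy]

end GradedModFP

open GradedModFP in
/-- Restriction to a large Veronese subalgebra is an equivalence on the categories `qmod`: it has
the induction functor as a left adjoint whose unit is an isomorphism, and it reflects the morphisms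
with finite-dimensional kernel and cokernel. -/
theorem IsVeronese.nonempty_qmod_equivalence [IsScalarTower k B A] [IsNoetherianRing B]
    [IsNoetherianRing A] (hV : IsVeronese 𝒜 ℬ φ) {δ : G →+ ℤ} (hA : PositivelyGraded 𝒜 δ)
    {δ' : H →+ ℤ} (hB : PositivelyGraded ℬ δ') : Nonempty (QMod 𝒜 ≌ QMod ℬ) := by
  have := hasRightCalculusOfFractions hA
  have := hasRightCalculusOfFractions hB
  exact nonempty_localization_equivalence_localization (isoModFD 𝒜) (isoModFD ℬ) (restr hV)
    (fun X Y f => ⟨isoModFD_restr_map hV f, isoModFD_of_restr_map hV f⟩) isoModFD_cancel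
    fun N => ⟨indObj hV N, indUnit hV N, isoModFD_of_bijective _ (indUnit_bijective hV N),
      existsUnique_indObj_hom hV N⟩

end Veronese

/-! ### Coarsening and unfolding of gradings -/

section Coarsen

variable {k A : Type*} {M N : Type*} {G G' : Type*} [Field k] [AddCommGroup M] [Module k M]
  [AddCommGroup N] [Module k N]

namespace IsGrading

variable {ℳ : G → Submodule k M} (h : IsGrading ℳ)

open Classical in
/-- The coarsening of a grading along a map of the index sets is a grading. -/
theorem coarsen {ℳ : G → Submodule k M} (h : IsGrading ℳ) (q : G → G') :
    IsGrading fun g' => ⨆ g, ⨆ _ : q g = g', ℳ g := by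
  have key (g' : G') (x : M) (hx : x ∈ ⨆ g, ⨆ _ : q g = g', ℳ g) (g'' : G') :
      h.lift (fun g => if q g = g'' then LinearMap.id else 0) x = if g' = g'' then x else 0 := by
    induction hx using Submodule.iSup_induction' with
    | mem g x hx =>
      rcases eq_or_ne (q g) g' with hg | hg
      · rw [iSup_pos hg] at hx
        rw [h.lift_apply _ hx, hg]
        split_ifs <;> rfl
      · rw [iSup_neg hg, Submodule.mem_bot] at hx
        simp [hx]
    | zero => simp
    | add x y _ _ hx hy =>
      rw [map_add, hx, hy]
      split_ifs <;> simp
  refine of_proj (fun g'' => h.lift (fun g => if q g = g'' then LinearMap.id else 0))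
    (fun g' x hx => ?_) (fun g' g'' hg x hx => ?_) (top_unique ?_)
  · rw [key g' x hx, if_pos rfl]
  · rw [key g' x hx, if_neg hg]
  · rw [← h.iSup_eq]
    exact iSup_le fun g => le_iSup_of_le (q g) (le_iSup₂_of_le g rfl le_rfl)

theorem mem_coarsen {ℳ : G → Submodule k M} (q : G → G') {g : G} {x : M} (hx : x ∈ ℳ g) :
    x ∈ ⨆ g₁, ⨆ _ : q g₁ = q g, ℳ g₁ :=
  Submodule.mem_iSup_of_mem g (Submodule.mem_iSup_of_mem rfl hx)

/-- The image of a grading under a surjective map with homogeneous kernel is a grading. -/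
theorem map_of_surjective {ℳ : G → Submodule k M} (h : IsGrading ℳ) (π : M →ₗ[k] N)
    (hπ : Function.Surjective π) (hker : ∀ g x, π x = 0 → π (h.proj g x) = 0) :
    IsGrading fun g => (ℳ g).map π := by
  refine ⟨fun g => Submodule.disjoint_def.2 fun x hx hx' => ?_, ?_⟩
  · simp only [← Submodule.map_iSup] at hx'
    obtain ⟨a, ha, rfl⟩ := hx
    obtain ⟨b, hb, e⟩ := hx'
    have h0 := hker g (a - b) (by rw [map_sub, e, sub_self])
    rwa [map_sub, h.proj_same ha, h.mem_biSup_iff.1 hb g (by simp), sub_zero] at h0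
  · rw [← Submodule.map_iSup, h.iSup_eq, Submodule.map_top, LinearMap.range_eq_top.2 hπ]

/-- A linear map which is compatible with the action of homogeneous elements of `A` on homogeneous
elements is `A`-linear. -/
def linearMapOfHomogeneous [CommRing A] [Algebra k A] [Module A M] [Module A N]
    {𝒜 : G' → Submodule k A} (hA : IsGrading 𝒜) {ℳ : G → Submodule k M} (h : IsGrading ℳ)
    (F : M →ₗ[k] N)
    (hF : ∀ d, ∀ a ∈ 𝒜 d, ∀ g, ∀ x ∈ ℳ g, F (a • x) = a • F x) : M →ₗ[A] N where
  toFun := F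
  map_add' := map_add F
  map_smul' a x := by
    change F (a • x) = a • F x
    induction a using hA.induction with
    | zero => simp
    | hom d a ha =>
      induction x using h.induction with
      | zero => simp
      | hom g x hx => exact hF d a ha g x hx
      | add x y hx hy => simp only [smul_add, map_add, hx, hy]
    | add a b ha hb => simp only [add_smul, map_add, ha, hb]

end IsGrading

end Coarsen

section IsCoarsening

variable {k A : Type*} [Field k] [CommRing A] [Algebra k A] {G : Type*} [AddCommGroup G]
  {G' : Type*} [AddCommGroup G']

/-- A `G`-graded algebra, with the grading by `G'` which is the coarsening along a surjective
homomorphism `q : G → G'`. -/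
structure IsCoarsening (𝒜 : G → Submodule k A) (𝒜' : G' → Submodule k A) (q : G →+ G') :
    Prop where
  isGrading : IsGrading 𝒜
  mul_mem : ∀ g g', ∀ a ∈ 𝒜 g, ∀ b ∈ 𝒜 g', a * b ∈ 𝒜 (g + g')
  one_mem : (1 : A) ∈ 𝒜 0
  surjective : Function.Surjective q
  eq_iSup : ∀ g', 𝒜' g' = ⨆ g, ⨆ _ : q g = g', 𝒜 g

theorem IsCoarsening.mem {𝒜 : G → Submodule k A} {𝒜' : G' → Submodule k A} {q : G →+ G'}
    (hq : IsCoarsening 𝒜 𝒜' q) {g : G} {a : A} (ha : a ∈ 𝒜 g) : a ∈ 𝒜' (q g) := by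
  rw [hq.eq_iSup]
  exact IsGrading.mem_coarsen q ha

theorem IsCoarsening.isGrading' {𝒜 : G → Submodule k A} {𝒜' : G' → Submodule k A} {q : G →+ G'}
    (hq : IsCoarsening 𝒜 𝒜' q) : IsGrading 𝒜' := by
  rw [funext hq.eq_iSup]
  exact hq.isGrading.coarsen q

theorem IsCoarsening.mul_mem' {𝒜 : G → Submodule k A} {𝒜' : G' → Submodule k A} {q : G →+ G'}
    (hq : IsCoarsening 𝒜 𝒜' q) (g g' : G') (a : A) (ha : a ∈ 𝒜' g) (b : A) (hb : b ∈ 𝒜' g') :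
    a * b ∈ 𝒜' (g + g') := by
  rw [hq.eq_iSup] at ha
  induction ha using Submodule.iSup_induction' with
  | mem h a ha =>
    rcases eq_or_ne (q h) g with rfl | hh
    · rw [iSup_pos rfl] at ha
      rw [hq.eq_iSup] at hb
      induction hb using Submodule.iSup_induction' with
      | mem h' b hb =>
        rcases eq_or_ne (q h') g' with rfl | hh'
        · rw [iSup_pos rfl] at hb
          rw [← map_add]
          exact hq.mem (hq.mul_mem _ _ a ha b hb)
        · rw [iSup_neg hh', Submodule.mem_bot] at hb
          rw [hb, mul_zero]
          exact zero_mem _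
      | zero => rw [mul_zero]; exact zero_mem _
      | add b c _ _ hb hc => rw [mul_add]; exact add_mem hb hc
    · rw [iSup_neg hh, Submodule.mem_bot] at ha
      rw [ha, zero_mul]
      exact zero_mem _
  | zero => rw [zero_mul]; exact zero_mem _
  | add a c _ _ ha hc => rw [add_mul]; exact add_mem ha hc

end IsCoarsening

section Unfold

variable {k A : Type u} [Field k] [CommRing A] [Algebra k A] {G : Type} [AddCommGroup G]
  {G' : Type w'} [AddCommGroup G']

namespace GradedModFP

variable {𝒜 : G → Submodule k A} {𝒜' : G' → Submodule k A} {q : G →+ G'}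

open DirectSum

/-- The space underlying the `G`-graded module with components `N_{q(x)}`. -/
abbrev Unfold (q : G →+ G') (N : GradedModFP 𝒜') := ⨁ x : G, N.comp (q x)

open Classical in
/-- The `A`-module structure on `⨁ x, N_{q(x)}`. -/
noncomputable abbrev unfoldModule (hq : IsCoarsening 𝒜 𝒜' q) (N : GradedModFP 𝒜') :
    Module A (Unfold q N) :=
  letI := (DirectSum.isInternal_submodule_of_iSupIndep_of_iSup_eq_top
    hq.isGrading.indep hq.isGrading.iSup_eq).chooseDecomposition
  letI : GradedRing 𝒜 :=
    { one_mem := hq.one_mem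
      mul_mem := fun {g g' a b} ha hb => hq.mul_mem g g' a ha b hb }
  letI : SetLike.GradedSMul 𝒜 fun x : G => N.comp (q x) :=
    ⟨fun {g g' a n} ha hn => by
      rw [vadd_eq_add, map_add]
      exact N.smul_mem (hq.mem ha) hn⟩
  GradedModule.isModule 𝒜 fun x : G => N.comp (q x)

open Classical in
/-- The copy of `N_{q(x)}` in `⨁ x, N_{q(x)}` in degree `x`, preceded by the projection of `N` onto
`N_{q(x)}`. -/
noncomputable def unfoldIn (q : G →+ G') (N : GradedModFP 𝒜') (x : G) :
    N.carrier →ₗ[k] Unfold q N :=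
  DirectSum.lof k G (fun x => N.comp (q x)) x ∘ₗ
    (N.proj (q x)).codRestrict (N.comp (q x)) (N.isGrading.proj_mem _)

open Classical in
/-- The linear map on `⨁ x, N_{q(x)}` with given restrictions to the summands. -/
noncomputable def unfoldDesc {P : Type*} [AddCommGroup P] [Module k P] (q : G →+ G')
    (N : GradedModFP 𝒜') (f : G → N.carrier →ₗ[k] P) : Unfold q N →ₗ[k] P :=
  DirectSum.toModule k G P fun x => f x ∘ₗ (N.comp (q x)).subtype

variable (q) in
theorem unfoldDesc_unfoldIn {P : Type*} [AddCommGroup P] [Module k P] {N : GradedModFP 𝒜'}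
    (f : G → N.carrier →ₗ[k] P) (x : G) (n : N.carrier) :
    unfoldDesc q N f (unfoldIn q N x n) = f x (N.proj (q x) n) := by
  classical
  unfold unfoldDesc unfoldIn
  rw [LinearMap.comp_apply, toModule_lof]
  rfl

theorem unfoldIn_proj {N : GradedModFP 𝒜'} (x : G) (n : N.carrier) :
    unfoldIn q N x (N.proj (q x) n) = unfoldIn q N x n := by
  unfold unfoldIn
  rw [LinearMap.comp_apply, LinearMap.comp_apply]
  exact congrArg _ (Subtype.ext (N.isGrading.proj_proj_same _ _))

theorem unfoldIn_ne {N : GradedModFP 𝒜'} {x : G} {g : G'} {n : N.carrier} (hn : n ∈ N.comp g)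
    (hg : g ≠ q x) : unfoldIn q N x n = 0 := by
  rw [← unfoldIn_proj, N.isGrading.proj_ne hn hg, map_zero]

theorem isGrading_unfold (N : GradedModFP 𝒜') :
    IsGrading fun x : G => LinearMap.range (unfoldIn q N x) := by
  classical
  refine IsGrading.of_proj (fun x => unfoldDesc q N fun y => if x = y then unfoldIn q N x else 0)
    ?_ ?_ ?_
  · rintro x _ ⟨n, rfl⟩
    rw [unfoldDesc_unfoldIn, if_pos rfl, unfoldIn_proj]
  · rintro x y hxy _ ⟨n, rfl⟩
    rw [unfoldDesc_unfoldIn, if_neg hxy.symm, LinearMap.zero_apply]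
  · refine top_unique fun m hm => ?_
    clear hm
    induction m using DirectSum.induction_on with
    | zero => exact zero_mem _
    | of x n =>
      refine Submodule.mem_iSup_of_mem x ⟨n.1, ?_⟩
      unfold unfoldIn
      rw [LinearMap.comp_apply]
      exact congrArg _ (Subtype.ext (N.isGrading.proj_same n.2))
    | add x y hx hy => exact add_mem hx hy

theorem smul_unfoldIn (hq : IsCoarsening 𝒜 𝒜' q) {N : GradedModFP 𝒜'} {d : G} {a : A}
    (ha : a ∈ 𝒜 d) (x : G) (n : N.carrier) :
    letI := unfoldModule hq N
    a • unfoldIn q N x n = unfoldIn q N (d + x) (a • n) := by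
  classical
  let D := (DirectSum.isInternal_submodule_of_iSupIndep_of_iSup_eq_top
    hq.isGrading.indep hq.isGrading.iSup_eq).chooseDecomposition
  let : GradedRing 𝒜 :=
    { one_mem := hq.one_mem
      mul_mem := fun {g g' a b} ha hb => hq.mul_mem g g' a ha b hb }
  let : SetLike.GradedSMul 𝒜 fun x : G => N.comp (q x) :=
    ⟨fun {g g' a n} ha hn => by
      rw [vadd_eq_add, map_add]
      exact N.smul_mem (hq.mem ha) hn⟩
  change (DirectSum.decompose 𝒜 a) • unfoldIn q N x n = _
  rw [DirectSum.decompose_of_mem 𝒜 ha]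
  unfold unfoldIn
  rw [LinearMap.comp_apply, LinearMap.comp_apply]
  refine (DirectSum.Gmodule.of_smul_of (fun g => 𝒜 g) (fun x : G => N.comp (q x)) _ _).trans ?_
  refine congrArg _ (Subtype.ext ?_)
  change a • N.proj (q x) n = N.proj (q (d + x)) (a • n)
  rw [map_add, N.proj_smul (hq.mem ha)]

theorem isScalarTower_unfold (hq : IsCoarsening 𝒜 𝒜' q) (N : GradedModFP 𝒜') :
    letI := unfoldModule hq N
    IsScalarTower k A (Unfold q N) := by
  let := unfoldModule hq N
  refine ⟨fun c a m => ?_⟩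
  induction a using hq.isGrading.induction with
  | zero => simp
  | hom d a ha =>
    induction m using (isGrading_unfold N).induction with
    | zero => simp
    | hom x m hm =>
      obtain ⟨n, rfl⟩ := hm
      rw [smul_unfoldIn hq ha, smul_unfoldIn hq (Submodule.smul_mem _ c ha), smul_assoc, map_smul]
    | add x y hx hy => simp only [smul_add, hx, hy]
  | add a b ha hb => simp only [add_smul, smul_add, ha, hb]

/-- The copies of homogeneous generators of `N` in the finitely many degrees above their degree
generate the unfolding. -/
theorem finite_unfold (hq : IsCoarsening 𝒜 𝒜' q) (hfin : (q.ker : Set G).Finite)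
    (N : GradedModFP 𝒜') :
    letI := unfoldModule hq N
    Module.Finite A (Unfold q N) := by
  let := unfoldModule hq N
  have := N.finite
  obtain ⟨S, hS, hS'⟩ := exists_homogeneous_generators (A := A) N.comp N.iSup_comp
  choose! d hd using hS
  have hf (g : G') : {x | q x = g}.Finite := by
    obtain ⟨y, rfl⟩ := hq.surjective g
    refine (hfin.image (y + ·)).subset fun x hx => ⟨x - y, ?_, by simp⟩
    change q (x - y) = 0
    rw [map_sub, hx, sub_self]
  let T : Set (Unfold q N) := ⋃ n ∈ S, (fun x => unfoldIn q N x n) '' {x | q x = d n}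
  have hT : T.Finite := S.finite_toSet.biUnion fun n _ => (hf _).image _
  have key (n : N.carrier) : ∀ x, unfoldIn q N x n ∈ Submodule.span A T := by
    have hn : n ∈ Submodule.span A (S : Set N.carrier) := hS' ▸ Submodule.mem_top
    induction hn using Submodule.closure_induction with
    | zero => simp
    | add x y _ _ hx hy => intro z; rw [map_add]; exact add_mem (hx z) (hy z)
    | smul_mem a n hn =>
      intro x
      induction a using hq.isGrading.induction with
      | zero => simp
      | hom c a ha =>
        have e := smul_unfoldIn hq ha (x - c) n
        rw [add_sub_cancel] at e
        rw [← e]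
        refine Submodule.smul_mem _ _ ?_
        by_cases hc : d n = q (x - c)
        · exact Submodule.subset_span (Set.mem_biUnion hn ⟨x - c, hc.symm, rfl⟩)
        · rw [unfoldIn_ne (hd n hn) hc]
          exact zero_mem _
      | add a b ha hb => rw [add_smul, map_add]; exact add_mem ha hb
  refine ⟨⟨hT.toFinset, ?_⟩⟩
  rw [Set.Finite.coe_toFinset]
  refine top_unique fun m hm => ?_
  clear hm
  induction m using (isGrading_unfold N).induction with
  | zero => exact zero_mem _
  | hom x m hm =>
    obtain ⟨n, rfl⟩ := hm
    exact key n x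
  | add x y hx hy => exact add_mem hx hy

variable [IsNoetherianRing A]

/-- The `G`-graded module with components `N_{q(x)}`, for a graded module `N` over the
coarsening. -/
noncomputable def unfoldObj (hq : IsCoarsening 𝒜 𝒜' q) (hfin : (q.ker : Set G).Finite)
    (N : GradedModFP 𝒜') : GradedModFP 𝒜 :=
  letI := unfoldModule hq N
  haveI := isScalarTower_unfold hq N
  haveI := finite_unfold hq hfin N
  { carrier := Unfold q N
    comp := fun x => LinearMap.range (unfoldIn q N x)
    indep := (isGrading_unfold N).indep
    iSup_comp := (isGrading_unfold N).iSup_eq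
    smul_mem := by
      rintro d x a _ ha ⟨n, rfl⟩
      exact ⟨a • n, (smul_unfoldIn hq ha x n).symm⟩
    finitePresentation := Module.finitePresentation_of_finite A _ }

end GradedModFP

end Unfold

/-! ### The unfolding functor -/

section Unfold

variable {k A : Type u} [Field k] [CommRing A] [Algebra k A] {G : Type} [AddCommGroup G]
  {G' : Type w'} [AddCommGroup G']

namespace GradedModFP

variable {𝒜 : G → Submodule k A} {𝒜' : G' → Submodule k A} {q : G →+ G'} [IsNoetherianRing A]

/-- The copy of `N_{q(x)}` in the unfolding of `N` in degree `x`, preceded by the projection of `N`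
onto `N_{q(x)}`. -/
noncomputable def unfoldι (hq : IsCoarsening 𝒜 𝒜' q) (hfin : (q.ker : Set G).Finite)
    (N : GradedModFP 𝒜') (x : G) : N.carrier →ₗ[k] (unfoldObj hq hfin N).carrier :=
  unfoldIn q N x

variable {hq : IsCoarsening 𝒜 𝒜' q} {hfin : (q.ker : Set G).Finite} {N : GradedModFP 𝒜'}

theorem smul_unfoldι {d : G} {a : A} (ha : a ∈ 𝒜 d) (x : G) (n : N.carrier) :
    a • unfoldι hq hfin N x n = unfoldι hq hfin N (d + x) (a • n) :=
  smul_unfoldIn hq ha x n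

theorem unfoldι_mem (x : G) (n : N.carrier) :
    unfoldι hq hfin N x n ∈ (unfoldObj hq hfin N).comp x :=
  ⟨n, rfl⟩

theorem exists_unfoldι {x : G} {m} (hm : m ∈ (unfoldObj hq hfin N).comp x) :
    ∃ n ∈ N.comp (q x), m = unfoldι hq hfin N x n := by
  obtain ⟨n, rfl⟩ := hm
  exact ⟨N.proj (q x) n, N.isGrading.proj_mem _ _, (unfoldIn_proj x n).symm⟩

theorem unfold_induction {P : (unfoldObj hq hfin N).carrier → Prop}
    (hom : ∀ x n, n ∈ N.comp (q x) → P (unfoldι hq hfin N x n))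
    (add : ∀ m m', P m → P m' → P (m + m')) (m) : P m := by
  induction m using (unfoldObj hq hfin N).isGrading.induction with
  | zero =>
    rw [← map_zero (unfoldι hq hfin N 0)]
    exact hom 0 0 (zero_mem _)
  | hom x m hm =>
    obtain ⟨n, hn, rfl⟩ := exists_unfoldι hm
    exact hom x n hn
  | add x y hx hy => exact add x y hx hy

theorem unfold_ext {P : Type*} [AddCommGroup P] [Module A P]
    {F F' : (unfoldObj hq hfin N).carrier →ₗ[A] P}
    (h : ∀ x n, n ∈ N.comp (q x) → F (unfoldι hq hfin N x n) = F' (unfoldι hq hfin N x n)) :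
    F = F' :=
  LinearMap.ext fun m => unfold_induction (P := fun m => F m = F' m) h
    (fun x y hx hy => by rw [map_add, map_add, hx, hy]) m

variable (hq hfin) in
theorem exists_unfoldLinearDesc (N : GradedModFP 𝒜') {P : Type*} [AddCommGroup P] [Module k P]
    [Module A P] (f : G → N.carrier →ₗ[k] P)
    (hf : ∀ d, ∀ a ∈ 𝒜 d, ∀ x, ∀ n ∈ N.comp (q x), f (d + x) (a • n) = a • f x n) :
    ∃ F : (unfoldObj hq hfin N).carrier →ₗ[A] P,
      ∀ x, ∀ n ∈ N.comp (q x), F (unfoldι hq hfin N x n) = f x n := by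
  let F : (unfoldObj hq hfin N).carrier →ₗ[k] P := unfoldDesc q N f
  have hF (x n) (hn : n ∈ N.comp (q x)) : F (unfoldι hq hfin N x n) = f x n := by
    refine (unfoldDesc_unfoldIn q f x n).trans ?_
    rw [N.isGrading.proj_same hn]
  refine ⟨IsGrading.linearMapOfHomogeneous hq.isGrading (unfoldObj hq hfin N).isGrading F ?_, hF⟩
  intro d a ha x m hm
  obtain ⟨n, hn, rfl⟩ := exists_unfoldι hm
  rw [smul_unfoldι ha, hF x n hn, hF, hf d a ha x n hn]
  rw [map_add]
  exact N.smul_mem (hq.mem ha) hn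

/-- The `A`-linear map on the unfolding with given restrictions to the summands. -/
noncomputable def unfoldLinearDesc (hq : IsCoarsening 𝒜 𝒜' q) (hfin : (q.ker : Set G).Finite)
    (N : GradedModFP 𝒜') {P : Type*} [AddCommGroup P] [Module k P]
    [Module A P] (f : G → N.carrier →ₗ[k] P)
    (hf : ∀ d, ∀ a ∈ 𝒜 d, ∀ x, ∀ n ∈ N.comp (q x), f (d + x) (a • n) = a • f x n) :
    (unfoldObj hq hfin N).carrier →ₗ[A] P :=
  (exists_unfoldLinearDesc hq hfin N f hf).choose

theorem unfoldLinearDesc_unfoldι {P : Type*} [AddCommGroup P] [Module k P]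
    [Module A P] (f : G → N.carrier →ₗ[k] P)
    (hf : ∀ d, ∀ a ∈ 𝒜 d, ∀ x, ∀ n ∈ N.comp (q x), f (d + x) (a • n) = a • f x n)
    {x n} (hn : n ∈ N.comp (q x)) :
    unfoldLinearDesc hq hfin N f hf (unfoldι hq hfin N x n) = f x n :=
  (exists_unfoldLinearDesc hq hfin N f hf).choose_spec x n hn

theorem unfoldι_map_smul {N N' : GradedModFP 𝒜'} (f : N ⟶ N') (d : G) (a : A) (ha : a ∈ 𝒜 d)
    (x : G) (n : N.carrier) (_ : n ∈ N.comp (q x)) :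
    (unfoldι hq hfin N' (d + x) ∘ₗ Hom.kLinearMap f) (a • n) =
      a • (unfoldι hq hfin N' x ∘ₗ Hom.kLinearMap f) n := by
  refine Eq.trans ?_ (smul_unfoldι ha x _).symm
  exact congrArg (unfoldι hq hfin N' (d + x)) (f.toLinearMap.map_smul a n)

/-- The morphism of unfoldings induced by a morphism. -/
noncomputable def unfoldMap (hq : IsCoarsening 𝒜 𝒜' q) (hfin : (q.ker : Set G).Finite)
    {N N' : GradedModFP 𝒜'} (f : N ⟶ N') : unfoldObj hq hfin N ⟶ unfoldObj hq hfin N' where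
  toLinearMap := unfoldLinearDesc hq hfin N
    (fun x => unfoldι hq hfin N' x ∘ₗ Hom.kLinearMap f) (unfoldι_map_smul f)
  map_mem := by
    intro x m hm
    obtain ⟨n, hn, rfl⟩ := exists_unfoldι hm
    rw [unfoldLinearDesc_unfoldι _ _ hn]
    exact unfoldι_mem _ _

theorem unfoldMap_unfoldι {N N' : GradedModFP 𝒜'} (f : N ⟶ N') {x : G} {n : N.carrier}
    (hn : n ∈ N.comp (q x)) :
    (unfoldMap hq hfin f).toLinearMap (unfoldι hq hfin N x n) =
      unfoldι hq hfin N' x (f.toLinearMap n) :=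
  unfoldLinearDesc_unfoldι _ (unfoldι_map_smul f) hn

theorem map_neg_add_of_mem_ker (h : q.ker) (x : G) : q (-h + x) = q x := by
  rw [map_add, map_neg, show q h = 0 from h.2, neg_zero, zero_add]

/-- The translations of an unfolding by the elements of the kernel of `q`. -/
noncomputable def unfoldTranslate (hq : IsCoarsening 𝒜 𝒜' q) (hfin : (q.ker : Set G).Finite)
    (N : GradedModFP 𝒜') (h : q.ker) :
    (unfoldObj hq hfin N).carrier →ₗ[A] (unfoldObj hq hfin N).carrier :=
  unfoldLinearDesc hq hfin N (fun x => unfoldι hq hfin N (-h + x)) (fun d a ha x n _ => by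
    rw [smul_unfoldι ha, add_left_comm])

theorem unfoldTranslate_unfoldι (h : q.ker) {x : G} {n : N.carrier} (hn : n ∈ N.comp (q x)) :
    unfoldTranslate hq hfin N h (unfoldι hq hfin N x n) = unfoldι hq hfin N (-h + x) n := by
  unfold unfoldTranslate
  rw [unfoldLinearDesc_unfoldι _ _ hn]

theorem unfoldTranslate_mem (h : q.ker) {x : G} {m} (hm : m ∈ (unfoldObj hq hfin N).comp x) :
    unfoldTranslate hq hfin N h m ∈ (unfoldObj hq hfin N).comp (-h + x) := by
  obtain ⟨n, hn, rfl⟩ := exists_unfoldι hm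
  rw [unfoldTranslate_unfoldι _ hn]
  exact unfoldι_mem _ _

theorem unfoldTranslate_add (g h : q.ker) : unfoldTranslate hq hfin N (g + h) =
    unfoldTranslate hq hfin N h ∘ₗ unfoldTranslate hq hfin N g := by
  refine unfold_ext fun x n hn => ?_
  have hn' : n ∈ N.comp (q (-g + x)) := by rwa [map_neg_add_of_mem_ker]
  rw [LinearMap.comp_apply, unfoldTranslate_unfoldι _ hn, unfoldTranslate_unfoldι _ hn,
    unfoldTranslate_unfoldι _ hn', AddSubgroup.coe_add, neg_add_rev, add_assoc]

theorem unfoldTranslate_zero : unfoldTranslate hq hfin N 0 = LinearMap.id := by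
  refine unfold_ext fun x n hn => ?_
  rw [unfoldTranslate_unfoldι _ hn, AddSubgroup.coe_zero, neg_zero, zero_add]
  rfl

theorem unfoldTranslate_unfoldMap {N N' : GradedModFP 𝒜'} (f : N ⟶ N') (h : q.ker) :
    unfoldTranslate hq hfin N' h ∘ₗ (unfoldMap hq hfin f).toLinearMap =
      (unfoldMap hq hfin f).toLinearMap ∘ₗ unfoldTranslate hq hfin N h := by
  refine unfold_ext fun x n hn => ?_
  have hn' : n ∈ N.comp (q (-h + x)) := by rwa [map_neg_add_of_mem_ker]
  rw [LinearMap.comp_apply, LinearMap.comp_apply, unfoldMap_unfoldι f hn,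
    unfoldTranslate_unfoldι _ hn, unfoldMap_unfoldι f hn',
    unfoldTranslate_unfoldι _ (f.map_mem hn)]

/-- The unfolding of a graded module is equivariant under shifts by the kernel of `q`. -/
noncomputable def unfold (hq : IsCoarsening 𝒜 𝒜' q) (hfin : (q.ker : Set G).Finite) :
    GradedModFP 𝒜' ⥤ (shiftAction 𝒜 q.ker).EquivariantObject where
  obj N :=
    { obj := unfoldObj hq hfin N
      α := fun h =>
        { hom := Hom.mk (Y := (shift (-(h.toAdd : G))).obj (unfoldObj hq hfin N))
            (unfoldTranslate hq hfin N h.toAdd) fun hm => unfoldTranslate_mem _ hm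
          inv := Hom.mk (X := (shift (-(h.toAdd : G))).obj (unfoldObj hq hfin N))
            (unfoldTranslate hq hfin N (-h.toAdd)) fun {x m} hm => by
              have := unfoldTranslate_mem (hq := hq) (hfin := hfin) (N := N) (-h.toAdd) hm
              rwa [AddSubgroup.coe_neg, neg_add_cancel_left] at this
          hom_inv_id := hom_ext <| (unfoldTranslate_add h.toAdd (-h.toAdd)).symm.trans <| by
            rw [add_neg_cancel]; exact unfoldTranslate_zero
          inv_hom_id := hom_ext <| (unfoldTranslate_add (-h.toAdd) h.toAdd).symm.trans <| by
            rw [neg_add_cancel]; exact unfoldTranslate_zero }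
      rel := fun g h => hom_ext (unfoldTranslate_add g.toAdd h.toAdd) }
  map {N N'} f :=
    { hom := unfoldMap hq hfin f
      comm := fun h => hom_ext (unfoldTranslate_unfoldMap f h.toAdd) }
  map_id N := CatAction.EquivariantObject.hom_ext (hom_ext (unfold_ext fun x n hn =>
    unfoldMap_unfoldι (𝟙 N) hn))
  map_comp f g := CatAction.EquivariantObject.hom_ext (hom_ext (unfold_ext fun x n hn =>
    (unfoldMap_unfoldι (f ≫ g) hn).trans
      ((congrArg (unfoldMap hq hfin g).toLinearMap (unfoldMap_unfoldι f hn)).trans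
        (unfoldMap_unfoldι g (f.map_mem hn))).symm))

/-- The map from an unfolding to the module which is the identity on each summand. -/
noncomputable def unfoldSum (hq : IsCoarsening 𝒜 𝒜' q) (hfin : (q.ker : Set G).Finite)
    (N : GradedModFP 𝒜') : (unfoldObj hq hfin N).carrier →ₗ[A] N.carrier :=
  unfoldLinearDesc hq hfin N (fun _ => LinearMap.id) (fun _ _ _ _ _ _ => rfl)

theorem unfoldSum_unfoldι {x : G} {n : N.carrier} (hn : n ∈ N.comp (q x)) :
    unfoldSum hq hfin N (unfoldι hq hfin N x n) = n :=
  unfoldLinearDesc_unfoldι _ _ hn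

instance faithful_unfold (hq : IsCoarsening 𝒜 𝒜' q) (hfin : (q.ker : Set G).Finite) :
    (unfold hq hfin).Faithful where
  map_injective {N N'} f f' h := by
    have h' : unfoldMap hq hfin f = unfoldMap hq hfin f' :=
      congrArg CatAction.EquivariantObject.Hom.hom h
    refine hom_ext (LinearMap.ext fun n => ?_)
    induction n using N.isGrading.induction with
    | zero => simp
    | hom g n hn =>
      obtain ⟨x, rfl⟩ := hq.surjective g
      rw [← unfoldSum_unfoldι (hq := hq) (hfin := hfin) (f.map_mem hn),
        ← unfoldSum_unfoldι (hq := hq) (hfin := hfin) (f'.map_mem hn),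
        ← unfoldMap_unfoldι f hn, ← unfoldMap_unfoldι f' hn, h']
    | add x y hx hy => rw [map_add, map_add, hx, hy]

/-- An equivariant morphism of unfoldings is determined by its restriction to the components in
degrees `s g`, for a section `s` of `q`; these components make up the module itself. -/
instance full_unfold (hq : IsCoarsening 𝒜 𝒜' q) (hfin : (q.ker : Set G).Finite) :
    (unfold hq hfin).Full where
  map_surjective {N N'} θ := by
    choose s hs using hq.surjective
    let t : (unfoldObj hq hfin N).carrier →ₗ[A] (unfoldObj hq hfin N').carrier :=
      (CatAction.EquivariantObject.Hom.hom θ).toLinearMap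
    have ht {x : G} {m} (hm : m ∈ (unfoldObj hq hfin N).comp x) :
        t m ∈ (unfoldObj hq hfin N').comp x :=
      (CatAction.EquivariantObject.Hom.hom θ).map_mem hm
    have hcomm (h : q.ker) (x : G) (n : N.carrier) (hn : n ∈ N.comp (q x)) :
        t (unfoldι hq hfin N (-h + x) n) =
          unfoldTranslate hq hfin N' h (t (unfoldι hq hfin N x n)) := by
      have := DFunLike.congr_fun (congrArg Hom.toLinearMap (θ.comm (.ofAdd h)))
        (unfoldι hq hfin N x n)
      refine Eq.trans ?_ this.symm
      exact congrArg t (unfoldTranslate_unfoldι h hn).symm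
    have hsum (h : q.ker) (m) : unfoldSum hq hfin N'
        (unfoldTranslate hq hfin N' h m) = unfoldSum hq hfin N' m := by
      induction m using unfold_induction with
      | hom x n hn =>
        have hn' : n ∈ N'.comp (q (-h + x)) := by rwa [map_neg_add_of_mem_ker]
        refine (congrArg _ (unfoldTranslate_unfoldι h hn)).trans ?_
        rw [unfoldSum_unfoldι hn, unfoldSum_unfoldι hn']
      | add m m' hm hm' =>
        refine (congrArg _ (map_add _ _ _)).trans ((map_add _ _ _).trans
            ((congrArg₂ _ hm hm').trans (map_add _ _ _).symm))
    let F : N.carrier →ₗ[k] N'.carrier := N.isGrading.lift fun g =>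
      (unfoldSum hq hfin N').restrictScalars k ∘ₗ t.restrictScalars k ∘ₗ unfoldι hq hfin N (s g)
    have hF (x : G) (n : N.carrier) (hn : n ∈ N.comp (q x)) :
        F n = unfoldSum hq hfin N' (t (unfoldι hq hfin N x n)) := by
      have hx : x - s (q x) ∈ q.ker := by
        change q (x - s (q x)) = 0
        rw [map_sub, hs, sub_self]
      have e : s (q x) = -(⟨x - s (q x), hx⟩ : q.ker) + x := by simp
      refine (N.isGrading.lift_apply _ hn).trans ?_
      change unfoldSum hq hfin N' (t (unfoldι hq hfin N (s (q x)) n)) = _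
      rw [e, hcomm _ _ _ hn]
      exact hsum _ _
    have hF' (x : G) (n : N.carrier) (hn : n ∈ N.comp (q x)) :
        ∃ n' ∈ N'.comp (q x), t (unfoldι hq hfin N x n) = unfoldι hq hfin N' x n' ∧
          F n = n' := by
      obtain ⟨n', hn', e⟩ := exists_unfoldι (ht (unfoldι_mem (hq := hq) (hfin := hfin) x n))
      exact ⟨n', hn', e, by rw [hF x n hn, e, unfoldSum_unfoldι hn']⟩
    refine ⟨⟨IsGrading.linearMapOfHomogeneous hq.isGrading N.isGrading F ?_, ?_⟩, ?_⟩
    · intro d a ha g n hn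
      obtain ⟨x, rfl⟩ := hq.surjective g
      have hdn := N.smul_mem (hq.mem ha) hn
      rw [← map_add] at hdn
      rw [hF _ _ hdn, hF x n hn, ← smul_unfoldι ha, map_smul, map_smul]
    · intro g n hn
      obtain ⟨x, rfl⟩ := hq.surjective g
      obtain ⟨n', hn', -, e⟩ := hF' x n hn
      change F n ∈ _
      rwa [e]
    · refine CatAction.EquivariantObject.hom_ext (hom_ext (unfold_ext (hq := hq) (hfin := hfin)
        fun x n hn => ?_))
      obtain ⟨n', hn', e, e'⟩ := hF' x n hn
      refine (unfoldMap_unfoldι _ hn).trans ?_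
      change unfoldι hq hfin N' x (F n) = t (unfoldι hq hfin N x n)
      rw [e, e']

end GradedModFP

end Unfold

/-! ### Equivariant graded modules for degree shifts -/

section Unfold

variable {k A : Type u} [Field k] [CommRing A] [Algebra k A] {G : Type} [AddCommGroup G]
  {G' : Type w'} [AddCommGroup G']

namespace GradedModFP

variable {𝒜 : G → Submodule k A} {𝒜' : G' → Submodule k A} {q : G →+ G'}

/-- The `A`-linear automorphisms given by the structure of a shift-equivariant module. -/
def equivariantMap {K : AddSubgroup G} (Y : (shiftAction 𝒜 K).EquivariantObject) (h : K) :
    Y.obj.carrier →ₗ[A] Y.obj.carrier :=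
  Hom.toLinearMap (X := Y.obj) (Y := (shift (-(h : G))).obj Y.obj) (Y.α (.ofAdd h)).hom

theorem equivariantMap_mem {K : AddSubgroup G} (Y : (shiftAction 𝒜 K).EquivariantObject) (h : K)
    {x : G} {m} (hm : m ∈ Y.obj.comp x) : equivariantMap Y h m ∈ Y.obj.comp (-h + x) :=
  Hom.map_mem (Y.α (.ofAdd h)).hom hm

theorem equivariantMap_add {K : AddSubgroup G} (Y : (shiftAction 𝒜 K).EquivariantObject)
    (g h : K) (m) : equivariantMap Y (g + h) m = equivariantMap Y h (equivariantMap Y g m) :=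
  DFunLike.congr_fun (congrArg Hom.toLinearMap (Y.rel (.ofAdd g) (.ofAdd h))) m

theorem equivariantMap_zero {K : AddSubgroup G} (Y : (shiftAction 𝒜 K).EquivariantObject) (m) :
    equivariantMap Y 0 m = m := by
  have hinj : Function.Injective (equivariantMap Y 0) := by
    refine Function.LeftInverse.injective (g := fun m =>
      Hom.toLinearMap (X := (shift (-((0 : K) : G))).obj Y.obj) (Y := Y.obj)
        (Y.α (.ofAdd (0 : K))).inv m) ?_
    exact fun m => DFunLike.congr_fun (congrArg Hom.toLinearMap (Y.α (.ofAdd (0 : K))).hom_inv_id) m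
  apply hinj
  rw [← equivariantMap_add, add_zero]

variable [IsNoetherianRing A]

open Classical in
/-- The coinvariants of a shift-equivariant module are a graded module over the coarsening, with
the same homogeneous components. -/
theorem exists_coinvariants (hq : IsCoarsening 𝒜 𝒜' q) (hfin : (q.ker : Set G).Finite)
    (Y : (shiftAction 𝒜 q.ker).EquivariantObject) :
    ∃ (N : GradedModFP 𝒜') (π : Y.obj.carrier →ₗ[A] N.carrier),
      (∀ h m, π (equivariantMap Y h m) = π m) ∧
      (∀ x, ∀ m ∈ Y.obj.comp x, π m ∈ N.comp (q x)) ∧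
      (∀ x, ∀ n ∈ N.comp (q x), ∃ m ∈ Y.obj.comp x, π m = n) ∧
      ∀ x, ∀ m ∈ Y.obj.comp x, π m = 0 → m = 0 := by
  have := hfin.fintype
  have hM := Y.obj.isGrading
  have hM' := hM.coarsen q
  let U : Submodule A Y.obj.carrier :=
    ⨆ h : q.ker, LinearMap.range (LinearMap.id - equivariantMap Y h)
  let π : Y.obj.carrier →ₗ[A] Y.obj.carrier ⧸ U := U.mkQ
  have hπ (h m) : π (equivariantMap Y h m) = π m := by
    refine Eq.symm ((Submodule.Quotient.eq U).2 ?_)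
    exact Submodule.mem_iSup_of_mem h ⟨m, rfl⟩
  have hU {P : Submodule k Y.obj.carrier} (hP : ∀ h m, m - equivariantMap Y h m ∈ P) :
      ∀ m ∈ U, m ∈ P := by
    intro m hm
    induction hm using Submodule.iSup_induction' with
    | mem h m hm =>
      obtain ⟨m, rfl⟩ := hm
      exact hP h m
    | zero => exact zero_mem _
    | add m m' _ _ hm hm' => exact add_mem hm hm'
  have hcoarse (h : q.ker) (g') (m) : equivariantMap Y h (hM'.proj g' m) =
      hM'.proj g' (equivariantMap Y h m) := by
    refine hM'.map_proj hM' ((equivariantMap Y h).restrictScalars k) (fun g m hm => ?_) g' m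
    induction hm using Submodule.iSup_induction' with
    | mem x m hm =>
      rcases eq_or_ne (q x) g with rfl | hx
      · rw [iSup_pos rfl] at hm
        have := IsGrading.mem_coarsen q (equivariantMap_mem Y h hm)
        rwa [map_neg_add_of_mem_ker] at this
      · rw [iSup_neg hx, Submodule.mem_bot] at hm
        rw [hm, map_zero]
        exact zero_mem _
    | zero => rw [map_zero]; exact zero_mem _
    | add m m' _ _ hm hm' => rw [map_add]; exact add_mem hm hm'
  have hgr : IsGrading fun g' => (⨆ x, ⨆ _ : q x = g', Y.obj.comp x).map (π.restrictScalars k) := by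
    refine hM'.map_of_surjective (π.restrictScalars k) U.mkQ_surjective fun g m hm => ?_
    have hm : m ∈ U := (Submodule.Quotient.mk_eq_zero U).1 hm
    refine (Submodule.Quotient.mk_eq_zero U).2 ?_
    refine hU (P := (U.restrictScalars k).comap (hM'.proj g)) (fun h m => ?_) m hm
    rw [Submodule.mem_comap, map_sub, ← hcoarse]
    exact Submodule.mem_iSup_of_mem h ⟨_, rfl⟩
  have hmem (x) (m) (hm : m ∈ Y.obj.comp x) : π m ∈
      (⨆ y, ⨆ _ : q y = q x, Y.obj.comp y).map (π.restrictScalars k) :=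
    ⟨m, IsGrading.mem_coarsen q hm, rfl⟩
  -- An element of degree `y` is identified with its translate of degree `x` when `q y = q x`.
  have hlift (x) (n) (hn : n ∈ (⨆ y, ⨆ _ : q y = q x, Y.obj.comp y).map (π.restrictScalars k)) :
      ∃ m ∈ Y.obj.comp x, π m = n := by
    obtain ⟨m, hm, rfl⟩ := hn
    induction hm using Submodule.iSup_induction' with
    | mem y m hm =>
      rcases eq_or_ne (q y) (q x) with hy | hy
      · rw [iSup_pos hy] at hm
        have hk : y - x ∈ q.ker := by
          change q (y - x) = 0
          rw [map_sub, hy, sub_self]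
        refine ⟨_, ?_, hπ ⟨y - x, hk⟩ m⟩
        simpa using equivariantMap_mem Y ⟨y - x, hk⟩ hm
      · rw [iSup_neg hy, Submodule.mem_bot] at hm
        exact ⟨0, zero_mem _, by rw [hm]; rfl⟩
    | zero => exact ⟨0, zero_mem _, rfl⟩
    | add m m' _ _ hm hm' =>
      obtain ⟨a, ha, ea⟩ := hm
      obtain ⟨b, hb, eb⟩ := hm'
      exact ⟨a + b, add_mem ha hb, by rw [map_add, map_add, ea, eb]⟩
  have hinj (x) (m) (hm : m ∈ Y.obj.comp x) (h0 : π m = 0) : m = 0 := by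
    -- The sum of the translates, followed by the projection to degree `x`, factors through the
    -- coinvariants and is the identity in degree `x`.
    let P : Y.obj.carrier →ₗ[k] Y.obj.carrier :=
      ∑ h : q.ker, Y.obj.proj x ∘ₗ (equivariantMap Y h).restrictScalars k
    have hP : P m = m := by
      rw [LinearMap.sum_apply, Finset.sum_eq_single 0]
      · change Y.obj.proj x (equivariantMap Y 0 m) = m
        rw [equivariantMap_zero, Y.obj.isGrading.proj_same hm]
      · intro h _ hh
        refine Y.obj.isGrading.proj_ne (equivariantMap_mem Y h hm) fun e => hh ?_
        exact Subtype.ext (by simpa using e)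
      · simp
    have hP' (h m) : P (equivariantMap Y h m) = P m := by
      rw [LinearMap.sum_apply, LinearMap.sum_apply]
      refine Fintype.sum_equiv (Equiv.addLeft h) _ _ fun g => ?_
      change Y.obj.proj x (equivariantMap Y g (equivariantMap Y h m)) =
        Y.obj.proj x (equivariantMap Y (h + g) m)
      rw [equivariantMap_add]
    rw [← hP]
    refine hU (P := LinearMap.ker P) (fun h m => ?_) m ((Submodule.Quotient.mk_eq_zero U).1 h0)
    rw [LinearMap.mem_ker, map_sub, hP', sub_self]
  have : Module.Finite A Y.obj.carrier := Y.obj.finite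
  refine ⟨{ carrier := Y.obj.carrier ⧸ U
            comp := fun g' => (⨆ x, ⨆ _ : q x = g', Y.obj.comp x).map (π.restrictScalars k)
            indep := hgr.indep
            iSup_comp := hgr.iSup_eq
            smul_mem := ?_
            finitePresentation := Module.finitePresentation_of_finite A _ }, π, hπ, hmem, hlift,
    hinj⟩
  intro g g' a n ha hn
  obtain ⟨y, rfl⟩ := hq.surjective g'
  obtain ⟨m, hm, rfl⟩ := hlift y n hn
  rw [hq.eq_iSup] at ha
  induction ha using Submodule.iSup_induction' with
  | mem x a ha =>
    rcases eq_or_ne (q x) g with rfl | hx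
    · rw [iSup_pos rfl] at ha
      rw [← map_smul, ← map_add]
      exact hmem _ _ (Y.obj.smul_mem ha hm)
    · rw [iSup_neg hx, Submodule.mem_bot] at ha
      rw [ha, zero_smul]
      exact zero_mem _
  | zero => rw [zero_smul]; exact zero_mem _
  | add a b _ _ ha hb => rw [add_smul]; exact add_mem ha hb

/-- A shift-equivariant module is isomorphic to the unfolding of its coinvariants. -/
instance essSurj_unfold (hq : IsCoarsening 𝒜 𝒜' q) (hfin : (q.ker : Set G).Finite) :
    (unfold hq hfin).EssSurj where
  mem_essImage Y := by
    obtain ⟨N, π, hπ, hmem, hlift, hinj⟩ := exists_coinvariants hq hfin Y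
    let F : Y.obj.carrier →ₗ[k] (unfoldObj hq hfin N).carrier := Y.obj.isGrading.lift fun x =>
      unfoldι hq hfin N x ∘ₗ π.restrictScalars k
    have hF {x m} (hm : m ∈ Y.obj.comp x) : F m = unfoldι hq hfin N x (π m) :=
      Y.obj.isGrading.lift_apply _ hm
    have hFmem (x m) (hm : m ∈ Y.obj.comp x) : F m ∈ (unfoldObj hq hfin N).comp x := by
      rw [hF hm]
      exact unfoldι_mem _ _
    let Ψ : Y.obj ⟶ unfoldObj hq hfin N :=
      { toLinearMap := IsGrading.linearMapOfHomogeneous hq.isGrading Y.obj.isGrading F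
          fun d a ha x m hm => by
            rw [hF hm, hF (Y.obj.smul_mem ha hm), smul_unfoldι ha, map_smul]
        map_mem := hFmem _ _ }
    have hΨ : Function.Bijective Ψ.toLinearMap := by
      constructor
      · rw [injective_iff_map_eq_zero]
        intro m hm
        change F m = 0 at hm
        refine Y.obj.isGrading.ext fun x => ?_
        rw [map_zero]
        have hx := Y.obj.isGrading.proj_mem x m
        refine hinj x _ hx ?_
        have e := Y.obj.isGrading.map_proj (unfoldObj hq hfin N).isGrading F hFmem x m
        rw [hm, map_zero, hF hx] at e
        rw [← unfoldSum_unfoldι (hq := hq) (hfin := hfin) (hmem _ _ hx), e, map_zero]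
      · intro m
        induction m using unfold_induction with
        | hom x n hn =>
          obtain ⟨m, hm, rfl⟩ := hlift x n hn
          exact ⟨m, hF hm⟩
        | add m m' hm hm' =>
          obtain ⟨a, rfl⟩ := hm
          obtain ⟨b, rfl⟩ := hm'
          exact ⟨a + b, map_add _ _ _⟩
    have hcomm (h : q.ker) (m) : unfoldTranslate hq hfin N h (F m) = F (equivariantMap Y h m) := by
      induction m using Y.obj.isGrading.induction with
      | zero => simp
      | hom x m hm =>
        rw [hF hm, hF (equivariantMap_mem Y h hm), unfoldTranslate_unfoldι _ (hmem _ _ hm), hπ]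
      | add m m' hm hm' => simp only [map_add, hm, hm']
    let e : Y ⟶ (unfold hq hfin).obj N :=
      { hom := Ψ
        comm := fun h => hom_ext (LinearMap.ext fun m => hcomm h.toAdd m) }
    have : IsIso (CatAction.EquivariantObject.Hom.hom e) := (isoOfBijective Ψ hΨ).isIso_hom
    have := CatAction.EquivariantObject.isIso_of_isIso_hom e
    exact ⟨N, ⟨(asIso e).symm⟩⟩

theorem isEquivalence_unfold (hq : IsCoarsening 𝒜 𝒜' q) (hfin : (q.ker : Set G).Finite) :
    (unfold hq hfin).IsEquivalence where

theorem isoModFD_unfold_iff (hq : IsCoarsening 𝒜 𝒜' q) (hfin : (q.ker : Set G).Finite)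
    {N N' : GradedModFP 𝒜'} (f : N ⟶ N') :
    isoModFD 𝒜' f ↔ isoModFD 𝒜 (unfoldMap hq hfin f) := by
  choose s hs using hq.surjective
  have := hfin.fintype
  -- The unfolding is a direct sum of copies of the module, indexed by the kernel of `q`.
  let ν (N : GradedModFP 𝒜') (h : q.ker) : N.carrier →ₗ[k] (unfoldObj hq hfin N).carrier :=
    N.isGrading.lift fun g => unfoldι hq hfin N (-h + s g)
  have hν (N : GradedModFP 𝒜') (h : q.ker) {g n} (hn : n ∈ N.comp g) :
      ν N h n = unfoldι hq hfin N (-h + s g) n := N.isGrading.lift_apply _ hn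
  have hmem (N : GradedModFP 𝒜') (h : q.ker) {g n} (hn : n ∈ N.comp g) :
      n ∈ N.comp (q (-h + s g)) := by rwa [map_neg_add_of_mem_ker, hs]
  have hνf (h) (n) : ν N' h (f.toLinearMap n) = (unfoldMap hq hfin f).toLinearMap (ν N h n) := by
    induction n using N.isGrading.induction with
    | zero => simp
    | hom g n hn =>
      rw [hν N h hn, hν N' h (f.map_mem hn), unfoldMap_unfoldι f (hmem N h hn)]
    | add x y hx hy => simp only [map_add, hx, hy]
  have hsum (N : GradedModFP 𝒜') (h) (n) : unfoldSum hq hfin N (ν N h n) = n := by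
    induction n using N.isGrading.induction with
    | zero => simp
    | hom g n hn => rw [hν N h hn, unfoldSum_unfoldι (hmem N h hn)]
    | add x y hx hy => simp only [map_add, hx, hy]
  have hsumf (m) : unfoldSum hq hfin N' ((unfoldMap hq hfin f).toLinearMap m) =
      f.toLinearMap (unfoldSum hq hfin N m) := by
    induction m using unfold_induction with
    | hom x n hn =>
      rw [unfoldMap_unfoldι f hn, unfoldSum_unfoldι hn, unfoldSum_unfoldι (f.map_mem hn)]
    | add m m' hm hm' => simp only [map_add, hm, hm']
  have hι (N : GradedModFP 𝒜') (x : G) : ∃ h : q.ker, ∀ n ∈ N.comp (q x),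
      unfoldι hq hfin N x n = ν N h n := by
    have hx : s (q x) - x ∈ q.ker := by
      change q (s (q x) - x) = 0
      rw [map_sub, hs, sub_self]
    refine ⟨⟨s (q x) - x, hx⟩, fun n hn => ?_⟩
    rw [hν N _ hn]
    simp
  constructor
  · rintro ⟨h1, h2⟩
    refine ⟨?_, ?_⟩
    · have : LinearMap.ker (Hom.kLinearMap (unfoldMap hq hfin f)) ≤
          ⨆ h, (LinearMap.ker (Hom.kLinearMap f)).map (ν N h) := by
        intro m hm
        refine (unfoldObj hq hfin N).isGrading.mem_of_proj_mem fun x => ?_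
        obtain ⟨n, hn, e⟩ := exists_unfoldι ((unfoldObj hq hfin N).isGrading.proj_mem x m)
        obtain ⟨h, hh⟩ := hι N x
        have h0 := (unfoldMap hq hfin f).map_proj x m
        rw [show (unfoldMap hq hfin f).toLinearMap m = 0 from hm, map_zero] at h0
        change (unfoldMap hq hfin f).toLinearMap ((unfoldObj hq hfin N).isGrading.proj x m) = 0 at h0
        rw [e, unfoldMap_unfoldι f hn] at h0
        rw [e, hh n hn]
        refine Submodule.mem_iSup_of_mem h ⟨n, ?_, rfl⟩
        change f.toLinearMap n = 0
        rw [← unfoldSum_unfoldι (hq := hq) (hfin := hfin) (f.map_mem hn), h0, map_zero]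
      exact Submodule.finiteDimensional_of_le this
    · obtain ⟨V, hV, hV'⟩ := finiteDimensional_quotient_iff.1 h2
      refine finiteDimensional_quotient_iff.2 ⟨⨆ h, V.map (ν N' h), inferInstance, ?_⟩
      refine top_unique fun m hm => ?_
      clear hm
      induction m using unfold_induction with
      | hom x n hn =>
        obtain ⟨h, hh⟩ := hι N' x
        obtain ⟨v, hv, _, ⟨b, rfl⟩, rfl⟩ := Submodule.mem_sup.1 (hV' ▸ Submodule.mem_top : n ∈ V ⊔ _)
        rw [hh _ hn, map_add]
        refine add_mem (Submodule.mem_sup_left (Submodule.mem_iSup_of_mem h ⟨v, hv, rfl⟩))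
          (Submodule.mem_sup_right ⟨ν N h b, (hνf h b).symm⟩)
      | add m m' hm hm' => exact add_mem hm hm'
  · rintro ⟨h1, h2⟩
    refine ⟨?_, ?_⟩
    · refine FiniteDimensional.of_injective (V₂ := LinearMap.ker
        (Hom.kLinearMap (unfoldMap hq hfin f))) ((ν N 0).restrict fun n hn => ?_) ?_
      · change (unfoldMap hq hfin f).toLinearMap (ν N 0 n) = 0
        rw [← hνf, show f.toLinearMap n = 0 from hn, map_zero]
      · intro a b hab
        have := congrArg (unfoldSum hq hfin N) (congrArg Subtype.val hab)
        change unfoldSum hq hfin N (ν N 0 a.1) = unfoldSum hq hfin N (ν N 0 b.1) at this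
        rw [hsum, hsum] at this
        exact Subtype.ext this
    · obtain ⟨V, hV, hV'⟩ := finiteDimensional_quotient_iff.1 h2
      refine finiteDimensional_quotient_iff.2
        ⟨V.map ((unfoldSum hq hfin N').restrictScalars k), inferInstance, ?_⟩
      refine top_unique fun n _ => ?_
      obtain ⟨v, hv, _, ⟨b, rfl⟩, e⟩ := Submodule.mem_sup.1
        (hV' ▸ Submodule.mem_top : ν N' 0 n ∈ V ⊔ _)
      rw [← hsum N' 0 n, ← e, map_add]
      exact add_mem (Submodule.mem_sup_left ⟨v, hv, rfl⟩)
        (Submodule.mem_sup_right ⟨unfoldSum hq hfin N b, (hsumf b).symm⟩)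

/-- If a subgroup `K` of finite order acts on `qmod^G-A` by degree shifts, then the
equivariantization is `qmod^{G/K}-A`. -/
theorem nonempty_qmod_equivalence_shift {K : AddSubgroup G} (hq : IsCoarsening 𝒜 𝒜' q)
    (hK : q.ker = K) (hfin : Finite K) {δ : G →+ ℤ} (hA : PositivelyGraded 𝒜 δ)
    {δ' : G' →+ ℤ} (hA' : PositivelyGraded 𝒜' δ') :
    Nonempty (QMod 𝒜' ≌ (qmodShiftAction 𝒜 K).EquivariantObject) := by
  subst hK
  have hfin' : (q.ker : Set G).Finite := hfin
  have := hasRightCalculusOfFractions hA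
  have := hasRightCalculusOfFractions hA'
  have := isEquivalence_unfold hq hfin'
  have hδ (h : q.ker) : δ h = 0 := by
    obtain ⟨n, hn, e⟩ := isOfFinAddOrder_iff_nsmul_eq_zero.1 (isOfFinAddOrder_of_finite h)
    have e' : n • δ (h : G) = 0 := by
      rw [← map_nsmul, ← AddSubgroup.coe_nsmul, e, AddSubgroup.coe_zero, map_zero]
    rw [nsmul_eq_mul, mul_eq_zero] at e'
    exact e'.resolve_left (by exact_mod_cast hn.ne')
  have hδ' (h : q.ker) (g : G) : δ (-h + g) = δ g := by
    rw [map_add, map_neg, hδ, neg_zero, zero_add]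
  -- Shifts in degree `0` commute with truncation.
  have htr (h : Multiplicative q.ker) (n : ℤ) (X : GradedModFP 𝒜) (x : X.carrier) :
      x ∈ truncSub hA n ((shift (-(h.toAdd : G))).obj X) ↔ x ∈ truncSub hA n X := by
    have e (g : G) : ((shift (-(h.toAdd : G))).obj X).proj g x = X.proj (-h.toAdd + g) x :=
      (IsGrading.map_proj_of_injective ((shift (-(h.toAdd : G))).obj X).isGrading X.isGrading
        LinearMap.id (add_right_injective (-(h.toAdd : G))) (fun _ _ hx => hx) g x)
    refine ⟨fun hx g hg => ?_, fun hx g hg => (e g).trans (hx _ (by rwa [hδ']))⟩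
    have := (e _).symm.trans (hx (h.toAdd + g) (by rwa [map_add, hδ, zero_add]))
    rwa [neg_add_cancel_left] at this
  refine CatAction.nonempty_localization_equivalence_equivariantObject
    (Φ := shiftAction 𝒜 q.ker) (W := isoModFD 𝒜)
    (truncation hA (shiftAction 𝒜 q.ker) (fun h n X => isoOfBijective
      (X := (shift (-(h.toAdd : G))).obj ((trunc hA n).obj X))
      (Y := (trunc hA n).obj ((shift (-(h.toAdd : G))).obj X))
      ⟨LinearMap.codRestrict _ (Submodule.subtype (truncSub hA n X))
        fun x => (htr h n X x.1).2 x.2, fun hx => hx⟩ ⟨fun x y hxy =>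
        Subtype.ext (congrArg (Submodule.subtype
          (truncSub hA n ((shift (-(h.toAdd : G))).obj X))) hxy),
        fun y => ⟨⟨y.1, (htr h n X y.1).1 y.2⟩, rfl⟩⟩)
      fun h n X => rfl)
    (fun _ _ f _ => isoModFD_of_isIso f) (shiftAction_isoModFD q.ker) (isoModFD 𝒜')
    (unfold hq hfin') (fun _ _ f => isoModFD_unfold_iff hq hfin' f)

end GradedModFP

end Unfold

/-! ### Gradings by characters and twisting actions -/

section Twist

variable {k A : Type u} [Field k] [CommRing A] [Algebra k A] {G : Type w} [AddCommGroup G]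
  {p : ℕ} [NeZero p] {χ : AddChar (ZMod p) k}

namespace GradedModFP

/-- A graded module, with the coarser grading. -/
def coarsenObj {G' : Type w'} [AddCommGroup G'] {𝒜 : G → Submodule k A} {𝒜' : G' → Submodule k A}
    {q : G →+ G'} (hq : IsCoarsening 𝒜 𝒜' q) (N : GradedModFP 𝒜) : GradedModFP 𝒜' where
  carrier := N.carrier
  comp g' := ⨆ g, ⨆ _ : q g = g', N.comp g
  indep := (N.isGrading.coarsen q).indep
  iSup_comp := (N.isGrading.coarsen q).iSup_eq
  smul_mem {g g' a x} ha hx := by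
    rw [hq.eq_iSup] at ha
    induction ha using Submodule.iSup_induction' with
    | mem h a ha =>
      rcases eq_or_ne (q h) g with rfl | hh
      · rw [iSup_pos rfl] at ha
        induction hx using Submodule.iSup_induction' with
        | mem h' x hx =>
          rcases eq_or_ne (q h') g' with rfl | hh'
          · rw [iSup_pos rfl] at hx
            rw [← map_add]
            exact IsGrading.mem_coarsen q (N.smul_mem ha hx)
          · rw [iSup_neg hh', Submodule.mem_bot] at hx
            rw [hx, smul_zero]
            exact zero_mem _
        | zero => rw [smul_zero]; exact zero_mem _
        | add x y _ _ hx hy => rw [smul_add]; exact add_mem hx hy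
      · rw [iSup_neg hh, Submodule.mem_bot] at ha
        rw [ha, zero_smul]
        exact zero_mem _
    | zero => rw [zero_smul]; exact zero_mem _
    | add a b _ _ ha hb => rw [add_smul]; exact add_mem ha hb
  finitePresentation := N.finitePresentation

variable {𝒜 : G × ZMod p → Submodule k A} {𝒜' : G → Submodule k A}

/-- The map which multiplies the component of degree `(n, j)` by `χ (- g j)`. -/
noncomputable def charScale (χ : AddChar (ZMod p) k) (N : GradedModFP 𝒜) (g : ZMod p) :
    N.carrier →ₗ[k] N.carrier :=
  N.isGrading.lift fun x => χ (-(g * x.2)) • LinearMap.id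

theorem charScale_apply {N : GradedModFP 𝒜} (g : ZMod p) {x} {m} (hm : m ∈ N.comp x) :
    charScale χ N g m = χ (-(g * x.2)) • m :=
  N.isGrading.lift_apply _ hm

theorem charScale_add {N : GradedModFP 𝒜} (g h : ZMod p) (m) :
    charScale χ N (g + h) m = charScale χ N h (charScale χ N g m) := by
  induction m using N.isGrading.induction with
  | zero => simp
  | hom x m hm =>
    rw [charScale_apply _ hm, charScale_apply _ hm, map_smul, charScale_apply _ hm, smul_smul,
      ← AddChar.map_add_eq_mul]
    congr 2
    ring
  | add x y hx hy => simp only [map_add, hx, hy]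

theorem charScale_zero {N : GradedModFP 𝒜} (m) : charScale χ N 0 m = m := by
  induction m using N.isGrading.induction with
  | zero => simp
  | hom x m hm => rw [charScale_apply _ hm]; simp
  | add x y hx hy => simp only [map_add, hx, hy]

theorem charScale_map {N N' : GradedModFP 𝒜} (f : N ⟶ N') (g : ZMod p) (m) :
    charScale χ N' g (f.toLinearMap m) = f.toLinearMap (charScale χ N g m) := by
  induction m using N.isGrading.induction with
  | zero => simp
  | hom x m hm =>
    rw [charScale_apply _ hm, charScale_apply _ (f.map_mem hm)]
    exact ((Hom.kLinearMap f).map_smul _ _).symm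
  | add x y hx hy => simp only [map_add, hx, hy]

variable [IsNoetherianRing A] {ρ : Multiplicative (ZMod p) →* gradedAut 𝒜'}

theorem charScale_smul (hq : IsCoarsening 𝒜 𝒜' (AddMonoidHom.fst G (ZMod p)))
    (hρ : ∀ (g : ZMod p) (x : G × ZMod p), ∀ a ∈ 𝒜 x, (ρ (.ofAdd g)).1 a = χ (g * x.2) • a)
    {N : GradedModFP 𝒜} (g : ZMod p) (a : A) (m) :
    charScale χ N g (a • m) = (ρ (.ofAdd g)⁻¹).1 a • charScale χ N g m := by
  induction a using hq.isGrading.induction with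
  | zero => simp
  | hom y a ha =>
    induction m using N.isGrading.induction with
    | zero => simp
    | hom x m hm =>
      rw [charScale_apply _ hm, charScale_apply _ (N.smul_mem ha hm), ← ofAdd_neg, hρ _ _ a ha,
        smul_smul_smul_comm, smul_eq_mul, ← AddChar.map_add_eq_mul, Prod.snd_add]
      congr 2
      ring
    | add x y hx hy => simp only [map_add, smul_add, hx, hy]
  | add a b ha hb => simp only [add_smul, map_add, ha, hb]

theorem charScale_mem {N : GradedModFP 𝒜} (g : ZMod p) {n : G} {m : N.carrier}
    (hm : m ∈ ⨆ x, ⨆ _ : AddMonoidHom.fst G (ZMod p) x = n, N.comp x) :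
    charScale χ N g m ∈ ⨆ x, ⨆ _ : AddMonoidHom.fst G (ZMod p) x = n, N.comp x := by
  induction hm using Submodule.iSup_induction' with
  | mem x m hm =>
    rcases eq_or_ne (AddMonoidHom.fst G (ZMod p) x) n with rfl | hx
    · rw [iSup_pos rfl] at hm
      rw [charScale_apply _ hm]
      exact Submodule.smul_mem _ _ (IsGrading.mem_coarsen _ hm)
    · rw [iSup_neg hx, Submodule.mem_bot] at hm
      rw [hm, map_zero]
      exact zero_mem _
  | zero => rw [map_zero]; exact zero_mem _
  | add x y _ _ hx hy => rw [map_add]; exact add_mem hx hy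

/-- The coarsening of a graded module is equivariant under twisting, the group acting on the
component of degree `(n, j)` through the character of index `-j`. -/
noncomputable def coarsenEquivariant (hq : IsCoarsening 𝒜 𝒜' (AddMonoidHom.fst G (ZMod p)))
    (hρ : ∀ (g : ZMod p) (x : G × ZMod p), ∀ a ∈ 𝒜 x, (ρ (.ofAdd g)).1 a = χ (g * x.2) • a) :
    GradedModFP 𝒜 ⥤ (twistAction ρ).EquivariantObject where
  obj N :=
    { obj := coarsenObj hq N
      α := fun g =>
        { hom := Hom.mk (Y := (twist (ρ g⁻¹)).obj (coarsenObj hq N))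
            { toFun := charScale χ N g.toAdd
              map_add' := map_add _
              map_smul' := fun a m => charScale_smul hq hρ g.toAdd a m }
            fun hm => charScale_mem g.toAdd hm
          inv := Hom.mk (X := (twist (ρ g⁻¹)).obj (coarsenObj hq N)) (Y := coarsenObj hq N)
            { toFun := charScale χ N (-g.toAdd)
              map_add' := map_add (charScale χ N (-g.toAdd))
              map_smul' := fun a m => by
                have e := charScale_smul (N := N) hq hρ (-g.toAdd) ((ρ g⁻¹).1 a) m
                rw [← ofAdd_neg, neg_neg, ofAdd_toAdd] at e
                refine e.trans (congrArg (· • _) ?_)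
                rw [map_inv]
                exact (ρ g).1.apply_symm_apply a }
            fun hm => charScale_mem (-g.toAdd) hm
          hom_inv_id := hom_ext <| LinearMap.ext fun m =>
            (charScale_add (χ := χ) g.toAdd (-g.toAdd) m).symm.trans <| by
              rw [add_neg_cancel]; exact charScale_zero (N := N) m
          inv_hom_id := hom_ext <| LinearMap.ext fun m =>
            (charScale_add (χ := χ) (-g.toAdd) g.toAdd m).symm.trans <| by
              rw [neg_add_cancel]; exact charScale_zero (N := N) m }
      rel := fun g h => hom_ext <| LinearMap.ext fun m =>
        charScale_add (N := N) (χ := χ) g.toAdd h.toAdd m }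
  map {N N'} f :=
    { hom := Hom.mk (X := coarsenObj hq N) (Y := coarsenObj hq N') f.toLinearMap fun {n m} hm => by
        change m ∈ ⨆ x, ⨆ _ : AddMonoidHom.fst G (ZMod p) x = n, N.comp x at hm
        change _ ∈ ⨆ x, ⨆ _ : AddMonoidHom.fst G (ZMod p) x = n, N'.comp x
        have : (⨆ x, ⨆ _ : AddMonoidHom.fst G (ZMod p) x = n, N.comp x) ≤
            (⨆ x, ⨆ _ : AddMonoidHom.fst G (ZMod p) x = n, N'.comp x).comap (Hom.kLinearMap f) :=
          iSup₂_le fun x hx m hm => Submodule.mem_iSup_of_mem x (Submodule.mem_iSup_of_mem hx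
            (f.map_mem hm))
        exact this hm
      comm := fun g => hom_ext <| LinearMap.ext fun m => charScale_map (χ := χ) f g.toAdd m }
  map_id _ := rfl
  map_comp _ _ := rfl

variable (hq : IsCoarsening 𝒜 𝒜' (AddMonoidHom.fst G (ZMod p)))
  (hρ : ∀ (g : ZMod p) (x : G × ZMod p), ∀ a ∈ 𝒜 x, (ρ (.ofAdd g)).1 a = χ (g * x.2) • a)

instance faithful_coarsenEquivariant : (coarsenEquivariant hq hρ).Faithful where
  map_injective {N N'} _ _ h := hom_ext <|
    congrArg (fun t : (coarsenEquivariant hq hρ).obj N ⟶ (coarsenEquivariant hq hρ).obj N' =>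
      Hom.toLinearMap (CatAction.EquivariantObject.Hom.hom t)) h

theorem full_coarsenEquivariant (hχ : χ.IsPrimitive) : (coarsenEquivariant hq hρ).Full where
  map_surjective {N N'} θ := by
    let t : N.carrier →ₗ[A] N'.carrier := (CatAction.EquivariantObject.Hom.hom θ).toLinearMap
    have hcomm (g : ZMod p) (m) : charScale χ N' g (t m) = t (charScale χ N g m) :=
      DFunLike.congr_fun (congrArg Hom.toLinearMap (θ.comm (.ofAdd g))) m
    have hcoarse (x) (m) (hm : m ∈ N.comp x) :
        t m ∈ ⨆ y, ⨆ _ : AddMonoidHom.fst G (ZMod p) y = x.1, N'.comp y :=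
      (CatAction.EquivariantObject.Hom.hom θ).map_mem (g := x.1)
        (IsGrading.mem_coarsen (AddMonoidHom.fst G (ZMod p)) hm)
    refine ⟨⟨t, fun {x m} hm => ?_⟩, rfl⟩
    rw [N'.isGrading.mem_iff]
    rintro ⟨n, j⟩ hy
    by_cases hn : n = x.1
    · have hj : j - x.2 ≠ 0 := fun h => hy (Prod.ext hn (sub_eq_zero.1 h))
      -- The two components belong to different characters, so some group element separates them.
      obtain ⟨g, hg⟩ := AddChar.ne_one_iff.1 (hχ hj)
      rw [AddChar.mulShift_apply] at hg
      have e1 : charScale χ N' g (t m) = χ (-(g * x.2)) • t m := by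
        rw [hcomm, charScale_apply _ hm]
        exact (t.restrictScalars k).map_smul _ _
      have e2 : N'.proj (n, j) (charScale χ N' g (t m)) =
          χ (-(g * j)) • N'.proj (n, j) (t m) := by
        rw [← N'.isGrading.map_proj N'.isGrading (charScale χ N' g) (fun y m hm => by
          rw [charScale_apply _ hm]
          exact Submodule.smul_mem _ _ hm), charScale_apply _ (N'.isGrading.proj_mem _ _)]
      rw [e1, map_smul, ← sub_eq_zero, ← sub_smul, smul_eq_zero] at e2
      refine e2.resolve_left fun h => hg ?_
      rw [sub_eq_zero] at h
      have h' : χ (-(g * x.2)) * χ (g * j) = χ (-(g * j)) * χ (g * j) := by rw [h]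
      rw [← AddChar.map_add_eq_mul, ← AddChar.map_add_eq_mul, neg_add_cancel,
        AddChar.map_zero_eq_one] at h'
      rw [← h']
      congr 1
      ring
    · exact N'.isGrading.mem_biSup_iff.1 (hcoarse x m hm) (n, j) hn

/-- An equivariant module is the direct sum of its eigenspaces for the characters of the group, and
these refine the grading. -/
theorem essSurj_coarsenEquivariant (hχ : χ.IsPrimitive) (hp : (p : k) ≠ 0) :
    (coarsenEquivariant hq hρ).EssSurj where
  mem_essImage Y := by
    have hsum (j : ZMod p) : ∑ g, χ (g * j) = if j = 0 then (p : k) else 0 := by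
      rw [AddChar.sum_mulShift j hχ, ZMod.card]
      split_ifs <;> simp
    have hM := Y.obj.isGrading
    have : Module.Finite A Y.obj.carrier := Y.obj.finite
    let T (g : ZMod p) : Y.obj.carrier →ₗ[k] Y.obj.carrier :=
      Hom.kLinearMap (X := Y.obj) (Y := (twist (ρ (.ofAdd g)⁻¹)).obj Y.obj) (Y.α (.ofAdd g)).hom
    have hT_smul (g) (a : A) (m) : T g (a • m) = (ρ (.ofAdd g)⁻¹).1 a • T g m :=
      (Hom.toLinearMap (X := Y.obj) (Y := (twist (ρ (.ofAdd g)⁻¹)).obj Y.obj)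
        (Y.α (.ofAdd g)).hom).map_smul a m
    have hT_mem (g) {n} {m} (hm : m ∈ Y.obj.comp n) : T g m ∈ Y.obj.comp n :=
      Hom.map_mem (X := Y.obj) (Y := (twist (ρ (.ofAdd g)⁻¹)).obj Y.obj) (Y.α (.ofAdd g)).hom hm
    have hT_add (g h) (m) : T (g + h) m = T h (T g m) :=
      DFunLike.congr_fun (congrArg Hom.toLinearMap (Y.rel (.ofAdd g) (.ofAdd h))) m
    have hT_zero (m) : T 0 m = m := by
      have hinj : Function.Injective (T 0) := by
        refine Function.LeftInverse.injective (g := fun m =>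
          Hom.toLinearMap (X := (twist (ρ (.ofAdd (0 : ZMod p))⁻¹)).obj Y.obj) (Y := Y.obj)
            (Y.α (.ofAdd (0 : ZMod p))).inv m) ?_
        exact fun m => DFunLike.congr_fun
          (congrArg Hom.toLinearMap (Y.α (.ofAdd (0 : ZMod p))).hom_inv_id) m
      apply hinj
      rw [← hT_add, add_zero]
    -- The eigenspaces, and the projections onto them.
    let E (j : ZMod p) : Submodule k Y.obj.carrier :=
      ⨅ g, LinearMap.ker (T g - χ (-(g * j)) • LinearMap.id)
    have hE {j m} : m ∈ E j ↔ ∀ g, T g m = χ (-(g * j)) • m := by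
      simp only [E, Submodule.mem_iInf, LinearMap.mem_ker, LinearMap.sub_apply,
        LinearMap.smul_apply, LinearMap.id_apply, sub_eq_zero]
    let P (j : ZMod p) : Y.obj.carrier →ₗ[k] Y.obj.carrier :=
      (p : k)⁻¹ • ∑ g, χ (g * j) • T g
    have hP (j m) : P j m = (p : k)⁻¹ • ∑ g, χ (g * j) • T g m := by
      simp only [P, LinearMap.smul_apply, LinearMap.sum_apply]
    have hPE (j i m) (hm : m ∈ E i) : P j m = if j = i then m else 0 := by
      rw [hP]
      have : ∑ g, χ (g * j) • T g m = (∑ g, χ (g * (j - i))) • m := by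
        rw [Finset.sum_smul]
        refine Finset.sum_congr rfl fun g _ => ?_
        rw [hE.1 hm, smul_smul, ← AddChar.map_add_eq_mul]
        congr 2
        ring
      rw [this, hsum]
      simp only [sub_eq_zero]
      split_ifs
      · rw [smul_smul, inv_mul_cancel₀ hp, one_smul]
      · simp
    have hPmem (j m) : P j m ∈ E j := by
      refine hE.2 fun h => ?_
      rw [hP, map_smul, map_sum]
      conv_rhs => rw [smul_comm, Finset.smul_sum]
      refine congrArg _ ?_
      refine Fintype.sum_equiv (Equiv.addRight h) _ _ fun g => ?_
      rw [Equiv.coe_addRight, map_smul, ← hT_add, smul_smul, ← AddChar.map_add_eq_mul]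
      congr 2
      ring
    have hPcomp (j n m) (hm : m ∈ Y.obj.comp n) : P j m ∈ Y.obj.comp n := by
      rw [hP]
      exact Submodule.smul_mem _ _ (Submodule.sum_mem _ fun g _ =>
        Submodule.smul_mem _ _ (hT_mem g hm))
    have hPsum (m) : ∑ j, P j m = m := by
      simp only [hP]
      rw [← Finset.smul_sum, Finset.sum_comm]
      have e : ∑ g, ∑ j, χ (g * j) • T g m = ∑ g : ZMod p, if g = 0 then (p : k) • m else 0 := by
        refine Finset.sum_congr rfl fun g _ => ?_
        rw [← Finset.sum_smul]
        simp only [mul_comm g]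
        rw [hsum]
        split_ifs with h
        · rw [h, hT_zero]
        · rw [zero_smul]
      rw [e, Finset.sum_ite_eq' Finset.univ 0, if_pos (Finset.mem_univ _), smul_smul,
        inv_mul_cancel₀ hp, one_smul]
    have hgr : IsGrading fun x : G × ZMod p => Y.obj.comp x.1 ⊓ E x.2 := by
      refine IsGrading.of_proj (fun x => P x.2 ∘ₗ Y.obj.proj x.1) ?_ ?_ (top_unique fun m hm => ?_)
      · rintro x m ⟨h1, h2⟩
        rw [LinearMap.comp_apply, Y.obj.isGrading.proj_same h1, hPE _ _ m h2, if_pos rfl]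
      · rintro x y hxy m ⟨h1, h2⟩
        rw [LinearMap.comp_apply]
        by_cases h : x.1 = y.1
        · rw [← h, Y.obj.isGrading.proj_same h1, hPE _ _ m h2,
            if_neg fun h' => hxy (Prod.ext h h'.symm)]
        · rw [Y.obj.isGrading.proj_ne h1 h, map_zero]
      · clear hm
        induction m using Y.obj.isGrading.induction with
        | zero => exact zero_mem _
        | hom n m hm =>
          rw [← hPsum m]
          exact Submodule.sum_mem _ fun j _ => Submodule.mem_iSup_of_mem (n, j)
            ⟨hPcomp j n m hm, hPmem j m⟩
        | add x y hx hy => exact add_mem hx hy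
    let N : GradedModFP 𝒜 :=
      { carrier := Y.obj.carrier
        comp := fun x => Y.obj.comp x.1 ⊓ E x.2
        indep := hgr.indep
        iSup_comp := hgr.iSup_eq
        smul_mem := by
          rintro x y a m ha ⟨h1, h2⟩
          refine ⟨Y.obj.smul_mem (hq.mem ha) h1, hE.2 fun g => ?_⟩
          rw [hT_smul, hE.1 h2, ← ofAdd_neg, hρ _ _ a ha, smul_smul_smul_comm,
            smul_eq_mul, ← AddChar.map_add_eq_mul, Prod.snd_add]
          congr 2
          ring
        finitePresentation := Y.obj.finitePresentation }
    let f : coarsenObj hq N ⟶ Y.obj :=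
      Hom.mk (X := coarsenObj hq N) (Y := Y.obj) (LinearMap.id (M := Y.obj.carrier))
        fun {n m} hm => by
          have : (⨆ x, ⨆ _ : AddMonoidHom.fst G (ZMod p) x = n, N.comp x) ≤ Y.obj.comp n :=
            iSup₂_le fun x hx m hm => by
              obtain ⟨h1, -⟩ := hm
              rwa [← hx]
          exact this hm
    have hscale (g) (m) : T g m = charScale χ N g m := by
      induction m using hgr.induction with
      | zero => exact (map_zero _).trans (map_zero (charScale χ N g)).symm
      | hom x m hm => exact (hE.1 hm.2 g).trans (charScale_apply (N := N) g hm).symm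
      | add x y hx hy =>
        exact (map_add _ _ _).trans ((congrArg₂ _ hx hy).trans (map_add (charScale χ N g) x y).symm)
    let e : (coarsenEquivariant hq hρ).obj N ⟶ Y :=
      { hom := f
        comm := fun g => hom_ext (LinearMap.ext fun m => hscale g.toAdd m) }
    have : IsIso (CatAction.EquivariantObject.Hom.hom e) :=
      (isoOfBijective f Function.bijective_id).isIso_hom
    have := CatAction.EquivariantObject.isIso_of_isIso_hom e
    exact ⟨N, ⟨asIso e⟩⟩

/-- If `ZMod p` acts on `A` through the characters given by a refinement of the grading, and `k`
contains a primitive `p`-th root of unity, then the equivariantization of `qmod-A` under twisting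
is the category `qmod` for the refined grading. -/
theorem nonempty_qmod_equivalence_twist (hq : IsCoarsening 𝒜 𝒜' (AddMonoidHom.fst G (ZMod p)))
    (hρ : ∀ (g : ZMod p) (x : G × ZMod p), ∀ a ∈ 𝒜 x, (ρ (.ofAdd g)).1 a = χ (g * x.2) • a)
    (hχ : χ.IsPrimitive) (hp : (p : k) ≠ 0)
    {δ : G × ZMod p →+ ℤ} (hA : PositivelyGraded 𝒜 δ) {δ' : G →+ ℤ}
    (hA' : PositivelyGraded 𝒜' δ') :
    Nonempty (QMod 𝒜 ≌ (qmodTwistAction ρ).EquivariantObject) := by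
  have := hasRightCalculusOfFractions hA
  have := hasRightCalculusOfFractions hA'
  have := full_coarsenEquivariant hq hρ hχ
  have := essSurj_coarsenEquivariant hq hρ hχ hp
  have : (coarsenEquivariant hq hρ).IsEquivalence := { }
  exact CatAction.nonempty_localization_equivalence_equivariantObject
    (Φ := twistAction ρ) (W := isoModFD 𝒜')
    (truncation hA' (twistAction ρ) (fun h n X => isoOfBijective
      (X := (twist (ρ h⁻¹)).obj ((trunc hA' n).obj X))
      (Y := (trunc hA' n).obj ((twist (ρ h⁻¹)).obj X))
      ⟨{ toFun := fun x => ⟨x.1, x.2⟩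
         map_add' := fun _ _ => rfl
         map_smul' := fun _ _ => rfl }, fun hx => hx⟩
      ⟨fun x y hxy => Subtype.ext (congrArg (Submodule.subtype
        (truncSub hA' n ((twist (ρ h⁻¹)).obj X))) hxy), fun y => ⟨⟨y.1, y.2⟩, rfl⟩⟩)
      fun h n X => rfl)
    (fun _ _ f _ => isoModFD_of_isIso f) (twistAction_isoModFD ρ) (isoModFD 𝒜)
    (coarsenEquivariant hq hρ) (fun _ _ f => Iff.rfl)

end GradedModFP

end Twist

/-! ### Gradings of quotients of polynomial rings -/

section QuotientGrading

variable {k : Type u} [Field k] {ι : Type} {G : Type w} [AddCommGroup G]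
  {I : Ideal (MvPolynomial ι k)} {deg : ι → G}

open MvPolynomial

theorem isGrading_weightedHomogeneousSubmodule (deg : ι → G) :
    IsGrading (weightedHomogeneousSubmodule k deg) := by
  classical
  refine IsGrading.of_proj (weightedHomogeneousComponent deg) ?_ ?_ (top_unique fun x _ => ?_)
  · intro g x hx
    exact weightedHomogeneousComponent_eq_self hx
  · intro g g' hg x hx
    exact hx.weightedHomogeneousComponent_ne g' hg.symm
  · rw [← MvPolynomial.support_sum_monomial_coeff x]
    exact Submodule.sum_mem _ fun d _ => Submodule.mem_iSup_of_mem (Finsupp.weight deg d)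
      (isWeightedHomogeneous_monomial deg d _ rfl)

theorem proj_weightedHomogeneousSubmodule (deg : ι → G) (g : G) (x : MvPolynomial ι k) :
    (isGrading_weightedHomogeneousSubmodule deg).proj g x =
      weightedHomogeneousComponent deg g x := by
  classical
  induction x using (isGrading_weightedHomogeneousSubmodule (k := k) deg).induction with
  | zero => simp
  | hom g' x hx =>
    by_cases hg : g' = g
    · subst hg
      rw [IsGrading.proj_same _ hx, weightedHomogeneousComponent_eq_self hx]
    · rw [IsGrading.proj_ne _ hx hg, IsWeightedHomogeneous.weightedHomogeneousComponent_ne g hx (Ne.symm hg)]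
  | add x y hx hy => rw [map_add, map_add, hx, hy]

variable (I deg) in
/-- The ideal `I` is generated by weighted homogeneous polynomials. -/
def IsSpannedByHomogeneous : Prop :=
  ∃ S : Set (MvPolynomial ι k), I = Ideal.span S ∧
    ∀ f ∈ S, ∃ g, IsWeightedHomogeneous deg f g

theorem isGrading_quotientGrading (hI : IsSpannedByHomogeneous I deg) :
    IsGrading (quotientGrading I deg) := by
  classical
  obtain ⟨S, rfl, hS⟩ := hI
  refine (isGrading_weightedHomogeneousSubmodule deg).map_of_surjective
    (Ideal.Quotient.mkₐ k (Ideal.span S)).toLinearMap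
    (Ideal.Quotient.mkₐ_surjective k _) fun g x hx => ?_
  have hx : x ∈ Ideal.span S := Ideal.Quotient.eq_zero_iff_mem.1 hx
  refine Ideal.Quotient.eq_zero_iff_mem.2 ?_
  rw [proj_weightedHomogeneousSubmodule]
  let := weightedGradedAlgebra k deg
  have h := Ideal.homogeneous_span (weightedHomogeneousSubmodule k deg) S hS
  exact weightedHomogeneousComponent_mem_of_mem k deg h hx g

theorem mk_mem_quotientGrading {f : MvPolynomial ι k} {g : G}
    (hf : IsWeightedHomogeneous deg f g) : Ideal.Quotient.mk I f ∈ quotientGrading I deg g :=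
  ⟨f, hf, rfl⟩

theorem mk_X_mem_quotientGrading (i : ι) :
    Ideal.Quotient.mk I (X i) ∈ quotientGrading I deg (deg i) :=
  mk_mem_quotientGrading (isWeightedHomogeneous_X k deg i)

theorem mk_monomial_mem_quotientGrading (d : ι →₀ ℕ) (c : k) :
    Ideal.Quotient.mk I (monomial d c) ∈ quotientGrading I deg (Finsupp.weight deg d) :=
  mk_mem_quotientGrading (isWeightedHomogeneous_monomial deg d _ rfl)

theorem quotientGrading_mul_mem (g g' : G) (a) (ha : a ∈ quotientGrading I deg g) (b)
    (hb : b ∈ quotientGrading I deg g') : a * b ∈ quotientGrading I deg (g + g') := by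
  obtain ⟨a, ha, rfl⟩ := ha
  obtain ⟨b, hb, rfl⟩ := hb
  exact ⟨a * b, IsWeightedHomogeneous.mul ha hb, rfl⟩

theorem quotientGrading_one_mem : (1 : MvPolynomial ι k ⧸ I) ∈ quotientGrading I deg 0 :=
  ⟨1, isWeightedHomogeneous_one k deg, rfl⟩

/-- A homogeneous component is spanned by the monomials of that degree. -/
theorem quotientGrading_le {g : G} {P : Submodule k (MvPolynomial ι k ⧸ I)}
    (hP : ∀ d, Finsupp.weight deg d = g → Ideal.Quotient.mk I (monomial d 1) ∈ P) :
    quotientGrading I deg g ≤ P := by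
  rintro _ ⟨f, hf, rfl⟩
  change Ideal.Quotient.mk I f ∈ P
  rw [← MvPolynomial.support_sum_monomial_coeff f, map_sum]
  refine Submodule.sum_mem _ fun d hd => ?_
  have := P.smul_mem (f.coeff d) (hP d (hf (mem_support_iff.1 hd)))
  convert this using 1
  rw [← mul_one (coeff d f), ← smul_eq_mul, ← smul_monomial]
  simp only [smul_eq_mul, mul_one]
  rfl

theorem positivelyGraded_quotientGrading [Finite ι] (hI : IsSpannedByHomogeneous I deg)
    (δ : G →+ ℤ) (hδ : ∀ i, 0 < δ (deg i)) : PositivelyGraded (quotientGrading I deg) δ := by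
  classical
  have := Fintype.ofFinite ι
  have hw (d : ι →₀ ℕ) : δ (Finsupp.weight deg d) = ∑ i, d i * δ (deg i) := by
    rw [Finsupp.weight_eq_sum, map_sum]
    simp
  refine ⟨isGrading_quotientGrading hI, fun g hg => bot_unique (quotientGrading_le fun d hd => ?_),
    fun n => ?_⟩
  · rw [← hd, hw] at hg
    exact absurd hg (not_lt.2 (Finset.sum_nonneg fun i _ =>
      mul_nonneg (Int.natCast_nonneg _) (hδ i).le))
  · let T : Set (ι →₀ ℕ) := {d | ∀ i, (d i : ℤ) < n}
    have hT : T.Finite := by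
      refine ((Set.finite_Iic fun _ : ι => n.toNat).preimage
        (DFunLike.coe_injective (F := ι →₀ ℕ)).injOn).subset fun d hd i => ?_
      have := hd i
      change d i ≤ n.toNat
      omega
    have hle : (⨆ g, ⨆ _ : δ g < n, quotientGrading I deg g) ≤
        Submodule.span k ((fun d => Ideal.Quotient.mk I (monomial d 1)) '' T) := by
      refine iSup₂_le fun g hg => quotientGrading_le fun d hd => Submodule.subset_span ⟨d, ?_, rfl⟩
      intro i
      refine lt_of_le_of_lt ?_ hg
      rw [← hd, hw]
      refine le_trans (le_mul_of_one_le_right (Int.natCast_nonneg _) (hδ i)) ?_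
      exact Finset.single_le_sum (f := fun i => (d i : ℤ) * δ (deg i)) (fun i _ =>
        mul_nonneg (Int.natCast_nonneg _) (hδ i).le) (Finset.mem_univ i)
    have : FiniteDimensional k (Submodule.span k
      ((fun d => Ideal.Quotient.mk I (monomial d (1 : k))) '' T)) :=
      FiniteDimensional.span_of_finite k (hT.image _)
    exact Submodule.finiteDimensional_of_le hle

theorem IsSpannedByHomogeneous.comp {G' : Type w'} [AddCommGroup G']
    (hI : IsSpannedByHomogeneous I deg) (q : G →+ G') : IsSpannedByHomogeneous I (q ∘ deg) := by
  obtain ⟨S, hS, h⟩ := hI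
  refine ⟨S, hS, fun f hf => ?_⟩
  obtain ⟨g, hg⟩ := h f hf
  refine ⟨q g, fun d hd => ?_⟩
  rw [← hg hd, Finsupp.weight_apply, Finsupp.weight_apply, Finsupp.sum, Finsupp.sum, map_sum]
  simp

theorem weight_comp {G' : Type w'} [AddCommGroup G'] (deg : ι → G) (q : G →+ G') (d : ι →₀ ℕ) :
    Finsupp.weight (q ∘ deg) d = q (Finsupp.weight deg d) := by
  rw [Finsupp.weight_apply, Finsupp.weight_apply, Finsupp.sum, Finsupp.sum, map_sum]
  simp

theorem isCoarsening_quotientGrading {G' : Type w'} [AddCommGroup G']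
    (hI : IsSpannedByHomogeneous I deg) {q : G →+ G'} (hq : Function.Surjective q) :
    IsCoarsening (quotientGrading I deg) (quotientGrading I (q ∘ deg)) q where
  isGrading := isGrading_quotientGrading hI
  mul_mem := quotientGrading_mul_mem
  one_mem := quotientGrading_one_mem
  surjective := hq
  eq_iSup g' := by
    refine le_antisymm (quotientGrading_le fun d hd => ?_) (iSup₂_le fun g hg => ?_)
    · rw [weight_comp] at hd
      exact Submodule.mem_iSup_of_mem _ (Submodule.mem_iSup_of_mem hd
        (mk_monomial_mem_quotientGrading d 1))
    · refine quotientGrading_le fun d hd => ?_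
      have := mk_monomial_mem_quotientGrading (I := I) (deg := q ∘ deg) d (1 : k)
      rwa [weight_comp, hd, hg] at this

/-- Finite-dimensionality of a quotient of `k[X_i]/I` by an ideal containing powers of all the
variables. -/
theorem finiteDimensional_quotient_of_pow_mem [Finite ι] (J : Ideal (MvPolynomial ι k ⧸ I))
    (hJ : ∀ i, ∃ n : ℕ, Ideal.Quotient.mk I (X i) ^ n ∈ J) :
    FiniteDimensional k ((MvPolynomial ι k ⧸ I) ⧸ J.restrictScalars k) := by
  classical
  have := Fintype.ofFinite ι
  choose n hn using hJ
  rw [finiteDimensional_quotient_iff]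
  let T : Set (ι →₀ ℕ) := {d | ∀ i, d i < n i}
  have hT : T.Finite := by
    refine ((Set.finite_Iic n).preimage
      (DFunLike.coe_injective (F := ι →₀ ℕ)).injOn).subset fun d hd i => (hd i).le
  have hfin : FiniteDimensional k (Submodule.span k
      ((fun d => Ideal.Quotient.mk I (monomial d (1 : k))) '' T)) :=
    FiniteDimensional.span_of_finite k (hT.image _)
  refine ⟨_, hfin, top_unique fun x hx => ?_⟩
  clear hx
  obtain ⟨f, rfl⟩ := Ideal.Quotient.mk_surjective x
  induction f using MvPolynomial.induction_on' with
  | monomial d a =>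
    have e : Ideal.Quotient.mk I (monomial d a) = a • Ideal.Quotient.mk I (monomial d 1) := by
      change _ = Ideal.Quotient.mk I (a • monomial d 1)
      rw [smul_monomial, smul_eq_mul, mul_one]
    rw [e]
    refine Submodule.smul_mem _ _ ?_
    by_cases hd : d ∈ T
    · exact Submodule.mem_sup_left (Submodule.subset_span ⟨d, hd, rfl⟩)
    · refine Submodule.mem_sup_right ?_
      obtain ⟨i, hi⟩ : ∃ i, n i ≤ d i := by
        by_contra! h
        exact hd h
      have e' : monomial d (1 : k) = X i ^ n i * monomial (d - Finsupp.single i (n i)) 1 := by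
        rw [X_pow_eq_monomial, monomial_mul, one_mul, add_tsub_cancel_of_le]
        simpa using hi
      rw [e', map_mul, map_pow]
      exact J.mul_mem_right _ (hn i)
  | add f g hf hg => rw [map_add]; exact add_mem hf hg

end QuotientGrading

section Veronese

variable {k A B : Type u} [Field k] [CommRing A] [Algebra k A] [CommRing B] [Algebra k B]
  [Algebra B A] {G : Type w} {H : Type w'} {G' H' : Type*} [AddCommGroup G] [AddCommGroup G']
  [AddCommGroup H] [AddCommGroup H']

/-- The Veronese property passes to coarser gradings, provided that the coarsening of the larger
algebra only identifies degrees which differ by degrees of the smaller one. -/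
theorem IsVeronese.coarsen {𝒜 : G → Submodule k A} {𝒜' : G' → Submodule k A}
    {ℬ : H → Submodule k B} {ℬ' : H' → Submodule k B} {φ : H →+ G} {φ' : H' →+ G'} {q : G →+ G'}
    {r : H →+ H'} (hV : IsVeronese 𝒜 ℬ φ) (hq : IsCoarsening 𝒜 𝒜' q) (hr : IsCoarsening ℬ ℬ' r)
    (hφ' : Function.Injective φ') (hφ : ∀ h, φ' (r h) = q (φ h))
    (hker : ∀ g, q g = 0 → ∃ h, φ h = g ∧ r h = 0) : IsVeronese 𝒜' ℬ' φ' where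
  isGrading := hq.isGrading'
  isGrading' := hr.isGrading'
  mul_mem := hq.mul_mem'
  one_mem := by
    rw [← map_zero q]
    exact hq.mem hq.one_mem
  injective := hφ'
  algebraMap_injective := hV.algebraMap_injective
  algebraMap_mem h b hb := by
    rw [hr.eq_iSup] at hb
    induction hb using Submodule.iSup_induction' with
    | mem h' b hb =>
      rcases eq_or_ne (r h') h with rfl | hh
      · rw [iSup_pos rfl] at hb
        rw [hφ]
        exact hq.mem (hV.algebraMap_mem _ _ hb)
      · rw [iSup_neg hh, Submodule.mem_bot] at hb
        rw [hb, map_zero]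
        exact zero_mem _
    | zero => rw [map_zero]; exact zero_mem _
    | add a b _ _ ha hb => rw [map_add]; exact add_mem ha hb
  exists_algebraMap h a ha := by
    rw [hq.eq_iSup] at ha
    induction ha using Submodule.iSup_induction' with
    | mem g a ha =>
      rcases eq_or_ne (q g) (φ' h) with hg | hg
      · rw [iSup_pos hg] at ha
        obtain ⟨h₁, rfl⟩ := hr.surjective h
        obtain ⟨h₂, h2, h2'⟩ := hker (g - φ h₁) (by rw [map_sub, hg, hφ, sub_self])
        obtain rfl : g = φ (h₂ + h₁) := by rw [map_add, h2, sub_add_cancel]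
        obtain ⟨b, hb, rfl⟩ := hV.exists_algebraMap _ _ ha
        refine ⟨b, ?_, rfl⟩
        have := hr.mem hb
        rwa [map_add, h2', zero_add] at this
      · rw [iSup_neg hg, Submodule.mem_bot] at ha
        exact ⟨0, zero_mem _, by rw [ha, map_zero]⟩
    | zero => exact ⟨0, zero_mem _, map_zero _⟩
    | add a b _ _ ha hb =>
      obtain ⟨x, hx, rfl⟩ := ha
      obtain ⟨y, hy, rfl⟩ := hb
      exact ⟨x + y, add_mem hx hy, map_add _ _ _⟩
  finite := hV.finite
  cofinite g' := by
    obtain ⟨g, rfl⟩ := hq.surjective g'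
    have := hV.cofinite g
    obtain ⟨V, hV1, hV2⟩ := finiteDimensional_quotient_iff.1 this
    refine finiteDimensional_quotient_iff.2 ⟨V, hV1, top_unique (hV2.symm.le.trans ?_)⟩
    refine sup_le_sup_left (Ideal.span_mono ?_) V
    refine Set.iUnion_subset fun h a ha => Set.mem_iUnion.2 ⟨r h, ?_⟩
    rw [hφ, ← map_add]
    exact hq.mem ha

end Veronese

/-! ### The string group -/

namespace WeightedProjectiveLine

variable {k : Type u} [Field k] (X : WeightedProjectiveLine k)

theorem smul_gen_eq (i j : Fin X.t) : X.p i • X.gen i = X.p j • X.gen j := by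
  have h : (QuotientAddGroup.mk (Pi.single i (X.p i : ℤ)) : X.StringGroup) =
      QuotientAddGroup.mk (Pi.single j (X.p j : ℤ)) := by
    rw [QuotientAddGroup.eq]
    refine AddSubgroup.subset_closure ⟨j, i, ?_⟩
    abel
  have e (i : Fin X.t) : X.p i • X.gen i =
      (QuotientAddGroup.mk (Pi.single i (X.p i : ℤ)) : X.StringGroup) := by
    unfold gen
    rw [← QuotientAddGroup.mk_nsmul, ← Pi.single_smul]
    simp
  rw [e, e, h]

theorem smul_gen (i : Fin X.t) : X.p i • X.gen i = X.canonical := X.smul_gen_eq _ _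

theorem exists_eq_sum_gen (x : X.StringGroup) : ∃ n : Fin X.t → ℤ, x = ∑ i, n i • X.gen i := by
  obtain ⟨n, rfl⟩ := QuotientAddGroup.mk_surjective x
  refine ⟨n, ?_⟩
  conv_lhs => rw [← Finset.univ_sum_single n]
  rw [QuotientAddGroup.mk_sum]
  refine Finset.sum_congr rfl fun i _ => ?_
  unfold gen
  rw [← QuotientAddGroup.mk_zsmul, ← Pi.single_smul]
  simp

/-- The homomorphism from the string group with given values on the generators. -/
noncomputable def liftHom {M : Type*} [AddCommGroup M] (m : Fin X.t → M) (c : M)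
    (hm : ∀ i, X.p i • m i = c) : X.StringGroup →+ M :=
  QuotientAddGroup.lift _ (∑ i, (zmultiplesHom M (m i)).comp (Pi.evalAddMonoidHom _ i)) (by
    rw [AddSubgroup.closure_le]
    rintro _ ⟨i, j, rfl⟩
    change (∑ i, (zmultiplesHom M (m i)).comp (Pi.evalAddMonoidHom _ i)) _ = 0
    rw [AddMonoidHom.finsetSum_apply]
    simp only [AddMonoidHom.comp_apply, Pi.evalAddMonoidHom_apply, Pi.sub_apply,
      zmultiplesHom_apply, sub_smul, Finset.sum_sub_distrib]
    have e (i : Fin X.t) : ∑ l, (Pi.single i (X.p i : ℤ) : Fin X.t → ℤ) l • m l = c := by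
      rw [Finset.sum_eq_single i]
      · rw [Pi.single_eq_same, natCast_zsmul, hm]
      · intro l _ hl
        rw [Pi.single_eq_of_ne hl, zero_smul]
      · simp
    rw [e, e, sub_self])

theorem liftHom_gen {M : Type*} [AddCommGroup M] (m : Fin X.t → M) (c : M)
    (hm : ∀ i, X.p i • m i = c) (i : Fin X.t) : X.liftHom m c hm (X.gen i) = m i := by
  change (∑ i, (zmultiplesHom M (m i)).comp (Pi.evalAddMonoidHom _ i)) _ = _
  rw [AddMonoidHom.finsetSum_apply, Finset.sum_eq_single i]
  · simp
  · intro l _ hl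
    simp [Pi.single_eq_of_ne hl]
  · simp

theorem liftHom_canonical {M : Type*} [AddCommGroup M] (m : Fin X.t → M) (c : M)
    (hm : ∀ i, X.p i • m i = c) : X.liftHom m c hm X.canonical = c := by
  unfold canonical
  rw [map_nsmul, liftHom_gen, hm]

theorem liftHom_dualizing {M : Type*} [AddCommGroup M] (m : Fin X.t → M) (c : M)
    (hm : ∀ i, X.p i • m i = c) :
    X.liftHom m c hm X.dualizing = ((X.t : ℤ) - 2) • c - ∑ i, m i := by
  unfold dualizing
  rw [map_sub, map_zsmul, liftHom_canonical, map_sum]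
  simp only [liftHom_gen]

theorem dvd_lcmWeights (i : Fin X.t) : X.p i ∣ X.lcmWeights := by
  have h (l : List ℕ) (a : ℕ) (ha : a ∈ l) : a ∣ l.foldr Nat.lcm 1 := by
    induction l with
    | nil => simp at ha
    | cons b l ih =>
      rcases List.mem_cons.1 ha with rfl | ha
      · exact Nat.dvd_lcm_left _ _
      · exact (ih ha).trans (Nat.dvd_lcm_right _ _)
  exact h _ _ ((List.mem_ofFn' _ _).2 ⟨i, rfl⟩)

theorem lcmWeights_dvd {n : ℕ} (h : ∀ i, X.p i ∣ n) : X.lcmWeights ∣ n := by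
  have h' (l : List ℕ) (hl : ∀ a ∈ l, a ∣ n) : l.foldr Nat.lcm 1 ∣ n := by
    induction l with
    | nil => simp
    | cons b l ih =>
      exact Nat.lcm_dvd (hl b (by simp)) (ih fun a ha => hl a (by simp [ha]))
  refine h' _ fun a ha => ?_
  obtain ⟨i, rfl⟩ := (List.mem_ofFn' _ _).1 ha
  exact h i

theorem p_pos (i : Fin X.t) : 0 < X.p i := lt_of_lt_of_le two_pos (X.two_le i)

theorem lcmWeights_pos : 0 < X.lcmWeights := by
  refine Nat.pos_of_ne_zero fun h => ?_
  have := X.lcmWeights_dvd (n := ∏ i, X.p i) fun i => Finset.dvd_prod_of_mem _ (Finset.mem_univ i)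
  rw [h, zero_dvd_iff, Finset.prod_eq_zero_iff] at this
  obtain ⟨i, -, hi⟩ := this
  exact (X.p_pos i).ne' hi

/-- The degree homomorphism `L → ℤ`, `x_i ↦ p / p_i`. -/
noncomputable def degreeHom : X.StringGroup →+ ℤ :=
  X.liftHom (fun i => (X.lcmWeights / X.p i : ℕ)) X.lcmWeights fun i => by
    rw [nsmul_eq_mul, ← Nat.cast_mul, Nat.mul_div_cancel' (X.dvd_lcmWeights i)]

theorem degreeHom_gen (i : Fin X.t) : X.degreeHom (X.gen i) = (X.lcmWeights / X.p i : ℕ) :=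
  X.liftHom_gen _ _ _ i

theorem degreeHom_gen_pos (i : Fin X.t) : 0 < X.degreeHom (X.gen i) := by
  rw [degreeHom_gen]
  exact_mod_cast Nat.div_pos (Nat.le_of_dvd X.lcmWeights_pos (X.dvd_lcmWeights i)) (X.p_pos i)

theorem degreeHom_dualizing : X.degreeHom X.dualizing =
    ((X.t : ℤ) - 2) * X.lcmWeights - ∑ i, ((X.lcmWeights / X.p i : ℕ) : ℤ) :=
  X.liftHom_dualizing _ _ _

variable {X}

theorem IsTubular.degreeHom_dualizing_eq_zero (hX : X.IsTubular) :
    X.degreeHom X.dualizing = 0 := by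
  obtain ⟨n, hn, e⟩ := isOfFinAddOrder_iff_nsmul_eq_zero.1 hX
  have e' := congrArg X.degreeHom e
  rw [map_nsmul, map_zero, nsmul_eq_mul, mul_eq_zero] at e'
  exact e'.resolve_left (by exact_mod_cast hn.ne')

theorem IsTubular.sum_inv (hX : X.IsTubular) : ∑ i, (X.p i : ℚ)⁻¹ = X.t - 2 := by
  have h := hX.degreeHom_dualizing_eq_zero
  rw [degreeHom_dualizing, sub_eq_zero] at h
  have h' : ((X.t : ℚ) - 2) * X.lcmWeights = ∑ i, ((X.lcmWeights / X.p i : ℕ) : ℚ) := by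
    have h := congrArg (Int.cast : ℤ → ℚ) h
    push_cast at h
    exact h
  have hp : (X.lcmWeights : ℚ) ≠ 0 := by exact_mod_cast X.lcmWeights_pos.ne'
  rw [← mul_right_cancel_iff_of_pos (b := (X.lcmWeights : ℚ)) (by exact_mod_cast X.lcmWeights_pos),
    h', Finset.sum_mul]
  refine Finset.sum_congr rfl fun i _ => ?_
  rw [Nat.cast_div (X.dvd_lcmWeights i) (by exact_mod_cast (X.p_pos i).ne')]
  field_simp

theorem zsmul_sub_sum_eq_zero {M ι : Type*} [AddCommGroup M] [Fintype ι] {N n : ℤ} (d : ι → ℤ)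
    (x : ι → M) (c : M) (e : ∀ i, N • x i = d i • c) (h : n * N - ∑ i, d i = 0) :
    N • (n • c - ∑ i, x i) = 0 := by
  rw [smul_sub, Finset.smul_sum, smul_smul, Finset.sum_congr rfl fun i _ => e i,
    ← Finset.sum_smul, ← sub_smul, mul_comm, h, zero_smul]

theorem IsTubular.lcmWeights_smul_dualizing (hX : X.IsTubular) :
    X.lcmWeights • X.dualizing = 0 := by
  have h := hX.degreeHom_dualizing_eq_zero
  rw [degreeHom_dualizing] at h
  have e (i : Fin X.t) : (X.lcmWeights : ℤ) • X.gen i =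
      ((X.lcmWeights / X.p i : ℕ) : ℤ) • X.canonical := by
    rw [← X.smul_gen i, natCast_zsmul, natCast_zsmul, smul_smul,
      Nat.div_mul_cancel (X.dvd_lcmWeights i)]
  rw [← natCast_zsmul]
  exact zsmul_sub_sum_eq_zero _ _ _ e h

theorem dvd_of_smul_dualizing_eq_zero {m : ℤ} (h : m • X.dualizing = 0) :
    (X.lcmWeights : ℤ) ∣ m := by
  classical
  rw [← Int.dvd_natAbs, Int.natCast_dvd_natCast]
  refine X.lcmWeights_dvd fun i => ?_
  rw [← Int.natCast_dvd_natCast, Int.dvd_natAbs, ← ZMod.intCast_zmod_eq_zero_iff_dvd]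
  -- The character of `L` which is `1` on `x_i` and `0` on the other generators maps `ω` to `-1`.
  have hm (j : Fin X.t) : X.p j • (Pi.single i 1 : Fin X.t → ZMod (X.p i)) j = 0 := by
    rcases eq_or_ne j i with rfl | hj
    · simp
    · simp [Pi.single_eq_of_ne hj]
  have e := congrArg (X.liftHom _ 0 hm) h
  rw [map_zsmul, liftHom_dualizing, map_zero, smul_zero, zero_sub, Finset.sum_pi_single'] at e
  simpa using e

/-- The possible tubular weight sequences. -/
theorem IsTubular.classification (hX : X.IsTubular) :
    (∃ ht : X.t = 4, ∀ j, X.p (Fin.cast ht.symm j) = 2) ∨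
    ∃ ht : X.t = 3, (∀ j, X.p (Fin.cast ht.symm j) = ![3, 3, 3] j) ∨
      (∀ j, X.p (Fin.cast ht.symm j) = ![4, 4, 2] j) ∨
      (∀ j, X.p (Fin.cast ht.symm j) = ![6, 3, 2] j) := by
  have h := hX.sum_inv
  have hinv (i : Fin X.t) : (X.p i : ℚ)⁻¹ ≤ 2⁻¹ :=
    inv_anti₀ two_pos (by exact_mod_cast X.two_le i)
  have hpos (i : Fin X.t) : 0 < (X.p i : ℚ)⁻¹ := inv_pos.2 (by exact_mod_cast X.p_pos i)
  have h1 : ∑ i, (X.p i : ℚ)⁻¹ ≤ X.t * 2⁻¹ := by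
    refine (Finset.sum_le_card_nsmul _ _ _ fun i _ => hinv i).trans ?_
    simp
  have h2 : 0 < ∑ i, (X.p i : ℚ)⁻¹ :=
    Finset.sum_pos (fun i _ => hpos i) ⟨⟨0, X.t_pos⟩, Finset.mem_univ _⟩
  have ht2 : 2 < X.t := by
    have : (2 : ℚ) < X.t := by linarith
    exact_mod_cast this
  have ht4 : X.t ≤ 4 := by
    have : (X.t : ℚ) ≤ 4 := by linarith
    exact_mod_cast this
  have ht : X.t = 3 ∨ X.t = 4 := by omega
  rcases ht with ht | ht
  · refine Or.inr ⟨ht, ?_⟩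
    have hs : ∑ j : Fin 3, (X.p (Fin.cast ht.symm j) : ℚ)⁻¹ = 1 := by
      have e := Fintype.sum_equiv (finCongr ht.symm)
        (fun j => (X.p (Fin.cast ht.symm j) : ℚ)⁻¹) (fun i => (X.p i : ℚ)⁻¹) fun _ => rfl
      rw [e, h, ht]
      norm_num
    have a1 : X.p (Fin.cast ht.symm 1) ≤ X.p (Fin.cast ht.symm 0) :=
      X.antitone (by simp [Fin.le_def])
    have a2 : X.p (Fin.cast ht.symm 2) ≤ X.p (Fin.cast ht.symm 1) :=
      X.antitone (by simp [Fin.le_def])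
    have a3 := X.two_le (Fin.cast ht.symm 2)
    rw [Fin.sum_univ_three] at hs
    simp only [Fin.forall_fin_succ, Fin.succ_zero_eq_one, Fin.succ_one_eq_two,
      Matrix.cons_val_zero, Matrix.cons_val_one, Matrix.cons_val, IsEmpty.forall_iff, and_true]
    generalize X.p (Fin.cast ht.symm 0) = a at *
    generalize X.p (Fin.cast ht.symm 1) = b at *
    generalize X.p (Fin.cast ht.symm 2) = c at *
    have hb : (a : ℚ)⁻¹ ≤ (b : ℚ)⁻¹ :=
      inv_anti₀ (by exact_mod_cast (by omega : 0 < b)) (by exact_mod_cast a1)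
    have hc : (b : ℚ)⁻¹ ≤ (c : ℚ)⁻¹ :=
      inv_anti₀ (by exact_mod_cast (by omega : 0 < c)) (by exact_mod_cast a2)
    have ha0 : (0 : ℚ) < a := by exact_mod_cast (by omega : 0 < a)
    have hb0 : (0 : ℚ) < b := by exact_mod_cast (by omega : 0 < b)
    have hc0 : (0 : ℚ) < c := by exact_mod_cast (by omega : 0 < c)
    have hc3 : c ≤ 3 := by
      have : (3 : ℚ)⁻¹ ≤ (c : ℚ)⁻¹ := by norm_num; linarith
      exact_mod_cast (inv_le_inv₀ (by norm_num) hc0).1 this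
    have heq : (b * c + a * c + a * b : ℚ) = a * b * c := by
      field_simp at hs
      linarith
    have heq' : b * c + a * c + a * b = a * b * c := by exact_mod_cast heq
    have hab0 : 0 < (a : ℚ)⁻¹ := inv_pos.2 ha0
    obtain rfl | rfl : c = 2 ∨ c = 3 := by omega
    · have hb4 : b ≤ 4 := by
        have : (4 : ℚ)⁻¹ ≤ (b : ℚ)⁻¹ := by norm_num at hs ⊢; linarith
        exact_mod_cast (inv_le_inv₀ (by norm_num) hb0).1 this
      interval_cases b <;> omega
    · have hb3 : b ≤ 3 := by
        have : (3 : ℚ)⁻¹ ≤ (b : ℚ)⁻¹ := by norm_num at hs ⊢; linarith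
        exact_mod_cast (inv_le_inv₀ (by norm_num) hb0).1 this
      interval_cases b
      omega
  · refine Or.inl ⟨ht, fun j => ?_⟩
    have hs : ∑ i, ((2 : ℚ)⁻¹ - (X.p i : ℚ)⁻¹) = 0 := by
      rw [Finset.sum_sub_distrib, h, ht]
      simp
      norm_num1
    have := (Finset.sum_eq_zero_iff_of_nonneg fun i _ => sub_nonneg.2 (hinv i)).1 hs
      (Fin.cast ht.symm j) (Finset.mem_univ _)
    rw [sub_eq_zero, inv_inj] at this
    exact_mod_cast this.symm

theorem IsTubular.two_lt (hX : X.IsTubular) : 2 < X.t := by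
  rcases hX.classification with ⟨ht, -⟩ | ⟨ht, -⟩ <;> omega

end WeightedProjectiveLine

/-! ### The coordinate algebra and its Veronese subalgebra -/

namespace WeightedProjectiveLine

variable {k : Type u} [Field k] (X : WeightedProjectiveLine k)

/-- The homomorphism `(n, m) ↦ 3 n x₁ + m ω`, along which the coordinate algebra of a tubular
weighted projective line is restricted to the algebra of the cubic. -/
noncomputable def IsTubular.veroneseHom {X : WeightedProjectiveLine k} (hX : X.IsTubular) :
    ℤ × ZMod X.lcmWeights →+ X.StringGroup :=
  AddMonoidHom.coprod (zmultiplesHom X.StringGroup (3 • X.gen ⟨0, X.t_pos⟩))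
    (ZMod.lift X.lcmWeights ⟨zmultiplesHom X.StringGroup X.dualizing, by
      rw [zmultiplesHom_apply, natCast_zsmul, hX.lcmWeights_smul_dualizing]⟩)

variable {X}

theorem IsTubular.veroneseHom_apply (hX : X.IsTubular) (n m : ℤ) :
    hX.veroneseHom (n, (m : ZMod X.lcmWeights)) =
      n • 3 • X.gen ⟨0, X.t_pos⟩ + m • X.dualizing := by
  unfold veroneseHom
  rw [AddMonoidHom.coprod_apply, ZMod.lift_coe]
  simp only [zmultiplesHom_apply]

theorem IsTubular.degreeHom_veroneseHom (hX : X.IsTubular) (h : ℤ × ZMod X.lcmWeights) :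
    X.degreeHom (hX.veroneseHom h) = h.1 * (3 * X.degreeHom (X.gen ⟨0, X.t_pos⟩)) := by
  obtain ⟨n, m⟩ := h
  obtain ⟨m, rfl⟩ := ZMod.intCast_surjective m
  rw [veroneseHom_apply, map_add, map_zsmul, map_zsmul, hX.degreeHom_dualizing_eq_zero, smul_zero,
    add_zero, map_nsmul, smul_eq_mul, nsmul_eq_mul, Nat.cast_ofNat]

theorem IsTubular.veroneseHom_injective (hX : X.IsTubular) :
    Function.Injective hX.veroneseHom := by
  rw [injective_iff_map_eq_zero]
  intro h e
  have e' := congrArg X.degreeHom e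
  rw [degreeHom_veroneseHom, map_zero] at e'
  have hpos := X.degreeHom_gen_pos ⟨0, X.t_pos⟩
  have h1 : h.1 = 0 := (mul_eq_zero.1 e').resolve_right (by omega)
  obtain ⟨n, m⟩ := h
  obtain ⟨m, rfl⟩ := ZMod.intCast_surjective m
  change n = 0 at h1
  subst h1
  rw [veroneseHom_apply, zero_smul, zero_add] at e
  rw [Prod.mk_eq_zero]
  exact ⟨rfl, (ZMod.intCast_zmod_eq_zero_iff_dvd _ _).2 (dvd_of_smul_dualizing_eq_zero e)⟩

theorem IsTubular.veroneseHom_canonical (hX : X.IsTubular) :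
    hX.veroneseHom ((X.p ⟨0, X.t_pos⟩ : ℤ), 0) = 3 • X.canonical := by
  have := hX.veroneseHom_apply (X.p ⟨0, X.t_pos⟩ : ℤ) 0
  rw [Int.cast_zero, zero_smul, add_zero] at this
  rw [this, natCast_zsmul, smul_comm, smul_gen]

theorem IsTubular.veroneseHom_dualizing (hX : X.IsTubular) :
    hX.veroneseHom (0, 1) = X.dualizing := by
  have := hX.veroneseHom_apply 0 1
  rwa [zero_smul, zero_add, one_smul, Int.cast_one] at this

/-- Modulo the range of `veroneseHom`, every degree is represented by a monomial in which a given
variable does not occur. -/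
theorem IsTubular.exists_weight_eq (hX : X.IsTubular) (i : Fin X.t) (g : X.StringGroup) :
    ∃ d : Fin X.t →₀ ℕ, d i = 0 ∧ ∃ h, Finsupp.weight X.gen d = g + hX.veroneseHom h := by
  classical
  let T : AddSubgroup X.StringGroup :=
    { carrier := {g | ∃ d : Fin X.t →₀ ℕ, d i = 0 ∧
        ∃ h, Finsupp.weight X.gen d = g + hX.veroneseHom h}
      zero_mem' := ⟨0, rfl, 0, by rw [map_zero, map_zero, add_zero]⟩
      add_mem' := by
        rintro g g' ⟨d, hd, h, e⟩ ⟨d', hd', h', e'⟩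
        refine ⟨d + d', by rw [Finsupp.add_apply, hd, hd'], h + h', ?_⟩
        rw [map_add, map_add, e, e']
        abel
      neg_mem' := by
        -- The monomial with exponents `3 p_j d_j` has degree a multiple of `3 c`, so that the
        -- exponents `(3 p_j - 1) d_j` represent the opposite degree.
        rintro g ⟨d, hd, h, e⟩
        let d' : Fin X.t →₀ ℕ := Finsupp.equivFunOnFinite.symm fun j => (3 * X.p j - 1) * d j
        have key : Finsupp.weight X.gen (d' + d) = (∑ j, d j) • 3 • X.canonical := by
          rw [Finsupp.weight_eq_sum, Finset.sum_smul]
          refine Finset.sum_congr rfl fun j _ => ?_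
          have : (d' + d) j = d j * 3 * X.p j := by
            have hp := X.p_pos j
            change (3 * X.p j - 1) * d j + d j = _
            rw [← Nat.succ_mul, Nat.succ_eq_add_one, Nat.sub_add_cancel (by omega)]
            ring
          rw [this, mul_smul, mul_smul, X.smul_gen]
        refine ⟨d', by change _ * d i = 0; rw [hd, mul_zero],
          (∑ j, d j) • ((X.p ⟨0, X.t_pos⟩ : ℤ), 0) - h, ?_⟩
        rw [map_add, e, ← hX.veroneseHom_canonical] at key
        rw [map_sub, map_nsmul, ← key]
        abel }
  have hr (h) : hX.veroneseHom h ∈ T := ⟨0, rfl, -h, by rw [map_zero, map_neg, add_neg_cancel]⟩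
  have hj (j : Fin X.t) (hj : j ≠ i) : X.gen j ∈ T :=
    ⟨Finsupp.single j 1, Finsupp.single_eq_of_ne hj.symm, 0, by
      rw [map_zero, add_zero, Finsupp.weight_single, one_smul]⟩
  have hc : X.canonical ∈ T := by
    have : Nontrivial (Fin X.t) := Fin.nontrivial_iff_two_le.2 hX.two_lt.le
    obtain ⟨j, hji⟩ := exists_ne i
    rw [← X.smul_gen j]
    exact nsmul_mem (hj j hji) _
  have hi : X.gen i ∈ T := by
    have hw : X.dualizing ∈ T := hX.veroneseHom_dualizing ▸ hr _
    -- The relation for `ω` expresses `x_i` through the other generators.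
    have e : X.gen i = ((X.t : ℤ) - 2) • X.canonical - ∑ j ∈ Finset.univ.erase i, X.gen j
        - X.dualizing := by
      unfold dualizing
      rw [← Finset.add_sum_erase _ _ (Finset.mem_univ i)]
      abel
    rw [e]
    exact sub_mem (sub_mem (zsmul_mem hc _) (sum_mem fun j hj' => hj j (Finset.ne_of_mem_erase hj')))
      hw
  have htop : g ∈ T := by
    obtain ⟨n, rfl⟩ := X.exists_eq_sum_gen g
    refine sum_mem fun j _ => zsmul_mem ?_ _
    rcases eq_or_ne j i with rfl | h
    exacts [hi, hj j h]
  exact htop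

theorem isSpannedByHomogeneous_coordIdeal : IsSpannedByHomogeneous X.coordIdeal X.gen := by
  refine ⟨_, rfl, ?_⟩
  rintro _ ⟨i, hi, rfl⟩
  have h (i : Fin X.t) : MvPolynomial.IsWeightedHomogeneous X.gen
      (MvPolynomial.X i ^ X.p i : MvPolynomial (Fin X.t) k) X.canonical := by
    rw [← X.smul_gen i]
    exact (MvPolynomial.isWeightedHomogeneous_X k X.gen i).pow _
  refine ⟨X.canonical, ?_⟩
  have h0 := (MvPolynomial.isWeightedHomogeneous_C X.gen (X.affineParam i)).mul (h ⟨0, by omega⟩)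
  rw [zero_add] at h0
  exact Submodule.sub_mem (MvPolynomial.weightedHomogeneousSubmodule k X.gen X.canonical) (h i)
    (Submodule.sub_mem _ (h _) h0)

theorem mk_X_pow_eq (h1 : 1 < X.t) (i : Fin X.t) (hi : (i : ℕ) ≠ 0) :
    Ideal.Quotient.mk X.coordIdeal (MvPolynomial.X i) ^ X.p i =
      Ideal.Quotient.mk X.coordIdeal (MvPolynomial.X ⟨1, h1⟩) ^ X.p ⟨1, h1⟩ -
        algebraMap k _ (X.affineParam i) *
          Ideal.Quotient.mk X.coordIdeal (MvPolynomial.X ⟨0, X.t_pos⟩) ^ X.p ⟨0, X.t_pos⟩ := by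
  by_cases hi1 : (i : ℕ) = 1
  · obtain rfl : i = ⟨1, h1⟩ := Fin.ext hi1
    have : X.affineParam ⟨1, h1⟩ = 0 := by
      unfold affineParam
      rw [X.param_one _ rfl]
      rfl
    rw [this, map_zero, zero_mul, sub_zero]
  · have : Ideal.Quotient.mk X.coordIdeal _ = 0 := Ideal.Quotient.eq_zero_iff_mem.2
      (Ideal.subset_span ⟨i, by omega, rfl⟩)
    rw [map_sub, sub_eq_zero, map_pow, map_sub, map_pow, map_mul, map_pow] at this
    exact this

theorem affineParam_injOn {i j : Fin X.t} (hi : (i : ℕ) ≠ 0) (hj : (j : ℕ) ≠ 0)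
    (h : X.affineParam i = X.affineParam j) : i = j := by
  have key (i : Fin X.t) (hi : (i : ℕ) ≠ 0) : X.param i = (X.affineParam i : OnePoint k) := by
    have : X.param i ≠ OnePoint.infty := fun e => hi (by
      rw [← X.param_zero ⟨0, X.t_pos⟩ rfl] at e
      exact congrArg Fin.val (X.param_injective e))
    unfold affineParam
    induction hx : X.param i using OnePoint.rec with
    | infty => exact absurd hx this
    | coe x => rfl
  exact X.param_injective (by rw [key i hi, key j hj, h])

/-- A prime ideal of the coordinate algebra containing two of the variables contains them all, as
the points `λ_i` are pairwise distinct. -/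
theorem mk_X_mem_of_isPrime (h1 : 1 < X.t) {P : Ideal X.CoordAlgebra} [hP : P.IsPrime]
    {a b : Fin X.t} (hab : a ≠ b) (ha : Ideal.Quotient.mk _ (MvPolynomial.X a) ∈ P)
    (hb : Ideal.Quotient.mk _ (MvPolynomial.X b) ∈ P) (i : Fin X.t) :
    Ideal.Quotient.mk _ (MvPolynomial.X i) ∈ P := by
  have hu {i : Fin X.t} (hi : Ideal.Quotient.mk _ (MvPolynomial.X i) ∈ P) :=
    Ideal.pow_mem_of_mem P hi (X.p i) (X.p_pos i)
  have h0 : Ideal.Quotient.mk _ (MvPolynomial.X ⟨0, X.t_pos⟩) ∈ P := by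
    by_cases ha0 : (a : ℕ) = 0
    · obtain rfl : a = ⟨0, X.t_pos⟩ := Fin.ext ha0
      exact ha
    by_cases hb0 : (b : ℕ) = 0
    · obtain rfl : b = ⟨0, X.t_pos⟩ := Fin.ext hb0
      exact hb
    have hne : X.affineParam b - X.affineParam a ≠ 0 :=
      sub_ne_zero.2 fun h => hab (affineParam_injOn hb0 ha0 h).symm
    have h := sub_mem (hu ha) (hu hb)
    rw [mk_X_pow_eq h1 a ha0, mk_X_pow_eq h1 b hb0, sub_sub_sub_cancel_left, ← sub_mul,
      ← map_sub] at h
    refine hP.mem_of_pow_mem _ ((hP.mem_or_mem h).resolve_left fun h' => hP.ne_top ?_)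
    exact P.eq_top_of_isUnit_mem h' ((isUnit_iff_ne_zero.2 hne).map (algebraMap k _))
  have key : ∃ c : Fin X.t, (c : ℕ) ≠ 0 ∧ Ideal.Quotient.mk _ (MvPolynomial.X c) ∈ P := by
    by_cases ha0 : (a : ℕ) = 0
    · exact ⟨b, fun hb0 => hab (Fin.ext (ha0.trans hb0.symm)), hb⟩
    · exact ⟨a, ha0, ha⟩
  obtain ⟨c, hc0, hc⟩ := key
  have hu1 : Ideal.Quotient.mk X.coordIdeal (MvPolynomial.X ⟨1, h1⟩) ^ X.p ⟨1, h1⟩ ∈ P := by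
    have h := add_mem (hu hc) (P.mul_mem_left (algebraMap k _ (X.affineParam c)) (hu h0))
    rwa [mk_X_pow_eq h1 c hc0, sub_add_cancel] at h
  by_cases hi : (i : ℕ) = 0
  · obtain rfl : i = ⟨0, X.t_pos⟩ := Fin.ext hi
    exact h0
  · refine hP.mem_of_pow_mem (X.p i) ?_
    rw [mk_X_pow_eq h1 i hi]
    exact sub_mem hu1 (P.mul_mem_left _ (hu h0))

/-- The elements of degree in a coset of the range of `veroneseHom` generate an ideal of finite
codimension: a prime ideal containing it contains, for each `i`, a monomial without `X_i`, so it
contains two different variables and therefore all of them. -/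
theorem IsTubular.finiteDimensional_quotient (hX : X.IsTubular) (g : X.StringGroup) :
    FiniteDimensional k (X.CoordAlgebra ⧸ (Ideal.span (⋃ h, (X.coordGrading (g + hX.veroneseHom h) :
      Set X.CoordAlgebra))).restrictScalars k) := by
  refine finiteDimensional_quotient_of_pow_mem _ fun i => ?_
  change _ ∈ Ideal.radical _
  rw [Ideal.radical_eq_sInf, Submodule.mem_sInf]
  rintro P ⟨hJP, hP⟩
  have key (a : Fin X.t) : ∃ b, b ≠ a ∧
      Ideal.Quotient.mk X.coordIdeal (MvPolynomial.X b) ∈ P := by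
    obtain ⟨d, hd, h, e⟩ := hX.exists_weight_eq a g
    have hm : Ideal.Quotient.mk X.coordIdeal (MvPolynomial.monomial d 1) ∈ P := by
      refine hJP (Ideal.subset_span (Set.mem_iUnion.2 ⟨h, ?_⟩))
      rw [← e]
      exact mk_monomial_mem_quotientGrading d 1
    rw [MvPolynomial.monomial_eq, MvPolynomial.C_1, one_mul, Finsupp.prod, map_prod,
      hP.prod_mem_iff] at hm
    obtain ⟨b, hb, hbP⟩ := hm
    rw [map_pow] at hbP
    exact ⟨b, fun h => Finsupp.mem_support_iff.1 hb (h ▸ hd), hP.mem_of_pow_mem _ hbP⟩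
  obtain ⟨a, -, ha⟩ := key i
  obtain ⟨b, hba, hb⟩ := key a
  exact mk_X_mem_of_isPrime (by have := hX.two_lt; omega) hba hb ha i

theorem positivelyGraded_coordGrading : PositivelyGraded X.coordGrading X.degreeHom :=
  positivelyGraded_quotientGrading isSpannedByHomogeneous_coordIdeal _ X.degreeHom_gen_pos

/-- An algebra onto which the coordinate algebra restricts along `veroneseHom` is a Veronese
subalgebra: the remaining conditions of finiteness hold. -/
theorem IsTubular.isVeronese (hX : X.IsTubular) {B : Type u} [CommRing B] [Algebra k B]
    [Algebra B X.CoordAlgebra] [IsScalarTower k B X.CoordAlgebra]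
    {ℬ : ℤ × ZMod X.lcmWeights → Submodule k B} (hℬ : IsGrading ℬ)
    (hinj : Function.Injective (algebraMap B X.CoordAlgebra))
    (hmem : ∀ h, ∀ b ∈ ℬ h, algebraMap B X.CoordAlgebra b ∈ X.coordGrading (hX.veroneseHom h))
    (hsurj : ∀ h, ∀ a ∈ X.coordGrading (hX.veroneseHom h), ∃ b ∈ ℬ h, algebraMap B _ b = a) :
    IsVeronese X.coordGrading ℬ hX.veroneseHom where
  isGrading := isGrading_quotientGrading isSpannedByHomogeneous_coordIdeal
  isGrading' := hℬ
  mul_mem := quotientGrading_mul_mem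
  one_mem := quotientGrading_one_mem
  injective := hX.veroneseHom_injective
  algebraMap_injective := hinj
  algebraMap_mem := hmem
  exists_algebraMap := hsurj
  finite := by
    have : Algebra.FiniteType k X.CoordAlgebra := inferInstance
    have : Algebra.FiniteType B X.CoordAlgebra :=
      Algebra.FiniteType.of_restrictScalars_finiteType k B X.CoordAlgebra
    have : Algebra.IsIntegral B X.CoordAlgebra := by
      refine ⟨fun x => ?_⟩
      obtain ⟨f, rfl⟩ := Ideal.Quotient.mk_surjective x
      induction f using MvPolynomial.induction_on with
      | C a =>
        change IsIntegral B (algebraMap k X.CoordAlgebra a)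
        rw [IsScalarTower.algebraMap_apply k B X.CoordAlgebra]
        exact isIntegral_algebraMap
      | add f g hf hg => rw [map_add]; exact hf.add hg
      | mul_X f i hf =>
        rw [map_mul]
        refine hf.mul (IsIntegral.of_pow (n := 3 * X.p i) (by have := X.p_pos i; omega) ?_)
        -- The power `X_i ^ (3 p_i)` has degree `3 c`.
        obtain ⟨b, -, hb⟩ := hsurj ((X.p ⟨0, X.t_pos⟩ : ℤ), 0)
          (Ideal.Quotient.mk X.coordIdeal (MvPolynomial.X i) ^ (3 * X.p i)) (by
            rw [hX.veroneseHom_canonical, ← X.smul_gen i, smul_smul, ← map_pow]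
            exact mk_mem_quotientGrading
              ((MvPolynomial.isWeightedHomogeneous_X k X.gen i).pow _))
        rw [← hb]
        exact isIntegral_algebraMap
    exact Algebra.IsIntegral.finite
  cofinite := hX.finiteDimensional_quotient

end WeightedProjectiveLine

/-! ### Plane cubics in Weierstrass form -/

section Weierstrass

variable {k : Type u} [Field k]

open MvPolynomial

/-- The ternary cubic `Z Y² + α Z² Y - (X³ + a X² Z + b X Z² + c Z³)`. -/
noncomputable def weierstrassCubic (α a b c : k) : MvPolynomial (Fin 3) k :=
  X 2 * X 1 ^ 2 + C α * (X 2 ^ 2 * X 1) -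
    (X 0 ^ 3 + C a * (X 0 ^ 2 * X 2) + C b * (X 0 * X 2 ^ 2) + C c * X 2 ^ 3)

theorem isWeightedHomogeneous_weierstrassCubic {M : Type*} [AddCommGroup M] {w : Fin 3 → M}
    {α a b c : k} (h : 2 • w 1 + w 2 = 3 • w 0) (hα : α = 0 ∨ 2 • w 2 + w 1 = 3 • w 0)
    (ha : a = 0 ∨ 2 • w 0 + w 2 = 3 • w 0) (hb : b = 0 ∨ w 0 + 2 • w 2 = 3 • w 0)
    (hc : c = 0 ∨ 3 • w 2 = 3 • w 0) :
    IsWeightedHomogeneous w (weierstrassCubic α a b c) (3 • w 0) := by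
  have hC {r : k} {f : MvPolynomial (Fin 3) k} {n : M} (hr : r = 0 ∨ n = 3 • w 0)
      (hf : IsWeightedHomogeneous w f n) : C r * f ∈ weightedHomogeneousSubmodule k w (3 • w 0) := by
    rcases hr with rfl | rfl
    · rw [C_0, zero_mul]
      exact zero_mem _
    · rw [← smul_eq_C_mul]
      exact Submodule.smul_mem _ _ hf
  have hX (i : Fin 3) (n : ℕ) : IsWeightedHomogeneous w (X i ^ n : MvPolynomial (Fin 3) k) (n • w i) :=
    (isWeightedHomogeneous_X k w i).pow n
  have hX1 (i : Fin 3) : IsWeightedHomogeneous w (X i : MvPolynomial (Fin 3) k) (w i) :=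
    isWeightedHomogeneous_X k w i
  refine Submodule.sub_mem (weightedHomogeneousSubmodule k w (3 • w 0)) (Submodule.add_mem _ ?_ ?_)
    (Submodule.add_mem _ (Submodule.add_mem _ (Submodule.add_mem _ ?_ ?_) ?_) ?_)
  · rw [← h, add_comm]
    exact (hX1 2).mul (hX 1 2)
  · exact hC hα ((hX 2 2).mul (hX1 1))
  · exact hX 0 3
  · exact hC ha ((hX 0 2).mul (hX1 2))
  · exact hC hb ((hX1 0).mul (hX 2 2))
  · exact hC hc (hX 2 3)

/-- The inclusion of `k[Z][X]` into `k[X, Y, Z]`. -/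
noncomputable def polyXZ : Polynomial (Polynomial k) →+* MvPolynomial (Fin 3) k :=
  Polynomial.eval₂RingHom (Polynomial.aeval (X 2) : Polynomial k →ₐ[k] _).toRingHom (X 0)

theorem polyXZ_X : polyXZ (Polynomial.X : Polynomial (Polynomial k)) = X 0 :=
  Polynomial.eval₂_X _ _

theorem polyXZ_CX : polyXZ (Polynomial.C (Polynomial.X : Polynomial k)) = X 2 :=
  (Polynomial.eval₂_C _ _).trans (Polynomial.aeval_X _)

theorem polyXZ_CC (r : k) : polyXZ (Polynomial.C (Polynomial.C r)) = C r :=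
  (Polynomial.eval₂_C _ _).trans (Polynomial.aeval_C _ _)

/-- The polynomial `X³ + a X² Z + b X Z² + c Z³` in `k[Z][X]`. -/
noncomputable def binaryCubic (a b c : k) : Polynomial (Polynomial k) :=
  Polynomial.X ^ 3 + Polynomial.C (Polynomial.C a * Polynomial.X) * Polynomial.X ^ 2 +
    Polynomial.C (Polynomial.C b * Polynomial.X ^ 2) * Polynomial.X +
    Polynomial.C (Polynomial.C c * Polynomial.X ^ 3)

theorem binaryCubic_natDegree (a b c : k) : (binaryCubic a b c).natDegree = 3 := by
  unfold binaryCubic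
  compute_degree!

theorem polyXZ_binaryCubic (a b c : k) : polyXZ (binaryCubic a b c) =
    X 0 ^ 3 + C a * (X 0 ^ 2 * X 2) + C b * (X 0 * X 2 ^ 2) + C c * X 2 ^ 3 := by
  unfold binaryCubic
  simp only [map_add, map_mul, map_pow, polyXZ_X, polyXZ_CX, polyXZ_CC]
  ring

/-- Modulo the cubic, and up to a power of `Z`, every polynomial has degree at most one in `Y`. -/
theorem exists_sub_mem_span_weierstrassCubic (α a b c : k) (F : MvPolynomial (Fin 3) k) :
    ∃ (N : ℕ) (P Q : Polynomial (Polynomial k)),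
      weierstrassCubic α a b c ∣ X 2 ^ N * F - (polyXZ P + X 1 * polyXZ Q) := by
  induction F using MvPolynomial.induction_on with
  | C r => exact ⟨0, Polynomial.C (Polynomial.C r), 0, by simp [polyXZ_CC]⟩
  | add F F' hF hF' =>
    obtain ⟨N, P, Q, A, hA⟩ := hF
    obtain ⟨N', P', Q', A', hA'⟩ := hF'
    refine ⟨N + N', Polynomial.C Polynomial.X ^ N' * P + Polynomial.C Polynomial.X ^ N * P',
      Polynomial.C Polynomial.X ^ N' * Q + Polynomial.C Polynomial.X ^ N * Q',
      X 2 ^ N' * A + X 2 ^ N * A', ?_⟩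
    simp only [map_add, map_mul, map_pow, polyXZ_CX]
    linear_combination X 2 ^ N' * hA + X 2 ^ N * hA'
  | mul_X F i hF =>
    obtain ⟨N, P, Q, A, hA⟩ := hF
    fin_cases i
    · refine ⟨N, Polynomial.X * P, Polynomial.X * Q, A * X 0, ?_⟩
      simp only [map_mul, polyXZ_X, Fin.zero_eta]
      linear_combination X 0 * hA
    · -- Here `Z Y²` is replaced by `X³ + ⋯ - α Z² Y`.
      refine ⟨N + 1, binaryCubic a b c * Q, Polynomial.C Polynomial.X * P -
        Polynomial.C (Polynomial.C α * Polynomial.X ^ 2) * Q,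
        A * (X 2 * X 1) + polyXZ Q, ?_⟩
      simp only [map_mul, map_sub, map_pow, polyXZ_CX, polyXZ_CC, polyXZ_binaryCubic, Fin.mk_one]
      unfold weierstrassCubic at hA ⊢
      linear_combination X 2 * X 1 * hA
    · refine ⟨N, Polynomial.C Polynomial.X * P, Polynomial.C Polynomial.X * Q, A * X 2, ?_⟩
      simp only [map_mul, polyXZ_CX, Fin.reduceFinMk]
      linear_combination X 2 * hA

theorem not_X_dvd_weierstrassCubic (α a b c : k) :
    ¬ (X 2 : MvPolynomial (Fin 3) k) ∣ weierstrassCubic α a b c := by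
  rintro ⟨A, hA⟩
  have h := congrArg (MvPolynomial.eval ![1, 0, 0]) hA
  simp [weierstrassCubic] at h

/-- The cubic has no solution `Y` in the field of rational functions of `X` and `Z`, by comparison
of degrees in `X`. -/
theorem eq_zero_of_weierstrass {α a b c : k} {P Q : Polynomial (Polynomial k)}
    (h : Polynomial.C Polynomial.X * P ^ 2 -
      Polynomial.C (Polynomial.C α * Polynomial.X ^ 2) * P * Q - binaryCubic a b c * Q ^ 2 = 0) :
    P = 0 ∧ Q = 0 := by
  have hg : binaryCubic a b c ≠ 0 := fun e => by
    have := binaryCubic_natDegree a b c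
    rw [e, Polynomial.natDegree_zero] at this
    omega
  have hZ : (Polynomial.C Polynomial.X : Polynomial (Polynomial k)) ≠ 0 :=
    Polynomial.C_ne_zero.2 Polynomial.X_ne_zero
  by_cases hQ : Q = 0
  · subst hQ
    simpa [hZ] using h
  by_cases hP : P = 0
  · subst hP
    simp [hg, hQ] at h
  exfalso
  have h' : P * (Polynomial.C Polynomial.X * P - Polynomial.C (Polynomial.C α * Polynomial.X ^ 2) * Q)
      = binaryCubic a b c * Q ^ 2 := by linear_combination h
  have hd : (binaryCubic a b c * Q ^ 2).natDegree = 3 + 2 * Q.natDegree := by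
    rw [Polynomial.natDegree_mul hg (pow_ne_zero 2 hQ), binaryCubic_natDegree,
      Polynomial.natDegree_pow]
  have hr : Polynomial.C Polynomial.X * P -
      Polynomial.C (Polynomial.C α * Polynomial.X ^ 2) * Q ≠ 0 := by
    intro e
    rw [e, mul_zero] at h'
    exact mul_ne_zero hg (pow_ne_zero 2 hQ) h'.symm
  rw [← h', Polynomial.natDegree_mul hP hr] at hd
  have h1 : (Polynomial.C Polynomial.X * P : Polynomial (Polynomial k)).natDegree = P.natDegree :=
    Polynomial.natDegree_C_mul Polynomial.X_ne_zero
  have h2 : (Polynomial.C (Polynomial.C α * Polynomial.X ^ 2) * Q).natDegree ≤ Q.natDegree :=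
    Polynomial.natDegree_C_mul_le _ _
  rcases lt_or_ge Q.natDegree P.natDegree with hlt | hle
  · rw [Polynomial.natDegree_sub_eq_left_of_natDegree_lt (by omega), h1] at hd
    omega
  · have := Polynomial.natDegree_sub_le (Polynomial.C Polynomial.X * P)
      (Polynomial.C (Polynomial.C α * Polynomial.X ^ 2) * Q)
    omega

/-- The embedding of `k[Z][X]` into `k[a][b]` with `Z ↦ a³` and `X ↦ a bᵐ`. -/
noncomputable def monomialMap (m : ℕ) : Polynomial (Polynomial k) →+* Polynomial (Polynomial k) :=
  (Polynomial.compRingHom (Polynomial.C Polynomial.X * Polynomial.X ^ m)).comp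
    (Polynomial.mapRingHom (Polynomial.expand k 3).toRingHom)

theorem monomialMap_injective {m : ℕ} (hm : 0 < m) :
    Function.Injective (monomialMap m : Polynomial (Polynomial k) →+* _) := by
  refine Function.Injective.comp (g := Polynomial.compRingHom _) ?_
    (Polynomial.map_injective _ (Polynomial.expand_injective three_pos))
  rw [injective_iff_map_eq_zero]
  intro P hP
  refine (Polynomial.comp_eq_zero_iff.1 hP).resolve_right fun h => ?_
  have := congrArg Polynomial.natDegree h.2
  rw [Polynomial.natDegree_C, Polynomial.natDegree_C_mul_X_pow _ _ Polynomial.X_ne_zero] at this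
  omega

/-- A homomorphism killing the cubic under which `X` and `Z` stay algebraically independent has
kernel generated by the cubic. -/
theorem weierstrassCubic_dvd_of_map_eq_zero {α a b c : k} {Ω : Type*} [Field Ω] [Algebra k Ω]
    (ι : Polynomial (Polynomial k) →ₐ[k] Ω) (hι : Function.Injective ι) {m : ℕ} (hm : 0 < m)
    (θ : MvPolynomial (Fin 3) k →ₐ[k] Ω) (hf : θ (weierstrassCubic α a b c) = 0)
    (h0 : θ (X 0) = ι (Polynomial.C Polynomial.X * Polynomial.X ^ m))
    (h2 : θ (X 2) = ι (Polynomial.C Polynomial.X ^ 3)) {F : MvPolynomial (Fin 3) k}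
    (hF : θ F = 0) : weierstrassCubic α a b c ∣ F := by
  have hcomp (P : Polynomial (Polynomial k)) : θ (polyXZ P) = ι (monomialMap m P) := by
    have : θ.toRingHom.comp polyXZ = ι.toRingHom.comp (monomialMap m) := by
      refine Polynomial.ringHom_ext' (Polynomial.ringHom_ext (fun r => ?_) ?_) ?_
      · change θ (polyXZ (Polynomial.C (Polynomial.C r))) =
          ι (monomialMap m (Polynomial.C (Polynomial.C r)))
        have e : monomialMap m (Polynomial.C (Polynomial.C r)) = algebraMap k _ r := by
          simp [monomialMap]
        rw [polyXZ_CC, e, AlgHom.commutes]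
        exact θ.commutes r
      · change θ (polyXZ (Polynomial.C Polynomial.X)) =
          ι (monomialMap m (Polynomial.C Polynomial.X))
        rw [polyXZ_CX, h2]
        congr 1
        simp [monomialMap]
      · change θ (polyXZ Polynomial.X) = ι (monomialMap m Polynomial.X)
        rw [polyXZ_X, h0]
        congr 1
        simp [monomialMap]
    exact RingHom.congr_fun this P
  obtain ⟨N, P, Q, A, hA⟩ := exists_sub_mem_span_weierstrassCubic α a b c F
  have hPQ : θ (polyXZ P) + θ (X 1) * θ (polyXZ Q) = 0 := by
    have := congrArg θ hA
    rw [map_mul, hf, zero_mul, map_sub, map_mul, hF, mul_zero, zero_sub, neg_eq_zero, map_add,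
      map_mul] at this
    exact this
  have hf' : θ (X 2) * θ (X 1) ^ 2 + θ (C α) * θ (X 2) ^ 2 * θ (X 1) -
      θ (polyXZ (binaryCubic a b c)) = 0 := by
    rw [← hf, polyXZ_binaryCubic]
    unfold weierstrassCubic
    simp only [map_add, map_sub, map_mul, map_pow]
    ring
  have key : θ (polyXZ (Polynomial.C Polynomial.X * P ^ 2 -
      Polynomial.C (Polynomial.C α * Polynomial.X ^ 2) * P * Q -
        binaryCubic a b c * Q ^ 2)) = 0 := by
    simp only [map_sub, map_mul, map_pow, polyXZ_CX, polyXZ_CC]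
    linear_combination θ (polyXZ Q) ^ 2 * hf' + (θ (X 2) * θ (polyXZ P) -
      θ (X 2) * θ (X 1) * θ (polyXZ Q) - θ (C α) * θ (X 2) ^ 2 * θ (polyXZ Q)) * hPQ
  rw [hcomp, map_eq_zero_iff _ hι, map_eq_zero_iff _ (monomialMap_injective hm)] at key
  obtain ⟨rfl, rfl⟩ := eq_zero_of_weierstrass key
  rw [map_zero, mul_zero, add_zero, sub_zero] at hA
  have hp : Prime (X 2 : MvPolynomial (Fin 3) k) := MvPolynomial.X_prime
  obtain ⟨A', rfl⟩ := hp.pow_dvd_of_dvd_mul_left N (not_X_dvd_weierstrassCubic α a b c)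
    (Dvd.intro _ hA)
  exact ⟨A', mul_left_cancel₀ (pow_ne_zero N hp.ne_zero) (by rw [hA]; ring)⟩

end Weierstrass

/-! ### Monomials in the Veronese subalgebra -/

section Monomials

variable {k A : Type*} [Field k] [CommRing A] [Algebra k A] {T : Subalgebra k A} {x y z w : A}

/-! In the following lemmas `x`, `y`, `z` (and `w`) stand for the generators of the coordinate
algebra and `T` for the subalgebra generated by the images of the variables of the cubic. The
congruences say that the degree of a monomial is killed by the characters of the string group which
vanish on `3 x₁` and on `ω`; each lemma shows that such a monomial belongs to `T`. -/

theorem pow_mul_pow_mem {n a b : ℕ} (hx : x ^ n ∈ T) (hy : y ^ n ∈ T) (hxy : x * y ∈ T)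
    (h : a % n = b % n) : x ^ a * y ^ b ∈ T := by
  have e : x ^ a * y ^ b = (x ^ n) ^ (a / n) * (y ^ n) ^ (b / n) * (x * y) ^ (a % n) := by
    conv_lhs => rw [← Nat.div_add_mod a n, ← Nat.div_add_mod b n, ← h]
    ring
  rw [e]
  exact mul_mem (mul_mem (pow_mem hx _) (pow_mem hy _)) (pow_mem hxy _)

/-- Weights `(6, 3, 2)`. -/
theorem monomial_mem_632 (h0 : x ^ 3 ∈ T) (h1 : x * y ∈ T) (h2 : z ∈ T)
    (hrel : z ^ 2 = y ^ 3 - x ^ 6) {a b c : ℕ} (h : 3 ∣ a * 1 + b * 2 + c * 0) :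
    x ^ a * y ^ b * z ^ c ∈ T := by
  have hy : y ^ 3 ∈ T := by
    rw [show y ^ 3 = z ^ 2 + (x ^ 3) ^ 2 by rw [hrel]; ring]
    exact add_mem (pow_mem h2 _) (pow_mem h0 _)
  exact mul_mem (pow_mul_pow_mem h0 hy h1 (by omega)) (pow_mem h2 _)

/-- Weights `(3, 3, 3)`: the congruences force all three exponents to be congruent modulo `3`. -/
theorem monomial_mem_333 (h0 : x ^ 3 ∈ T) (h1 : x * y * z ∈ T) (h2 : y ^ 3 ∈ T)
    (hrel : z ^ 3 = y ^ 3 - x ^ 3) {a b c : ℕ} (h : 3 ∣ a * 1 + b * 0 + c * 2)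
    (h' : 3 ∣ a * 0 + b * 1 + c * 2) : x ^ a * y ^ b * z ^ c ∈ T := by
  have e : x ^ a * y ^ b * z ^ c =
      (x ^ 3) ^ (a / 3) * (y ^ 3) ^ (b / 3) * (z ^ 3) ^ (c / 3) * (x * y * z) ^ (a % 3) := by
    have hb : b % 3 = a % 3 := by omega
    have hc : c % 3 = a % 3 := by omega
    conv_lhs => rw [← Nat.div_add_mod a 3, ← Nat.div_add_mod b 3, ← Nat.div_add_mod c 3, hb, hc]
    ring
  rw [e, hrel]
  exact mul_mem (mul_mem (mul_mem (pow_mem h0 _) (pow_mem h2 _)) (pow_mem (sub_mem h2 h0) _))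
    (pow_mem h1 _)

theorem pow_mul_pow_mem_of_sq {a b : ℕ} (h0 : x ^ 3 ∈ T) (h1 : x * y ^ 2 ∈ T) (hy : y ^ 6 ∈ T)
    (h : a % 3 = b % 3) : x ^ a * y ^ (2 * b) ∈ T := by
  rw [pow_mul]
  exact pow_mul_pow_mem h0 (by rwa [← pow_mul]) h1 h

/-- Weights `(4, 4, 2)`: the relation reduces to the exponents `0` and `1` of `z`. -/
theorem monomial_mem_442 (h0 : x ^ 3 ∈ T) (h1 : x * y ^ 2 ∈ T) (h2 : y * z ∈ T)
    (hrel : z ^ 2 = y ^ 4 - x ^ 4) {a b c : ℕ} (h : 6 ∣ a * 4 + b * 1 + c * 5) :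
    x ^ a * y ^ b * z ^ c ∈ T := by
  have hy : y ^ 6 ∈ T := by
    rw [show y ^ 6 = (y * z) ^ 2 + x ^ 3 * (x * y ^ 2) by rw [mul_pow, hrel]; ring]
    exact add_mem (pow_mem h2 _) (mul_mem h0 h1)
  induction c using Nat.strong_induction_on generalizing a b with
  | _ c ih =>
    match c with
    | 0 =>
      obtain ⟨b, rfl⟩ : 2 ∣ b := by omega
      rw [pow_zero, mul_one]
      exact pow_mul_pow_mem_of_sq h0 h1 hy (by omega)
    | 1 =>
      obtain ⟨b, rfl⟩ : ∃ b', b = 2 * b' + 1 := ⟨b / 2, by omega⟩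
      rw [show x ^ a * y ^ (2 * b + 1) * z ^ 1 = x ^ a * y ^ (2 * b) * (y * z) by ring]
      exact mul_mem (pow_mul_pow_mem_of_sq h0 h1 hy (by omega)) h2
    | c + 2 =>
      rw [show x ^ a * y ^ b * z ^ (c + 2) =
        x ^ a * y ^ (b + 4) * z ^ c - x ^ (a + 4) * y ^ b * z ^ c by rw [pow_add z, hrel]; ring]
      exact sub_mem (ih c (by omega) (by omega)) (ih c (by omega) (by omega))

/-- Weights `(2, 2, 2, 2)`: the relations reduce to the exponents `0` and `1` of `z` and `w`. -/
theorem monomial_mem_2222 (l : k) (h0 : x ^ 3 ∈ T) (h1 : x * y ^ 2 ∈ T) (h2 : y * z * w ∈ T)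
    (hrel : z ^ 2 = y ^ 2 - x ^ 2) (hrel' : w ^ 2 = y ^ 2 - algebraMap k A l * x ^ 2)
    {a b c d : ℕ} (h : 2 ∣ a * 0 + b * 1 + c * 0 + d * 1) (h' : 2 ∣ a * 0 + b * 0 + c * 1 + d * 1)
    (h'' : 3 ∣ a * 1 + b * 1 + c * 1 + d * 1) : x ^ a * y ^ b * z ^ c * w ^ d ∈ T := by
  have hy : y ^ 6 ∈ T := by
    rw [show y ^ 6 = (y * z * w) ^ 2 + (1 + algebraMap k A l) * (x * y ^ 2) ^ 2 -
      algebraMap k A l * (x ^ 3 * (x * y ^ 2)) by rw [mul_pow, mul_pow, hrel, hrel']; ring]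
    exact sub_mem (add_mem (pow_mem h2 _)
      (mul_mem (add_mem (one_mem _) (T.algebraMap_mem _)) (pow_mem h1 _)))
      (mul_mem (T.algebraMap_mem _) (mul_mem h0 h1))
  induction hn : c + d using Nat.strong_induction_on generalizing a b c d with
  | _ n ih =>
    match c, d with
    | c + 2, d =>
      rw [show x ^ a * y ^ b * z ^ (c + 2) * w ^ d =
        x ^ a * y ^ (b + 2) * z ^ c * w ^ d - x ^ (a + 2) * y ^ b * z ^ c * w ^ d by
          rw [pow_add z, hrel]; ring]
      exact sub_mem (ih (c + d) (by omega) (by omega) (by omega) (by omega) rfl)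
        (ih (c + d) (by omega) (by omega) (by omega) (by omega) rfl)
    | c, d + 2 =>
      rw [show x ^ a * y ^ b * z ^ c * w ^ (d + 2) =
        x ^ a * y ^ (b + 2) * z ^ c * w ^ d -
          algebraMap k A l * (x ^ (a + 2) * y ^ b * z ^ c * w ^ d) by
          rw [pow_add w, hrel']; ring]
      exact sub_mem (ih (c + d) (by omega) (by omega) (by omega) (by omega) rfl)
        (mul_mem (T.algebraMap_mem _)
          (ih (c + d) (by omega) (by omega) (by omega) (by omega) rfl))
    | 0, 0 =>
      obtain ⟨b, rfl⟩ : 2 ∣ b := by omega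
      rw [pow_zero, pow_zero, mul_one, mul_one]
      exact pow_mul_pow_mem_of_sq h0 h1 hy (by omega)
    | 1, 1 =>
      obtain ⟨b, rfl⟩ : ∃ b', b = 2 * b' + 1 := ⟨b / 2, by omega⟩
      rw [show x ^ a * y ^ (2 * b + 1) * z ^ 1 * w ^ 1 = x ^ a * y ^ (2 * b) * (y * z * w) by ring]
      exact mul_mem (pow_mul_pow_mem_of_sq h0 h1 hy (by omega)) h2
    | 1, 0 => omega
    | 0, 1 => omega

end Monomials

/-! ### The algebra of the cubic as a Veronese subalgebra -/

namespace WeightedProjectiveLine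

variable {k : Type u} [Field k] (X : WeightedProjectiveLine k)

/-- The generators of the coordinate algebra. -/
noncomputable def coord (i : Fin X.t) : X.CoordAlgebra :=
  Ideal.Quotient.mk X.coordIdeal (MvPolynomial.X i)

/-- The degrees of the variables of the cubic in the grading by `ℤ × ZMod p` that refines the
grading by `ℤ` by the weights of the action of `C_p`. -/
def cubicDegree (j : Fin 3) : ℤ × ZMod X.lcmWeights :=
  (1, (tubularExponents X.weights j : ZMod X.lcmWeights))

/-- The grading of the algebra of the cubic by `ℤ × ZMod p`. -/
noncomputable def fineCubicGrading : ℤ × ZMod X.lcmWeights → Submodule k X.CubicAlgebra :=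
  quotientGrading (Ideal.span {X.cubic}) X.cubicDegree

variable {X}

theorem coord_pow_mem (i : Fin X.t) (n : ℕ) : X.coord i ^ n ∈ X.coordGrading (n • X.gen i) := by
  unfold coord
  rw [← map_pow]
  exact mk_mem_quotientGrading ((MvPolynomial.isWeightedHomogeneous_X k X.gen i).pow n)

theorem coord_mem (i : Fin X.t) : X.coord i ∈ X.coordGrading (X.gen i) :=
  mk_X_mem_quotientGrading i

theorem mul_mem_coordGrading {g h : X.StringGroup} {a b : X.CoordAlgebra}
    (ha : a ∈ X.coordGrading g) (hb : b ∈ X.coordGrading h) : a * b ∈ X.coordGrading (g + h) :=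
  quotientGrading_mul_mem g h a ha b hb

theorem mk_monomial_eq_prod (d : Fin X.t →₀ ℕ) :
    Ideal.Quotient.mk X.coordIdeal (MvPolynomial.monomial d 1) = ∏ i, X.coord i ^ d i := by
  rw [MvPolynomial.monomial_eq, MvPolynomial.C_1, one_mul, Finsupp.prod_fintype _ _ (by simp),
    map_prod]
  simp only [map_pow]
  rfl

theorem coord_pow_eq (h1 : 1 < X.t) (i : Fin X.t) (hi : (i : ℕ) ≠ 0) :
    X.coord i ^ X.p i = X.coord ⟨1, h1⟩ ^ X.p ⟨1, h1⟩ -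
      algebraMap k _ (X.affineParam i) * X.coord ⟨0, X.t_pos⟩ ^ X.p ⟨0, X.t_pos⟩ :=
  mk_X_pow_eq h1 i hi

theorem exists_algHom (h1 : 1 < X.t) {Ω : Type*} [CommRing Ω] [Algebra k Ω] (r : Fin X.t → Ω)
    (hr : ∀ i : Fin X.t, 2 ≤ (i : ℕ) → r i ^ X.p i = r ⟨1, h1⟩ ^ X.p ⟨1, h1⟩ -
      algebraMap k Ω (X.affineParam i) * r ⟨0, X.t_pos⟩ ^ X.p ⟨0, X.t_pos⟩) :
    ∃ τ : X.CoordAlgebra →ₐ[k] Ω, ∀ i, τ (X.coord i) = r i := by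
  have h (f) (hf : f ∈ X.coordIdeal) : MvPolynomial.aeval r f = 0 := by
    have : X.coordIdeal ≤ RingHom.ker (MvPolynomial.aeval r : MvPolynomial (Fin X.t) k →ₐ[k] Ω) := by
      refine Ideal.span_le.2 ?_
      rintro _ ⟨i, hi, rfl⟩
      change MvPolynomial.aeval r _ = 0
      simp only [map_sub, map_mul, map_pow, MvPolynomial.aeval_X, MvPolynomial.algHom_C]
      rw [hr i hi, sub_self]
    exact this hf
  exact ⟨Ideal.Quotient.liftₐ _ _ h, fun i => MvPolynomial.aeval_X r i⟩

/-- In an algebraically closed field, two of the coordinates can be prescribed. -/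
theorem exists_algHom_of_isAlgClosed (h1 : 1 < X.t) {Ω : Type*} [Field Ω] [IsAlgClosed Ω]
    [Algebra k Ω] (x y : Ω) : ∃ τ : X.CoordAlgebra →ₐ[k] Ω,
      τ (X.coord ⟨0, X.t_pos⟩) = x ∧ τ (X.coord ⟨1, h1⟩) = y := by
  choose r hr using fun i : Fin X.t => IsAlgClosed.exists_pow_nat_eq
    (y ^ X.p ⟨1, h1⟩ - algebraMap k Ω (X.affineParam i) * x ^ X.p ⟨0, X.t_pos⟩) (X.p_pos i)
  obtain ⟨τ, hτ⟩ := exists_algHom h1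
    (fun i => if (i : ℕ) = 0 then x else if (i : ℕ) = 1 then y else r i) fun i hi => by
      rw [if_neg (by omega), if_neg (by omega), if_neg (by simp), if_pos rfl, if_pos rfl, hr]
  exact ⟨τ, by rw [hτ, if_pos rfl], by rw [hτ, if_neg (by simp), if_pos rfl]⟩

/-- There is an algebraically closed extension of `k` with two algebraically independent elements. -/
theorem exists_algHom_algebraicClosure (k : Type u) [Field k] :
    ∃ (Ω : Type u) (_ : Field Ω) (_ : IsAlgClosed Ω) (_ : Algebra k Ω)
      (ι : Polynomial (Polynomial k) →ₐ[k] Ω), Function.Injective ι := by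
  let K := FractionRing (Polynomial (Polynomial k))
  refine ⟨AlgebraicClosure K, inferInstance, inferInstance, inferInstance,
    (IsScalarTower.toAlgHom k K (AlgebraicClosure K)).comp
      (IsScalarTower.toAlgHom k (Polynomial (Polynomial k)) K), ?_⟩
  exact (algebraMap K (AlgebraicClosure K)).injective.comp
    (IsFractionRing.injective (Polynomial (Polynomial k)) K)

/-- The degrees of the monomials in the Veronese subalgebra are killed by the characters of the
string group that vanish on `3 x₁` and on `ω`. -/
theorem IsTubular.sum_smul_eq_zero (hX : X.IsTubular) {n : ℕ} (ht : X.t = n) (hn : 0 < n)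
    {M : Type*} [AddCommGroup M] (m : Fin n → M) (c : M)
    (hm : ∀ j, X.p (Fin.cast ht.symm j) • m j = c) (h3 : 3 • m ⟨0, hn⟩ = 0)
    (hω : ((n : ℤ) - 2) • c - ∑ j, m j = 0) {d : Fin X.t →₀ ℕ}
    (hd : Finsupp.weight X.gen d ∈ Set.range hX.veroneseHom) :
    ∑ j : Fin n, d (Fin.cast ht.symm j) • m j = 0 := by
  subst ht
  let χ := X.liftHom m c hm
  obtain ⟨⟨n, z⟩, h⟩ := hd
  obtain ⟨z, rfl⟩ := ZMod.intCast_surjective z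
  rw [veroneseHom_apply] at h
  have hgen (i : Fin X.t) : χ (X.gen i) = m i := X.liftHom_gen m c hm i
  have hχ := congrArg χ h
  rw [map_add, map_zsmul, map_zsmul, map_nsmul, hgen, h3, smul_zero, zero_add,
    show χ X.dualizing = 0 from (X.liftHom_dualizing m c hm).trans hω, smul_zero,
    Finsupp.weight_eq_sum, map_sum] at hχ
  rw [hχ]
  refine Finset.sum_congr rfl fun i _ => ?_
  rw [map_nsmul, hgen]
  rfl

variable (X) in
/-- The algebra of the cubic is isomorphic to the Veronese subalgebra of the coordinate algebra in
the degrees from `ℤ 3 x₁ + ℤ ω`. -/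
def IsCubicVeronese (hX : X.IsTubular) : Prop :=
  IsSpannedByHomogeneous (Ideal.span {X.cubic}) X.cubicDegree ∧
  ∃ (_ : Algebra X.CubicAlgebra X.CoordAlgebra) (_ : IsScalarTower k X.CubicAlgebra X.CoordAlgebra),
    IsVeronese X.coordGrading X.fineCubicGrading hX.veroneseHom

/-- A criterion for the algebra of a cubic in Weierstrass form to be a Veronese subalgebra of the
coordinate algebra. Here `s` are the images of the variables; the specializations `τ` of the
coordinate algebra show that the map is injective, since an element of the kernel vanishes at a
generic point of the cubic, and `hmon` says that it is surjective onto the degrees in question. -/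
theorem IsTubular.isCubicVeronese_of_weierstrass (hX : X.IsTubular) {α a b c : k} {m : ℕ}
    (hm : 0 < m) (s : Fin 3 → X.CoordAlgebra)
    (hcub : X.cubic = weierstrassCubic α a b c ∨ X.cubic = -weierstrassCubic α a b c)
    (hhom : MvPolynomial.IsWeightedHomogeneous X.cubicDegree (weierstrassCubic α a b c)
      (3 • X.cubicDegree 0))
    (hs : ∀ j, s j ∈ X.coordGrading (3 • X.gen ⟨0, X.t_pos⟩ +
      tubularExponents X.weights j • X.dualizing))
    (hrel : MvPolynomial.aeval s (weierstrassCubic α a b c) = 0)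
    (hτ : ∀ {Ω : Type u} [Field Ω] [IsAlgClosed Ω] [Algebra k Ω] (x y : Ω), y ≠ 0 →
      ∃ τ : X.CoordAlgebra →ₐ[k] Ω, τ (s 0) = x * y ^ m ∧ τ (s 2) = x ^ 3)
    (hmon : ∀ d : Fin X.t →₀ ℕ, Finsupp.weight X.gen d ∈ Set.range hX.veroneseHom →
      ∏ i, X.coord i ^ d i ∈ (MvPolynomial.aeval s : MvPolynomial (Fin 3) k →ₐ[k] _).range) :
    X.IsCubicVeronese hX := by
  have hspan : Ideal.span {X.cubic} = Ideal.span {weierstrassCubic α a b c} := by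
    rcases hcub with h | h
    · rw [h]
    · rw [h, Ideal.span_singleton_neg]
  have hsp : IsSpannedByHomogeneous (Ideal.span {X.cubic}) X.cubicDegree :=
    ⟨_, hspan, fun f hf => ⟨3 • X.cubicDegree 0, by
      rw [Set.mem_singleton_iff.1 hf]
      exact hhom⟩⟩
  refine ⟨hsp, ?_⟩
  have hker (f) (hf : f ∈ Ideal.span {X.cubic}) : MvPolynomial.aeval s f = 0 := by
    rw [hspan, Ideal.mem_span_singleton] at hf
    obtain ⟨g, rfl⟩ := hf
    rw [map_mul, hrel, zero_mul]
  let ψ : X.CubicAlgebra →ₐ[k] X.CoordAlgebra := Ideal.Quotient.liftₐ _ (MvPolynomial.aeval s) hker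
  have hψ (f) : ψ (Ideal.Quotient.mk _ f) = MvPolynomial.aeval s f := rfl
  let : Algebra X.CubicAlgebra X.CoordAlgebra := ψ.toRingHom.toAlgebra
  have hst : IsScalarTower k X.CubicAlgebra X.CoordAlgebra :=
    IsScalarTower.of_algebraMap_eq fun r => (ψ.commutes r).symm
  refine ⟨inferInstance, hst, ?_⟩
  have hgr : IsGrading X.fineCubicGrading := isGrading_quotientGrading hsp
  have hgr' : IsGrading X.coordGrading := isGrading_quotientGrading isSpannedByHomogeneous_coordIdeal
  have hdeg (j : Fin 3) : s j ∈ X.coordGrading (hX.veroneseHom (X.cubicDegree j)) := by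
    have h := hX.veroneseHom_apply 1 (tubularExponents X.weights j)
    rw [one_smul, Int.cast_natCast, natCast_zsmul] at h
    unfold cubicDegree
    rw [h]
    exact hs j
  have hmem (h) (r : X.CubicAlgebra) (hr : r ∈ X.fineCubicGrading h) :
      ψ r ∈ X.coordGrading (hX.veroneseHom h) := by
    suffices X.fineCubicGrading h ≤ (X.coordGrading (hX.veroneseHom h)).comap ψ.toLinearMap from
      this hr
    refine quotientGrading_le fun d hd => ?_
    change MvPolynomial.aeval s (MvPolynomial.monomial d 1) ∈ X.coordGrading _
    rw [MvPolynomial.aeval_monomial, map_one, one_mul, Finsupp.prod_fintype _ _ (by simp), ← hd,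
      Finsupp.weight_eq_sum, map_sum]
    simp only [Fin.prod_univ_three, Fin.sum_univ_three, map_nsmul]
    have hpow (j : Fin 3) (n : ℕ) :
        s j ^ n ∈ X.coordGrading (n • hX.veroneseHom (X.cubicDegree j)) := by
      induction n with
      | zero =>
        rw [pow_zero, zero_smul]
        exact quotientGrading_one_mem
      | succ n ih =>
        rw [pow_succ, succ_nsmul]
        exact mul_mem_coordGrading ih (hdeg j)
    exact mul_mem_coordGrading (mul_mem_coordGrading (hpow 0 _) (hpow 1 _)) (hpow 2 _)
  refine hX.isVeronese hgr ?_ hmem ?_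
  · rw [injective_iff_map_eq_zero]
    intro r hr
    obtain ⟨F, rfl⟩ := Ideal.Quotient.mk_surjective r
    obtain ⟨Ω, _, _, _, ι, hι⟩ := exists_algHom_algebraicClosure k
    obtain ⟨τ, h0, h2⟩ := hτ (ι (Polynomial.C Polynomial.X)) (ι Polynomial.X) (by
      rw [Ne, map_eq_zero_iff ι hι]
      exact Polynomial.X_ne_zero)
    rw [Ideal.Quotient.eq_zero_iff_mem, hspan, Ideal.mem_span_singleton]
    refine weierstrassCubic_dvd_of_map_eq_zero ι hι hm (τ.comp (MvPolynomial.aeval s)) ?_ ?_ ?_ ?_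
    · rw [AlgHom.comp_apply, hrel, map_zero]
    · rw [AlgHom.comp_apply, MvPolynomial.aeval_X, h0, map_mul, map_pow]
    · rw [AlgHom.comp_apply, MvPolynomial.aeval_X, h2, map_pow]
    · rw [AlgHom.comp_apply]
      exact (congrArg τ hr).trans (map_zero τ)
  · have hproj (h) (r : X.CubicAlgebra) :
        hgr'.proj (hX.veroneseHom h) (ψ r) = ψ (hgr.proj h r) := by
      induction r using hgr.induction with
      | zero => simp
      | hom h' r hr =>
        by_cases hh : h' = h
        · subst hh
          rw [hgr.proj_same hr, hgr'.proj_same (hmem _ _ hr)]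
        · rw [hgr.proj_ne hr hh, hgr'.proj_ne (hmem _ _ hr)
            fun e => hh (hX.veroneseHom_injective e), map_zero]
      | add r r' hr hr' => rw [map_add, map_add, hr, hr', map_add, map_add]
    intro h x hx
    suffices X.coordGrading (hX.veroneseHom h) ≤ LinearMap.range ψ.toLinearMap by
      obtain ⟨r, rfl⟩ := this hx
      refine ⟨hgr.proj h r, hgr.proj_mem _ _, ?_⟩
      exact (hproj h r).symm.trans (hgr'.proj_same hx)
    refine quotientGrading_le fun d hd => ?_
    rw [mk_monomial_eq_prod]
    obtain ⟨F, hF⟩ := hmon d ⟨h, hd.symm⟩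
    exact ⟨Ideal.Quotient.mk _ F, hF⟩

end WeightedProjectiveLine

/-! ### The four tubular weight sequences -/

namespace WeightedProjectiveLine

variable {k : Type u} [Field k] {X : WeightedProjectiveLine k}

theorem prod_cast {M : Type*} [CommMonoid M] {n : ℕ} (ht : X.t = n) (f : Fin X.t → M) :
    ∏ i, f i = ∏ j, f (Fin.cast ht.symm j) := by
  subst ht
  rfl

theorem weights_eq {n : ℕ} (ht : X.t = n) {q : Fin n → ℕ}
    (hp : ∀ j, X.p (Fin.cast ht.symm j) = q j) : X.weights = List.ofFn q := by
  subst ht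
  exact congrArg List.ofFn (funext hp)

theorem smul_gen_cast {n : ℕ} (ht : X.t = n) {q : Fin n → ℕ}
    (hp : ∀ j, X.p (Fin.cast ht.symm j) = q j) (j : Fin n) :
    q j • X.gen (Fin.cast ht.symm j) = X.canonical := by
  rw [← hp]
  exact X.smul_gen _

theorem coord_two_pow_eq {n : ℕ} (ht : X.t = n + 3) {q : Fin (n + 3) → ℕ}
    (hp : ∀ j, X.p (Fin.cast ht.symm j) = q j) :
    X.coord (Fin.cast ht.symm 2) ^ q 2 = X.coord (Fin.cast ht.symm 1) ^ q 1 -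
      X.coord (Fin.cast ht.symm 0) ^ q 0 := by
  have h2 : ((Fin.cast ht.symm 2 : Fin X.t) : ℕ) = 2 := rfl
  have h := coord_pow_eq (X := X) (by omega) (Fin.cast ht.symm 2) (by omega)
  have h1 : X.affineParam (Fin.cast ht.symm 2) = 1 := by
    unfold affineParam
    rw [X.param_two _ h2]
    rfl
  rw [h1, map_one, one_mul] at h
  rw [← hp, ← hp, ← hp]
  exact h

/-- The Weierstrass cubic is homogeneous for the fine degrees if the exponents `e` of the cyclic
action satisfy a congruence for each monomial with nonzero coefficient. -/
theorem isWeightedHomogeneous_cubicDegree {α a b c : k} {n : ℕ} {e : Fin 3 → ℕ}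
    (hn : X.lcmWeights = n) (he : tubularExponents X.weights = e)
    (h : 2 * e 1 + e 2 ≡ 3 * e 0 [MOD n]) (hα : α = 0 ∨ 2 * e 2 + e 1 ≡ 3 * e 0 [MOD n])
    (ha : a = 0 ∨ 2 * e 0 + e 2 ≡ 3 * e 0 [MOD n]) (hb : b = 0 ∨ e 0 + 2 * e 2 ≡ 3 * e 0 [MOD n])
    (hc : c = 0 ∨ 3 * e 2 ≡ 3 * e 0 [MOD n]) :
    MvPolynomial.IsWeightedHomogeneous X.cubicDegree (weierstrassCubic α a b c)
      (3 • X.cubicDegree 0) := by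
  subst hn he
  simp only [← ZMod.natCast_eq_natCast_iff, Nat.cast_add, Nat.cast_mul, Nat.cast_ofNat] at *
  refine isWeightedHomogeneous_weierstrassCubic ?_ (hα.imp_right fun h => ?_)
    (ha.imp_right fun h => ?_) (hb.imp_right fun h => ?_) (hc.imp_right fun h => ?_) <;>
  refine Prod.ext (by simp [cubicDegree]) ?_ <;>
  simpa [cubicDegree] using h

theorem aeval_weierstrassCubic {A : Type*} [CommRing A] [Algebra k A] (s : Fin 3 → A)
    (α a b c : k) : MvPolynomial.aeval s (weierstrassCubic α a b c) =
      s 2 * s 1 ^ 2 + algebraMap k A α * (s 2 ^ 2 * s 1) - (s 0 ^ 3 +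
        algebraMap k A a * (s 0 ^ 2 * s 2) + algebraMap k A b * (s 0 * s 2 ^ 2) +
        algebraMap k A c * s 2 ^ 3) := by
  unfold weierstrassCubic
  simp only [map_add, map_sub, map_mul, map_pow, MvPolynomial.aeval_X, MvPolynomial.aeval_C]

theorem mem_range_aeval {A : Type*} [CommRing A] [Algebra k A] (s : Fin 3 → A) (j : Fin 3) :
    s j ∈ (MvPolynomial.aeval s : MvPolynomial (Fin 3) k →ₐ[k] A).range :=
  ⟨MvPolynomial.X j, MvPolynomial.aeval_X s j⟩

theorem dualizing_eq {n : ℕ} (ht : X.t = n) :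
    X.dualizing = ((n : ℤ) - 2) • X.canonical - ∑ j, X.gen (Fin.cast ht.symm j) := by
  subst ht
  rfl

theorem coord_mul_mem (i j : Fin X.t) :
    X.coord i * X.coord j ∈ X.coordGrading (X.gen i + X.gen j) :=
  mul_mem_coordGrading (coord_mem i) (coord_mem j)

theorem coord_mul_mul_mem (i j l : Fin X.t) :
    X.coord i * X.coord j * X.coord l ∈ X.coordGrading (X.gen i + X.gen j + X.gen l) :=
  mul_mem_coordGrading (coord_mul_mem i j) (coord_mem l)

theorem forall_fin_three {P : Fin 3 → Prop} (h0 : P 0) (h1 : P 1) (h2 : P 2) (j : Fin 3) : P j := by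
  fin_cases j
  exacts [h0, h1, h2]

theorem mem_coordGrading_of_eq {g h : X.StringGroup} {a : X.CoordAlgebra} (e : g = h)
    (ha : a ∈ X.coordGrading g) : a ∈ X.coordGrading h := e ▸ ha

theorem coord_pow_mem_add_zero (i : Fin X.t) (n : ℕ) :
    X.coord i ^ n ∈ X.coordGrading (n • X.gen i + 0 • X.dualizing) := by
  rw [zero_smul, add_zero]
  exact coord_pow_mem i n

/-- The degrees of `X₁ X₂` and `X₃` are `3 x₁ + 2 ω` and `3 x₁ + 3 ω`. -/
theorem degrees_632 {M : Type*} [AddCommGroup M] {x y z c : M} (hy : 3 • y = c)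
    (hz : 2 • z = c) : x + y = 3 • x + 2 • (((3 : ℕ) - 2 : ℤ) • c - (x + y + z)) ∧
      z = 3 • x + 3 • (((3 : ℕ) - 2 : ℤ) • c - (x + y + z)) := by
  subst hz
  constructor
  · linear_combination (norm := module) hy
  · linear_combination (norm := module) hy

/-- Weights `(6, 3, 2)`: the variables `X`, `Y`, `Z` of the cubic correspond to `X₁ X₂`, `X₃`, `X₁³`.
The degrees of the monomials are detected by one character with values in `ℤ / 3`. -/
theorem IsTubular.isCubicVeronese_632 (hX : X.IsTubular) (ht : X.t = 3)
    (hp : ∀ j, X.p (Fin.cast ht.symm j) = ![6, 3, 2] j) : X.IsCubicVeronese hX := by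
  have hw : X.weights = [6, 3, 2] := weights_eq ht hp
  have he : tubularExponents X.weights = ![2, 3, 0] := by rw [hw]; rfl
  have hn : X.lcmWeights = 6 := by unfold lcmWeights; rw [hw]; rfl
  have hg := smul_gen_cast ht hp
  have hr : X.coord (Fin.cast ht.symm 2) ^ 2 = X.coord (Fin.cast ht.symm 1) ^ 3 -
      X.coord (Fin.cast ht.symm 0) ^ 6 := coord_two_pow_eq (n := 0) ht hp
  have hdeg := degrees_632 (x := X.gen (Fin.cast ht.symm 0)) (hg 1) (hg 2)
  rw [← Fin.sum_univ_three fun j => X.gen (Fin.cast ht.symm j), ← dualizing_eq ht] at hdeg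
  obtain ⟨s, hs⟩ : ∃ s : Fin 3 → X.CoordAlgebra, s =
    ![X.coord (Fin.cast ht.symm 0) * X.coord (Fin.cast ht.symm 1), X.coord (Fin.cast ht.symm 2),
      X.coord (Fin.cast ht.symm 0) ^ 3] := ⟨_, rfl⟩
  have hs0 : s 0 = X.coord (Fin.cast ht.symm 0) * X.coord (Fin.cast ht.symm 1) := by rw [hs]; rfl
  have hs1 : s 1 = X.coord (Fin.cast ht.symm 2) := by rw [hs]; rfl
  have hs2 : s 2 = X.coord (Fin.cast ht.symm 0) ^ 3 := by rw [hs]; rfl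
  refine hX.isCubicVeronese_of_weierstrass (α := 0) (a := 0) (b := 0) (c := -1) one_pos s
    (Or.inl ?_) (isWeightedHomogeneous_cubicDegree hn he rfl (Or.inl rfl) (Or.inl rfl) (Or.inl rfl)
      (Or.inr rfl)) ?_ ?_ ?_ ?_
  · unfold cubic
    rw [hw]
    simp only [tubularCubic, weierstrassCubic, map_neg, map_one, map_zero]
    ring
  · rw [he]
    refine forall_fin_three ?_ ?_ ?_
    · rw [hs0]
      exact mem_coordGrading_of_eq hdeg.1 (coord_mul_mem _ _)
    · rw [hs1]
      exact mem_coordGrading_of_eq hdeg.2 (coord_mem (Fin.cast ht.symm 2))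
    · rw [hs2]
      exact coord_pow_mem_add_zero _ _
  · rw [aeval_weierstrassCubic, hs0, hs1, hs2, map_zero, map_neg, map_one]
    linear_combination X.coord (Fin.cast ht.symm 0) ^ 3 * hr
  · intro Ω _ _ _ x y hy
    obtain ⟨τ, h0, h1⟩ := exists_algHom_of_isAlgClosed (X := X) (by omega) x y
    refine ⟨τ, ?_, ?_⟩
    · rw [hs0, map_mul, pow_one]
      exact congrArg₂ _ h0 h1
    · rw [hs2, map_pow]
      exact congrArg (· ^ 3) h0
  · intro d hd
    have h := hX.sum_smul_eq_zero ht three_pos (M := ZMod 3) ![1, 2, 0] 0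
      (fun j => by rw [hp]; revert j; decide) (by decide) (by decide) hd
    rw [Fin.sum_univ_three] at h
    have hT := mem_range_aeval (k := k) s
    rw [prod_cast ht, Fin.prod_univ_three]
    refine monomial_mem_632 (hs2 ▸ hT 2) (hs0 ▸ hT 0) (hs1 ▸ hT 1) hr ?_
    rw [← ZMod.natCast_eq_zero_iff]
    simpa using h

/-- The degrees of `X₁ X₂²` and `X₂ X₃` are `3 x₁ + 2 ω` and `3 x₁ + 3 ω`. -/
theorem degrees_442 {M : Type*} [AddCommGroup M] {x y z c : M} (hy : 4 • y = c)
    (hz : 2 • z = c) : x + 2 • y = 3 • x + 2 • (((3 : ℕ) - 2 : ℤ) • c - (x + y + z)) ∧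
      y + z = 3 • x + 3 • (((3 : ℕ) - 2 : ℤ) • c - (x + y + z)) := by
  subst hz
  constructor
  · linear_combination (norm := module) hy
  · linear_combination (norm := module) hy

/-- Weights `(4, 4, 2)`: the variables `X`, `Y`, `Z` of the cubic correspond to `X₁ X₂²`, `X₂ X₃`,
`X₁³`. The degrees of the monomials are detected by one character with values in `ℤ / 6`. -/
theorem IsTubular.isCubicVeronese_442 (hX : X.IsTubular) (ht : X.t = 3)
    (hp : ∀ j, X.p (Fin.cast ht.symm j) = ![4, 4, 2] j) : X.IsCubicVeronese hX := by
  have hw : X.weights = [4, 4, 2] := weights_eq ht hp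
  have he : tubularExponents X.weights = ![2, 3, 0] := by rw [hw]; rfl
  have hn : X.lcmWeights = 4 := by unfold lcmWeights; rw [hw]; rfl
  have hg := smul_gen_cast ht hp
  have hr : X.coord (Fin.cast ht.symm 2) ^ 2 = X.coord (Fin.cast ht.symm 1) ^ 4 -
      X.coord (Fin.cast ht.symm 0) ^ 4 := coord_two_pow_eq (n := 0) ht hp
  have hdeg := degrees_442 (x := X.gen (Fin.cast ht.symm 0)) (hg 1) (hg 2)
  rw [← Fin.sum_univ_three fun j => X.gen (Fin.cast ht.symm j), ← dualizing_eq ht] at hdeg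
  obtain ⟨s, hs⟩ : ∃ s : Fin 3 → X.CoordAlgebra, s =
    ![X.coord (Fin.cast ht.symm 0) * X.coord (Fin.cast ht.symm 1) ^ 2,
      X.coord (Fin.cast ht.symm 1) * X.coord (Fin.cast ht.symm 2),
      X.coord (Fin.cast ht.symm 0) ^ 3] := ⟨_, rfl⟩
  have hs0 : s 0 = X.coord (Fin.cast ht.symm 0) * X.coord (Fin.cast ht.symm 1) ^ 2 := by
    rw [hs]; rfl
  have hs1 : s 1 = X.coord (Fin.cast ht.symm 1) * X.coord (Fin.cast ht.symm 2) := by rw [hs]; rfl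
  have hs2 : s 2 = X.coord (Fin.cast ht.symm 0) ^ 3 := by rw [hs]; rfl
  refine hX.isCubicVeronese_of_weierstrass (α := 0) (a := 0) (b := -1) (c := 0) two_pos s
    (Or.inl ?_) (isWeightedHomogeneous_cubicDegree hn he rfl (Or.inl rfl) (Or.inl rfl) (Or.inr rfl)
      (Or.inl rfl)) ?_ ?_ ?_ ?_
  · unfold cubic
    rw [hw]
    simp only [tubularCubic, weierstrassCubic, map_neg, map_one, map_zero]
    ring
  · rw [he]
    refine forall_fin_three ?_ ?_ ?_
    · rw [hs0]
      exact mem_coordGrading_of_eq hdeg.1 (mul_mem_coordGrading (coord_mem _) (coord_pow_mem _ _))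
    · rw [hs1]
      exact mem_coordGrading_of_eq hdeg.2 (coord_mul_mem _ _)
    · rw [hs2]
      exact coord_pow_mem_add_zero _ _
  · rw [aeval_weierstrassCubic, hs0, hs1, hs2, map_zero, map_neg, map_one]
    linear_combination
      X.coord (Fin.cast ht.symm 0) ^ 3 * X.coord (Fin.cast ht.symm 1) ^ 2 * hr
  · intro Ω _ _ _ x y hy
    obtain ⟨τ, h0, h1⟩ := exists_algHom_of_isAlgClosed (X := X) (by omega) x y
    refine ⟨τ, ?_, ?_⟩
    · rw [hs0, map_mul, map_pow]
      exact congrArg₂ (· * · ^ 2) h0 h1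
    · rw [hs2, map_pow]
      exact congrArg (· ^ 3) h0
  · intro d hd
    have h := hX.sum_smul_eq_zero ht three_pos (M := ZMod 6) ![4, 1, 5] 4
      (fun j => by rw [hp]; revert j; decide) (by decide) (by decide) hd
    rw [Fin.sum_univ_three] at h
    have hT := mem_range_aeval (k := k) s
    rw [prod_cast ht, Fin.prod_univ_three]
    refine monomial_mem_442 (hs2 ▸ hT 2) (hs0 ▸ hT 0) (hs1 ▸ hT 1) hr ?_
    rw [← ZMod.natCast_eq_zero_iff]
    simpa using h

/-- The degrees of `X₁ X₂ X₃` and `X₂³` are `3 x₁ + 2 ω` and `3 x₁`. -/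
theorem degrees_333 {M : Type*} [AddCommGroup M] {x y z c : M} (hx : 3 • x = c) (hy : 3 • y = c)
    (hz : 3 • z = c) : x + y + z = 3 • x + 2 • (((3 : ℕ) - 2 : ℤ) • c - (x + y + z)) ∧
      3 • y = 3 • x + 0 • (((3 : ℕ) - 2 : ℤ) • c - (x + y + z)) := by
  subst hz
  constructor
  · linear_combination (norm := module) hy
  · linear_combination (norm := module) hy - hx

/-- For the weights `(3, 3, 3)`, the first coordinate and the product of the other two can be
prescribed: with `w` the second coordinate and `y / w` the third, the condition is a quadratic
equation for `w ^ 3`. -/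
theorem exists_algHom_333 (ht : X.t = 3) (hp : ∀ j, X.p (Fin.cast ht.symm j) = ![3, 3, 3] j)
    {Ω : Type*} [Field Ω] [IsAlgClosed Ω] [Algebra k Ω] (x : Ω) {y : Ω} (hy : y ≠ 0) :
    ∃ τ : X.CoordAlgebra →ₐ[k] Ω, τ (X.coord (Fin.cast ht.symm 0) * X.coord (Fin.cast ht.symm 1) *
      X.coord (Fin.cast ht.symm 2)) = x * y ∧ τ (X.coord (Fin.cast ht.symm 0)) = x := by
  obtain ⟨v, hv⟩ := IsAlgClosed.exists_root (Polynomial.X ^ 2 - Polynomial.C (x ^ 3) *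
    Polynomial.X - Polynomial.C (y ^ 3)) (by
      have h : (Polynomial.X ^ 2 - Polynomial.C (x ^ 3) * Polynomial.X -
        Polynomial.C (y ^ 3)).degree = 2 := by compute_degree!
      rw [h]
      decide)
  obtain ⟨w, rfl⟩ := IsAlgClosed.exists_pow_nat_eq v three_pos
  simp only [Polynomial.IsRoot.def, Polynomial.eval_sub, Polynomial.eval_mul,
    Polynomial.eval_pow, Polynomial.eval_X, Polynomial.eval_C] at hv
  have hw0 : w ≠ 0 := by
    rintro rfl
    exact hy (by simpa using hv)
  obtain ⟨τ, hτ⟩ := exists_algHom (X := X) (by omega)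
    (fun i => ![x, w, y / w] (Fin.cast ht i)) fun i hi => by
      obtain ⟨i, rfl⟩ := (finCongr ht.symm).surjective i
      obtain rfl : i = 2 := Fin.ext (by have := i.2; change 2 ≤ (i : ℕ) at hi; omega)
      have h1 : X.affineParam (Fin.cast ht.symm 2) = 1 := by
        unfold affineParam
        rw [X.param_two _ rfl]
        rfl
      change (y / w) ^ X.p (Fin.cast ht.symm 2) = w ^ X.p (Fin.cast ht.symm 1) -
        algebraMap k Ω (X.affineParam (Fin.cast ht.symm 2)) * x ^ X.p (Fin.cast ht.symm 0)
      rw [hp, hp, hp, h1, map_one, one_mul]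
      change (y / w) ^ 3 = w ^ 3 - x ^ 3
      field_simp
      linear_combination -hv
  refine ⟨τ, ?_, hτ _⟩
  rw [map_mul, map_mul, hτ, hτ, hτ]
  change x * w * (y / w) = x * y
  field_simp

/-- Weights `(3, 3, 3)`: the variables `X`, `Y`, `Z` of the cubic correspond to `X₁ X₂ X₃`, `X₂³`,
`X₁³`. The degrees of the monomials are detected by two characters with values in `ℤ / 3`. -/
theorem IsTubular.isCubicVeronese_333 (hX : X.IsTubular) (ht : X.t = 3)
    (hp : ∀ j, X.p (Fin.cast ht.symm j) = ![3, 3, 3] j) : X.IsCubicVeronese hX := by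
  have hw : X.weights = [3, 3, 3] := weights_eq ht hp
  have he : tubularExponents X.weights = ![2, 0, 0] := by rw [hw]; rfl
  have hn : X.lcmWeights = 3 := by unfold lcmWeights; rw [hw]; rfl
  have hg := smul_gen_cast ht hp
  have hr : X.coord (Fin.cast ht.symm 2) ^ 3 = X.coord (Fin.cast ht.symm 1) ^ 3 -
      X.coord (Fin.cast ht.symm 0) ^ 3 := coord_two_pow_eq (n := 0) ht hp
  have hdeg := degrees_333 (hg 0) (hg 1) (hg 2)
  rw [← Fin.sum_univ_three fun j => X.gen (Fin.cast ht.symm j), ← dualizing_eq ht] at hdeg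
  obtain ⟨s, hs⟩ : ∃ s : Fin 3 → X.CoordAlgebra, s =
    ![X.coord (Fin.cast ht.symm 0) * X.coord (Fin.cast ht.symm 1) * X.coord (Fin.cast ht.symm 2),
      X.coord (Fin.cast ht.symm 1) ^ 3, X.coord (Fin.cast ht.symm 0) ^ 3] := ⟨_, rfl⟩
  have hs0 : s 0 = X.coord (Fin.cast ht.symm 0) * X.coord (Fin.cast ht.symm 1) *
    X.coord (Fin.cast ht.symm 2) := by rw [hs]; rfl
  have hs1 : s 1 = X.coord (Fin.cast ht.symm 1) ^ 3 := by rw [hs]; rfl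
  have hs2 : s 2 = X.coord (Fin.cast ht.symm 0) ^ 3 := by rw [hs]; rfl
  refine hX.isCubicVeronese_of_weierstrass (α := -1) (a := 0) (b := 0) (c := 0) one_pos s
    (Or.inr ?_) (isWeightedHomogeneous_cubicDegree hn he rfl (Or.inr rfl) (Or.inl rfl) (Or.inl rfl)
      (Or.inl rfl)) ?_ ?_ ?_ ?_
  · unfold cubic
    rw [hw]
    simp only [tubularCubic, weierstrassCubic, map_neg, map_one, map_zero]
    ring
  · rw [he]
    refine forall_fin_three ?_ ?_ ?_
    · rw [hs0]
      exact mem_coordGrading_of_eq ((Fin.sum_univ_three _).symm.trans hdeg.1)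
        (coord_mul_mul_mem _ _ _)
    · rw [hs1]
      exact mem_coordGrading_of_eq hdeg.2 (coord_pow_mem (Fin.cast ht.symm 1) 3)
    · rw [hs2]
      exact coord_pow_mem_add_zero _ _
  · rw [aeval_weierstrassCubic, hs0, hs1, hs2, map_zero, map_neg, map_one]
    linear_combination
      -X.coord (Fin.cast ht.symm 0) ^ 3 * X.coord (Fin.cast ht.symm 1) ^ 3 * hr
  · intro Ω _ _ _ x y hy
    obtain ⟨τ, h, h0⟩ := exists_algHom_333 ht hp x hy
    refine ⟨τ, ?_, ?_⟩
    · rw [hs0, h, pow_one]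
    · rw [hs2, map_pow, h0]
  · intro d hd
    have h := hX.sum_smul_eq_zero ht three_pos (M := ZMod 3) ![1, 0, 2] 0
      (fun j => by rw [hp]; revert j; decide) (by decide) (by decide) hd
    have h' := hX.sum_smul_eq_zero ht three_pos (M := ZMod 3) ![0, 1, 2] 0
      (fun j => by rw [hp]; revert j; decide) (by decide) (by decide) hd
    rw [Fin.sum_univ_three] at h h'
    have hT := mem_range_aeval (k := k) s
    rw [prod_cast ht, Fin.prod_univ_three]
    refine monomial_mem_333 (hs2 ▸ hT 2) (hs0 ▸ hT 0) (hs1 ▸ hT 1) hr ?_ ?_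
    · rw [← ZMod.natCast_eq_zero_iff]
      simpa using h
    · rw [← ZMod.natCast_eq_zero_iff]
      simpa using h'

/-- The degrees of `X₁ X₂²` and `X₂ X₃ X₄` are `3 x₁` and `3 x₁ + ω`. -/
theorem degrees_2222 {M : Type*} [AddCommGroup M] {x y z w c : M} (hx : 2 • x = c)
    (hy : 2 • y = c) (hz : 2 • z = c) (hw : 2 • w = c) :
    x + 2 • y = 3 • x + 0 • (((4 : ℕ) - 2 : ℤ) • c - (x + y + z + w)) ∧
      y + z + w = 3 • x + 1 • (((4 : ℕ) - 2 : ℤ) • c - (x + y + z + w)) := by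
  subst hx
  constructor
  · linear_combination (norm := module) hy
  · linear_combination (norm := module) hy + hz + hw

/-- Weights `(2, 2, 2, 2)`: the variables `X`, `Y`, `Z` of the cubic correspond to `X₁ X₂²`,
`X₂ X₃ X₄`, `X₁³`. The degrees of the monomials are detected by two characters with values in
`ℤ / 2` and one with values in `ℤ / 3`. -/
theorem IsTubular.isCubicVeronese_2222 (hX : X.IsTubular) (ht : X.t = 4)
    (hp : ∀ j, X.p (Fin.cast ht.symm j) = 2) : X.IsCubicVeronese hX := by
  have hw : X.weights = [2, 2, 2, 2] := weights_eq ht hp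
  have he : tubularExponents X.weights = ![0, 1, 0] := by rw [hw]; rfl
  have hn : X.lcmWeights = 2 := by unfold lcmWeights; rw [hw]; rfl
  have hg := smul_gen_cast ht hp
  have hr : X.coord (Fin.cast ht.symm 2) ^ 2 = X.coord (Fin.cast ht.symm 1) ^ 2 -
      X.coord (Fin.cast ht.symm 0) ^ 2 := coord_two_pow_eq (n := 1) ht hp
  have hr' : X.coord (Fin.cast ht.symm 3) ^ 2 = X.coord (Fin.cast ht.symm 1) ^ 2 -
      algebraMap k _ X.lam * X.coord (Fin.cast ht.symm 0) ^ 2 := by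
    have h3 : ((Fin.cast ht.symm 3 : Fin X.t) : ℕ) = 3 := rfl
    have h := coord_pow_eq (X := X) (by omega) (Fin.cast ht.symm 3) (by omega)
    change X.coord _ ^ X.p _ = X.coord (Fin.cast ht.symm 1) ^ X.p (Fin.cast ht.symm 1) -
      _ * X.coord (Fin.cast ht.symm 0) ^ X.p (Fin.cast ht.symm 0) at h
    rw [hp, hp, hp] at h
    unfold lam
    rw [dif_pos (by omega)]
    exact h
  have hdeg := degrees_2222 (hg 0) (hg 1) (hg 2) (hg 3)
  rw [← Fin.sum_univ_four fun j => X.gen (Fin.cast ht.symm j), ← dualizing_eq ht] at hdeg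
  obtain ⟨s, hs⟩ : ∃ s : Fin 3 → X.CoordAlgebra, s =
    ![X.coord (Fin.cast ht.symm 0) * X.coord (Fin.cast ht.symm 1) ^ 2,
      X.coord (Fin.cast ht.symm 1) * X.coord (Fin.cast ht.symm 2) * X.coord (Fin.cast ht.symm 3),
      X.coord (Fin.cast ht.symm 0) ^ 3] := ⟨_, rfl⟩
  have hs0 : s 0 = X.coord (Fin.cast ht.symm 0) * X.coord (Fin.cast ht.symm 1) ^ 2 := by
    rw [hs]; rfl
  have hs1 : s 1 = X.coord (Fin.cast ht.symm 1) * X.coord (Fin.cast ht.symm 2) *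
    X.coord (Fin.cast ht.symm 3) := by rw [hs]; rfl
  have hs2 : s 2 = X.coord (Fin.cast ht.symm 0) ^ 3 := by rw [hs]; rfl
  refine hX.isCubicVeronese_of_weierstrass (α := 0) (a := -(1 + X.lam)) (b := X.lam) (c := 0)
    two_pos s (Or.inl ?_) (isWeightedHomogeneous_cubicDegree hn he rfl (Or.inl rfl) (Or.inr rfl)
      (Or.inr rfl) (Or.inl rfl)) ?_ ?_ ?_ ?_
  · unfold cubic
    rw [hw]
    simp only [tubularCubic, weierstrassCubic, map_neg, map_add, map_one, map_zero]
    ring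
  · rw [he]
    refine forall_fin_three ?_ ?_ ?_
    · rw [hs0]
      exact mem_coordGrading_of_eq hdeg.1 (mul_mem_coordGrading (coord_mem _) (coord_pow_mem _ _))
    · rw [hs1]
      exact mem_coordGrading_of_eq hdeg.2 (coord_mul_mul_mem _ _ _)
    · rw [hs2]
      exact coord_pow_mem_add_zero _ _
  · rw [aeval_weierstrassCubic, hs0, hs1, hs2, map_zero, map_neg, map_add, map_one]
    linear_combination
      X.coord (Fin.cast ht.symm 0) ^ 3 * X.coord (Fin.cast ht.symm 1) ^ 2 *
        (X.coord (Fin.cast ht.symm 3) ^ 2 * hr + (X.coord (Fin.cast ht.symm 1) ^ 2 -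
          X.coord (Fin.cast ht.symm 0) ^ 2) * hr')
  · intro Ω _ _ _ x y hy
    obtain ⟨τ, h0, h1⟩ := exists_algHom_of_isAlgClosed (X := X) (by omega) x y
    refine ⟨τ, ?_, ?_⟩
    · rw [hs0, map_mul, map_pow]
      exact congrArg₂ (· * · ^ 2) h0 h1
    · rw [hs2, map_pow]
      exact congrArg (· ^ 3) h0
  · intro d hd
    have h := hX.sum_smul_eq_zero ht four_pos (M := ZMod 2) ![0, 1, 0, 1] 0
      (fun j => by rw [hp]; revert j; decide) (by decide) (by decide) hd
    have h' := hX.sum_smul_eq_zero ht four_pos (M := ZMod 2) ![0, 0, 1, 1] 0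
      (fun j => by rw [hp]; revert j; decide) (by decide) (by decide) hd
    have h'' := hX.sum_smul_eq_zero ht four_pos (M := ZMod 3) ![1, 1, 1, 1] 2
      (fun j => by rw [hp]; revert j; decide) (by decide) (by decide) hd
    rw [Fin.sum_univ_four] at h h' h''
    have hT := mem_range_aeval (k := k) s
    rw [prod_cast ht, Fin.prod_univ_four]
    refine monomial_mem_2222 X.lam (hs2 ▸ hT 2) (hs0 ▸ hT 0) (hs1 ▸ hT 1) hr hr' ?_ ?_ ?_
    · rw [← ZMod.natCast_eq_zero_iff]
      simpa using h
    · rw [← ZMod.natCast_eq_zero_iff]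
      simpa using h'
    · rw [← ZMod.natCast_eq_zero_iff]
      simpa using h''

theorem IsTubular.isCubicVeronese (hX : X.IsTubular) : X.IsCubicVeronese hX := by
  rcases hX.classification with ⟨ht, hp⟩ | ⟨ht, hp | hp | hp⟩
  exacts [hX.isCubicVeronese_2222 ht hp, hX.isCubicVeronese_333 ht hp,
    hX.isCubicVeronese_442 ht hp, hX.isCubicVeronese_632 ht hp]

end WeightedProjectiveLine

/-! ### Splitting fields of cyclic groups -/

/-- A generator of the cyclic group acts on `kⁿ` by roots of unity of `k`, hence its order divides
their number. -/
theorem IsSplittingFieldOfGroup.exists_isPrimitiveRoot {k : Type u} [Field k] {p : ℕ} [NeZero p]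
    (h : IsSplittingFieldOfGroup k (Multiplicative (ZMod p))) : ∃ ζ : kˣ, IsPrimitiveRoot ζ p := by
  obtain ⟨n, ⟨e⟩⟩ := h
  let m := Nat.card (rootsOfUnity p k)
  have hg : (Multiplicative.ofAdd (1 : ZMod p)) ^ p = 1 := by
    rw [← ofAdd_nsmul, nsmul_one, ZMod.natCast_self, ofAdd_zero]
  let f : Multiplicative (ZMod p) →* (Fin n → k) :=
    (e : MonoidAlgebra k (Multiplicative (ZMod p)) →* (Fin n → k)).comp (MonoidAlgebra.of k _)
  have hf : Function.Injective f := e.injective.comp MonoidAlgebra.of_injective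
  have hm : f (Multiplicative.ofAdd 1) ^ m = 1 := by
    funext i
    have hi : f (Multiplicative.ofAdd 1) i ^ p = 1 := by
      rw [← Pi.pow_apply, ← map_pow, hg, map_one, Pi.one_apply]
    have := pow_card_eq_one' (G := rootsOfUnity p k) (x := rootsOfUnity.mkOfPowEq _ hi)
    have h2 := congrArg (fun u : rootsOfUnity p k => ((u : kˣ) : k)) this
    simp only [Subgroup.coe_pow, Units.val_pow_eq_pow_val, rootsOfUnity.val_mkOfPowEq_coe,
      Subgroup.coe_one, Units.val_one] at h2
    exact h2
  rw [← map_pow, ← map_one f, hf.eq_iff, ← ofAdd_nsmul, nsmul_one, ofAdd_eq_one,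
    ZMod.natCast_eq_zero_iff] at hm
  have hle : m ≤ p := card_rootsOfUnity k p
  have hp : m = p := le_antisymm hle (Nat.le_of_dvd Nat.card_pos hm)
  obtain ⟨ζ, hζ⟩ := card_rootsOfUnity_eq_iff_exists_isPrimitiveRoot.1 hp
  exact ⟨(hζ.isUnit (NeZero.ne p)).unit, IsPrimitiveRoot.coe_units_iff.1 hζ⟩

/-! ### The two equivalences -/

namespace WeightedProjectiveLine

variable {k : Type u} [Field k] {X : WeightedProjectiveLine k}

theorem IsTubular.isCoarsening_fineCubicGrading (hX : X.IsTubular) :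
    IsCoarsening X.fineCubicGrading X.cubicGrading
      (AddMonoidHom.fst ℤ (ZMod X.lcmWeights)) :=
  isCoarsening_quotientGrading (q := AddMonoidHom.fst ℤ (ZMod X.lcmWeights)) hX.isCubicVeronese.1
    fun n => ⟨(n, 0), rfl⟩

theorem IsTubular.positivelyGraded_fineCubicGrading (hX : X.IsTubular) :
    PositivelyGraded X.fineCubicGrading (AddMonoidHom.fst ℤ (ZMod X.lcmWeights)) :=
  positivelyGraded_quotientGrading hX.isCubicVeronese.1 _ fun _ => one_pos

theorem IsTubular.positivelyGraded_cubicGrading (hX : X.IsTubular) :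
    PositivelyGraded X.cubicGrading (AddMonoidHom.id ℤ) :=
  positivelyGraded_quotientGrading
    (hX.isCubicVeronese.1.comp (AddMonoidHom.fst ℤ (ZMod X.lcmWeights))) _ fun _ => one_pos

variable (X) in
/-- The quotient of the string group by `ℤ ω`. -/
def OrbitGroup : Type := X.StringGroup ⧸ AddSubgroup.zmultiples X.dualizing

noncomputable instance : AddCommGroup X.OrbitGroup :=
  inferInstanceAs (AddCommGroup (X.StringGroup ⧸ AddSubgroup.zmultiples X.dualizing))

variable (X) in
/-- The projection of the string group onto its quotient by `ℤ ω`. -/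
noncomputable def orbitMap : X.StringGroup →+ X.OrbitGroup :=
  QuotientAddGroup.mk' (AddSubgroup.zmultiples X.dualizing)

theorem orbitMap_eq_zero_iff {x : X.StringGroup} :
    X.orbitMap x = 0 ↔ x ∈ AddSubgroup.zmultiples X.dualizing :=
  QuotientAddGroup.eq_zero_iff x

variable (X) in
/-- The grading of the coordinate algebra by the quotient of the string group by `ℤ ω`. -/
noncomputable def orbitGrading : X.OrbitGroup → Submodule k X.CoordAlgebra :=
  quotientGrading X.coordIdeal (X.orbitMap ∘ X.gen)

theorem isCoarsening_orbitGrading : IsCoarsening X.coordGrading X.orbitGrading X.orbitMap :=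
  isCoarsening_quotientGrading isSpannedByHomogeneous_coordIdeal
    (QuotientAddGroup.mk'_surjective _)

/-- The degree homomorphism factors through the quotient by `ℤ ω`. -/
noncomputable def IsTubular.orbitDegree (hX : X.IsTubular) :
    X.OrbitGroup →+ ℤ :=
  QuotientAddGroup.lift _ X.degreeHom (by
    rw [AddSubgroup.zmultiples_le]
    exact hX.degreeHom_dualizing_eq_zero)

theorem IsTubular.orbitDegree_orbitMap (hX : X.IsTubular) (x : X.StringGroup) :
    hX.orbitDegree (X.orbitMap x) = X.degreeHom x := rfl

theorem IsTubular.positivelyGraded_orbitGrading (hX : X.IsTubular) :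
    PositivelyGraded X.orbitGrading hX.orbitDegree := by
  refine positivelyGraded_quotientGrading (isSpannedByHomogeneous_coordIdeal.comp X.orbitMap)
    hX.orbitDegree fun i => ?_
  rw [Function.comp_apply, orbitDegree_orbitMap]
  exact X.degreeHom_gen_pos i

variable (X) in
/-- The homomorphism induced by `veroneseHom` modulo `ℤ ω`. -/
noncomputable def orbitVeroneseHom : ℤ →+ X.OrbitGroup :=
  zmultiplesHom _ (X.orbitMap (3 • X.gen ⟨0, X.t_pos⟩))

theorem orbitVeroneseHom_apply (n : ℤ) :
    X.orbitVeroneseHom n = X.orbitMap (n • 3 • X.gen ⟨0, X.t_pos⟩) := by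
  rw [map_zsmul]
  rfl

theorem IsTubular.orbitVeroneseHom_injective (hX : X.IsTubular) :
    Function.Injective X.orbitVeroneseHom := by
  rw [injective_iff_map_eq_zero]
  intro n hn
  have h := congrArg hX.orbitDegree hn
  rw [orbitVeroneseHom_apply, orbitDegree_orbitMap, map_zsmul, map_zero, map_nsmul, smul_eq_mul,
    nsmul_eq_mul, mul_eq_zero] at h
  have hpos := X.degreeHom_gen_pos ⟨0, X.t_pos⟩
  refine h.resolve_right fun h' => ?_
  push_cast at h'
  omega

theorem IsTubular.orbitVeroneseHom_fst (hX : X.IsTubular) (h : ℤ × ZMod X.lcmWeights) :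
    X.orbitVeroneseHom (AddMonoidHom.fst ℤ (ZMod X.lcmWeights) h) =
      X.orbitMap (hX.veroneseHom h) := by
  obtain ⟨n, m⟩ := h
  obtain ⟨m, rfl⟩ := ZMod.intCast_surjective m
  rw [hX.veroneseHom_apply, map_add, orbitMap_eq_zero_iff.2
    (zsmul_mem (AddSubgroup.mem_zmultiples _) m), add_zero]
  exact orbitVeroneseHom_apply n

theorem IsTubular.exists_veroneseHom_eq (hX : X.IsTubular) (g : X.StringGroup)
    (hg : X.orbitMap g = 0) :
    ∃ h, hX.veroneseHom h = g ∧ AddMonoidHom.fst ℤ (ZMod X.lcmWeights) h = 0 := by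
  obtain ⟨m, rfl⟩ := orbitMap_eq_zero_iff.1 hg
  refine ⟨(0, (m : ZMod X.lcmWeights)), ?_, rfl⟩
  rw [hX.veroneseHom_apply, zero_smul, zero_add]

/-- The equivariantization of `qmod-S` for the shifts by `ℤ ω` is `qmod-S` for the grading of `S` by
the quotient of the string group by `ℤ ω`. -/
theorem IsTubular.nonempty_orbit_equivalence (hX : X.IsTubular) :
    Nonempty (QMod X.orbitGrading ≌ (qmodShiftAction X.coordGrading
      (AddSubgroup.zmultiples X.dualizing)).EquivariantObject) :=
  GradedModFP.nonempty_qmod_equivalence_shift isCoarsening_orbitGrading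
    (QuotientAddGroup.ker_mk' _) (IsOfFinAddOrder.finite_zmultiples hX).to_subtype
    positivelyGraded_coordGrading hX.positivelyGraded_orbitGrading

/-- The algebra of the cubic with its grading by `ℤ` is a Veronese subalgebra of the coordinate
algebra graded by the quotient of the string group by `ℤ ω`. -/
theorem IsTubular.nonempty_shift_equivalence (hX : X.IsTubular) :
    Nonempty ((qmodShiftAction X.coordGrading
        (AddSubgroup.zmultiples X.dualizing)).EquivariantObject ≌ QMod X.cubicGrading) := by
  obtain ⟨-, _, _, hψ⟩ := hX.isCubicVeronese
  have hV : IsVeronese X.orbitGrading X.cubicGrading X.orbitVeroneseHom :=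
    hψ.coarsen isCoarsening_orbitGrading hX.isCoarsening_fineCubicGrading
      hX.orbitVeroneseHom_injective hX.orbitVeroneseHom_fst hX.exists_veroneseHom_eq
  obtain ⟨e⟩ := hX.nonempty_orbit_equivalence
  obtain ⟨e'⟩ := hV.nonempty_qmod_equivalence hX.positivelyGraded_orbitGrading
    hX.positivelyGraded_cubicGrading
  exact ⟨e.symm.trans e'⟩

/-- The generator of `C_p` acts on a homogeneous component of the fine grading by the power of the
root of unity given by the degree. -/
theorem cyclicAction_apply (ζ : kˣ) (hζ : IsPrimitiveRoot ζ X.lcmWeights) [NeZero X.lcmWeights]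
    (g : ZMod X.lcmWeights) (x : ℤ × ZMod X.lcmWeights) (a : X.CubicAlgebra)
    (ha : a ∈ X.fineCubicGrading x) : (X.cyclicAction ζ hζ (.ofAdd g)).1 a =
      AddChar.zmodChar X.lcmWeights (IsPrimitiveRoot.coe_units_iff.2 hζ).pow_eq_one (g * x.2) •
        a := by
  obtain ⟨f, hf, rfl⟩ := ha
  obtain ⟨n, rfl⟩ := ZMod.natCast_zmod_surjective g
  have e : X.cyclicAction ζ hζ (.ofAdd (n : ZMod X.lcmWeights)) = X.cyclicGenerator ζ hζ ^ n := by
    have h1 : X.cyclicAction ζ hζ (.ofAdd (1 : ZMod X.lcmWeights)) = X.cyclicGenerator ζ hζ := by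
      have h := ZMod.lift_coe X.lcmWeights
        ⟨zmultiplesHom _ (Additive.ofMul (X.cyclicGenerator ζ hζ)), by
          rw [zmultiplesHom_apply, natCast_zsmul, ← ofMul_pow, cyclicGenerator_pow, ofMul_one]⟩ 1
      rw [Int.cast_one] at h
      refine (congrArg Additive.toMul h).trans ?_
      simp
    rw [← h1, ← map_pow, ← ofAdd_nsmul, nsmul_one]
  rw [e]
  change (X.cyclicGenerator ζ hζ ^ n).1 (Ideal.Quotient.mk _ f) = _ • Ideal.Quotient.mk _ f
  refine (diagQuotientAut_pow_mk X.cubic (fun _ => (1 : ℤ)) _ _ n f).trans ?_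
  change _ = Ideal.Quotient.mk _ (_ • f)
  congr 1
  ext d
  rw [coeff_diagAut, MvPolynomial.coeff_smul, smul_eq_mul]
  by_cases hd : f.coeff d = 0
  · rw [hd, mul_zero, mul_zero]
  congr 1
  have hx : x.2 = ((∑ i, d i * tubularExponents X.weights i : ℕ) : ZMod X.lcmWeights) := by
    rw [← hf hd, Finsupp.weight_eq_sum, Prod.snd_sum]
    push_cast
    refine Finset.sum_congr rfl fun i _ => ?_
    simp [cubicDegree]
  rw [hx, ← Nat.cast_mul, AddChar.zmodChar_apply', Finsupp.prod_fintype _ _ (by simp),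
    Finset.mul_sum, ← Finset.prod_pow_eq_pow_sum]
  refine Finset.prod_congr rfl fun i _ => ?_
  simp only [Pi.pow_apply, Units.val_pow_eq_pow_val, ← pow_mul]
  congr 1
  ring

/-- Both sides are equivalent to `qmod` of the algebra of the cubic with its fine grading. -/
theorem IsTubular.nonempty_twist_equivalence (hX : X.IsTubular) (ζ : kˣ)
    (hζ : IsPrimitiveRoot ζ X.lcmWeights) :
    Nonempty (QMod X.coordGrading ≌ (qmodTwistAction (X.cyclicAction ζ hζ)).EquivariantObject) := by
  have : NeZero X.lcmWeights := ⟨X.lcmWeights_pos.ne'⟩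
  have hζ' := IsPrimitiveRoot.coe_units_iff.2 hζ
  obtain ⟨-, _, _, hψ⟩ := hX.isCubicVeronese
  obtain ⟨e⟩ := hψ.nonempty_qmod_equivalence positivelyGraded_coordGrading
    hX.positivelyGraded_fineCubicGrading
  obtain ⟨e'⟩ := GradedModFP.nonempty_qmod_equivalence_twist hX.isCoarsening_fineCubicGrading
    (cyclicAction_apply ζ hζ) (AddChar.zmodChar_primitive_of_primitive_root _ hζ')
    hζ'.neZero'.out hX.positivelyGraded_fineCubicGrading hX.positivelyGraded_cubicGrading
  exact ⟨e.trans e'⟩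

end WeightedProjectiveLine

theorem mainTheorem1 {k : Type*} [Field k] (X : WeightedProjectiveLine k) (hX : X.IsTubular) :
    Nonempty ((qmodShiftAction X.coordGrading
        (AddSubgroup.zmultiples X.dualizing)).EquivariantObject ≌ QMod X.cubicGrading) ∧
    (IsSplittingFieldOfGroup k (Multiplicative (ZMod X.lcmWeights)) →
      (∃ ζ : kˣ, IsPrimitiveRoot ζ X.lcmWeights) ∧
      ∀ (ζ : kˣ) (hζ : IsPrimitiveRoot ζ X.lcmWeights),
        Nonempty (QMod X.coordGrading ≌
          (qmodTwistAction (X.cyclicAction ζ hζ)).EquivariantObject)) := by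
  have : NeZero X.lcmWeights := ⟨X.lcmWeights_pos.ne'⟩
  exact ⟨hX.nonempty_shift_equivalence,
    fun h => ⟨h.exists_isPrimitiveRoot, hX.nonempty_twist_equivalence⟩⟩
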